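/- **Setting.** Let $G_1,G_2$ be simple graphs on $[n]$ with adjacency matrices $A,B$, let $q\in(0,1)$, and let $\bar A=A-\mathbb E A$, $\bar B=B-\mathbb E B$ be the matrices centred at the mean of the Erdős–Rényi graph $\mathcal G(n,q)$ (so $\bar A_{ij}=A_{ij}-q$ for $i\ne j$ and $\bar A_{ii}=0$, and likewise for $\bar B$). For $K\ge1$ let $\mathcal T=\mathcal T_K$ be the set of unlabelled trees with $K$ edges, and let $\alpha\approx0.33833$ be Otter's constant, $|\mathcal T_K|^{1/K}\to1/\alpha$ as $K\to\infty$. Put $$r=\frac{(K+1)!}{(K+1)^{K+1}},\qquad t=\lceil 1/r\rceil .$$ For a tree $H$ with $K$ edges, a symmetric matrix $M$ on $[n]$ and a colouring $\mu:[n]\to[K+1]$ let $$X_H(M,\mu)=\sum_{S\cong H}\chi_\mu(V(S))\prod_{(i,j)\in E(S)}M_{ij},$$ the sum over the subgraphs $S$ of the complete graph on $[n]$ isomorphic to $H$, where $\chi_\mu(V)=1$ if $\mu$ is injective on $V$ and $\chi_\mu(V)=0$ otherwise. Let $\mathsf{aut}(H)$ be the number of automorphisms of $H$. For independent uniformly random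 colourings $\mu_1,\dots,\mu_t,\nu_1,\dots,\nu_t:[n]\to[K+1]$ let $$Y_{\mathcal T}(A,B)=\sum_{[H]\in\mathcal T}\mathsf{aut}(H)\Bigl(\frac1t\sum_{i=1}^tX_H(\bar A,\mu_i)\Bigr)\Bigl(\frac1t\sum_{j=1}^tX_H(\bar B,\nu_j)\Bigr).$$ **Algorithm 1** (input $\bar A,\bar B,K$). (1) List $\mathcal T$ by the level-sequence algorithm of Wright, Richmond, Odlyzko and McKay. (2) For each $[H]\in\mathcal T$ compute $\mathsf{aut}(H)$ from the multiplicities of isomorphic subtrees at siblings in $H$ rooted at a centre, with an additional factor $2$ if $H$ has two centres and its two halves are isomorphic. (3) Compute $t$ and draw the colours of $\mu_1,\dots,\mu_t,\nu_1,\dots,\nu_t$ independently and uniformly. (4) For $i=1,\dots,t$ and each $H\in\mathcal T$ compute $X_H(\bar A,\mu_i)$ and $X_H(\bar B,\nu_i)$ by Algorithm 2. (5) Output $Y_{\mathcal T}(A,B)$ by its defining formula. **Algorithm 2** (input $M,\mu,H,\mathsf{aut}(H)$). Root $H$ and label its edges $e_1,\dots,e_K$ in the reverse of a depth-first order; write $e_i=(p_i,c_i)$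 with $p_i$ the parent of $c_i$. Let $T_i$, rooted at $p_i$, be the maximal tree containing $e_i$ in the forest $\{e_1,\dots,e_i\}$, let $a_i$ (resp. $b_i$) be the largest $j<i$ such that $e_j$ is incident to $p_i$ (resp. $c_i$), or $0$ if there is none, and let $T_0$ be a one-vertex tree. Put $Y(x,T_0,C)=\mathbf 1\{\{\mu(x)\}=C\}$, and for $i=1,\dots,K$ compute, for all $x\in[n]$ and all $C\subset[K+1]$ with $|C|=|V(T_i)|$, $$Y(x,T_i,C)=\sum_{y\ne x}\ \sum_{\substack{C_1\sqcup C_2=C\\ C_1,C_2\neq\emptyset}}Y(x,T_{a_i},C_1)\,Y(y,T_{b_i},C_2)\,M_{xy}$$ (values at colour sets of other sizes are $0$). Output $\frac1{\mathsf{aut}(H)}\sum_{x}Y(x,T_K,[K+1])$. Time is the number of elementary steps of a real RAM at unit cost: arithmetic on numbers, comparisons, reading or writing an array cell, elementary list operations, operations on sets of colours stored as words of $K+1$ bits, drawing a uniform colour. **Proposition.** For every outcome of its random colourings, which are independent and uniform, Algorithm 1 computes $Y_{\mathcal T}(A,B)$, and it takes time $O\bigl(n^2(3e/\alpha)^K\bigr)$: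 there is an absolute constant $C>0$ such that for all $n\ge1$, $K\ge1$, $q\in(0,1)$ and all graphs $G_1,G_2$ on $[n]$, every run takes at most $C\,n^2(3e/\alpha)^K$ steps. Furthermore, let $q=q_n\in(0,1)$, $K=K_n$ and $\rho=\rho_n\in\bigl[-\min\{\tfrac q{1-q},\tfrac{1-q}q\},1\bigr]$ satisfy, as $n\to\infty$, $$n\min\{q,1-q\}\ge n^{-o(1)},\qquad \rho^2>\alpha,\qquad \omega(1)\le K\le\frac{\log n}{16\log\log n\ \vee\ 2\log\bigl(\frac1{n\min\{q,1-q\}}\bigr)} .$$ Then the running time is $n^{2+o(1)}$: there is a sequence $\delta_n\to0$ such that for all large $n$ and all graphs $G_1,G_2$ on $[n]$ every run takes at most $n^{2+\delta_n}$ steps. -/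

import Mathlib

open Filter Topology

/-! ### Trees, colourings and the statistic -/

namespace TreeStat

/-- Isomorphism of trees with `K` edges (realised on the vertex set `Fin (K + 1)`). -/
instance treeSetoid (K : ℕ) : Setoid {H : SimpleGraph (Fin (K + 1)) // H.IsTree} where
  r H H' := Nonempty (H.1 ≃g H'.1)
  iseqv :=
    { refl := fun _ => ⟨SimpleGraph.Iso.refl⟩
      symm := fun ⟨f⟩ => ⟨f.symm⟩
      trans := fun ⟨f⟩ ⟨g⟩ => ⟨f.trans g⟩ }

/-- The set of unlabelled trees with `K` edges: isomorphism classes of trees. -/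
abbrev UnlabeledTree (K : ℕ) : Type := Quotient (treeSetoid K)

noncomputable instance (K : ℕ) : Fintype (UnlabeledTree K) := Fintype.ofFinite _

/-- A tree in the isomorphism class `τ`. -/
noncomputable def UnlabeledTree.graph {K : ℕ} (τ : UnlabeledTree K) :
    SimpleGraph (Fin (K + 1)) := τ.out.1

/-- Otter's constant `α ≈ 0.33833`, given by `|𝒯_K|^(1/K) → 1/α` where `𝒯_K` is the set of
unlabelled trees with `K` edges. (The limit exists by a theorem of Otter; taking the upper limit
makes the definition independent of this theorem.) -/
noncomputable def otterConstant : ℝ :=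
  (limsup (fun K : ℕ => (Nat.card (UnlabeledTree K) : ℝ) ^ (1 / (K : ℝ))) atTop)⁻¹

/-- The number of automorphisms of a graph. -/
noncomputable def aut {V : Type} (H : SimpleGraph V) : ℕ := Nat.card (H ≃g H)

/-- A colouring of the `n` vertices of the host graph by `K + 1` colours. -/
abbrev Coloring (n K : ℕ) : Type := Fin n → Fin (K + 1)

open Classical in
/-- The indicator that the vertices in `V` have pairwise distinct colours. -/
noncomputable def colorful {n K : ℕ} (μ : Coloring n K) (V : Set (Fin n)) : ℝ :=
  if Set.InjOn μ V then 1 else 0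

open Classical in
/-- `X_H(M, μ) = ∑_{S ≅ H} χ_μ(V(S)) ∏_{(i,j) ∈ E(S)} M i j`, the sum over all subgraphs `S` of the
complete graph on `Fin n` that are isomorphic to `H`; an edge is listed as the pair `i < j`. -/
noncomputable def colorfulCount {n K : ℕ} (H : SimpleGraph (Fin (K + 1)))
    (M : Matrix (Fin n) (Fin n) ℝ) (μ : Coloring n K) : ℝ :=
  ∑ S : (⊤ : SimpleGraph (Fin n)).Subgraph with Nonempty (S.coe ≃g H),
    colorful μ S.verts * ∏ e : Fin n × Fin n with e.1 < e.2 ∧ S.Adj e.1 e.2, M e.1 e.2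

/-- The probability `r = (K+1)! / (K+1)^(K+1)` that `K + 1` vertices are colourful. -/
noncomputable def colorfulProb (K : ℕ) : ℝ :=
  ((K + 1).factorial : ℝ) / ((K : ℝ) + 1) ^ (K + 1)

/-- The number `t = ⌈1/r⌉` of random colourings for each of the two graphs. -/
noncomputable def numRounds (K : ℕ) : ℕ := ⌈1 / colorfulProb K⌉₊

open Classical in
/-- The centred adjacency matrix `A - 𝔼 A` of `G`, where `𝔼 A` is the mean of the adjacency matrix
of the Erdős–Rényi graph `𝒢(n, q)`: `q` off the diagonal and `0` on it. -/
noncomputable def centeredAdj {n : ℕ} (q : ℝ) (G : SimpleGraph (Fin n)) :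
    Matrix (Fin n) (Fin n) ℝ :=
  Matrix.of fun i j => if i = j then 0 else (if G.Adj i j then 1 else 0) - q

/-- The statistic
`Y = ∑_{[H]} aut(H) (1/t ∑_i X_H(Abar, μ_i)) (1/t ∑_j X_H(Bbar, ν_j))`, the sum over all unlabelled
trees with `K` edges, as a function of the centred matrices and of the colourings. -/
noncomputable def statisticY {n K : ℕ} (Abar Bbar : Matrix (Fin n) (Fin n) ℝ)
    (μ ν : Fin (numRounds K) → Coloring n K) : ℝ :=
  ∑ τ : UnlabeledTree K, (aut τ.graph : ℝ) *
    ((1 / (numRounds K : ℝ)) * ∑ i, colorfulCount τ.graph Abar (μ i)) *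
    ((1 / (numRounds K : ℝ)) * ∑ j, colorfulCount τ.graph Bbar (ν j))

/-- The parameter regime, for sequences `q`, `ρ`, `K` indexed by the number `n` of vertices:
`n min{q, 1-q} ≥ n^(-o(1))`, `ρ² > α` and
`ω(1) ≤ K ≤ log n / max{16 log log n, 2 log (1 / (n min{q, 1-q}))}`, together with the ranges of the
edge probability `q` and of the correlation coefficient `ρ` of two Bernoulli(`q`) variables. -/
structure Regime (q ρ : ℕ → ℝ) (K : ℕ → ℕ) : Prop where
  q_mem : ∀ᶠ n in atTop, 0 < q n ∧ q n < 1
  ρ_mem : ∀ᶠ n in atTop,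
    -min (q n / (1 - q n)) ((1 - q n) / q n) ≤ ρ n ∧ ρ n ≤ 1
  density : ∃ ε : ℕ → ℝ, Tendsto ε atTop (𝓝 0) ∧
    ∀ᶠ n : ℕ in atTop, (n : ℝ) ^ (-ε n) ≤ n * min (q n) (1 - q n)
  correlation : ∀ᶠ n in atTop, otterConstant < ρ n ^ 2
  K_tendsto : Tendsto K atTop atTop
  K_le : ∀ᶠ n : ℕ in atTop, (K n : ℝ) ≤ Real.log n /
    max (16 * Real.log (Real.log n)) (2 * Real.log (1 / (n * min (q n) (1 - q n))))

end TreeStat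

/-! ### Step-counted computations

A real RAM at unit cost: an elementary step is one arithmetic operation on, or comparison of, two
numbers, one read or write of an array cell, one list operation at an end of a list, or one
operation on a set of colours, which is stored as a machine word with one bit per colour. -/

/-- A result together with the number of elementary steps spent on it. -/
structure Timed (α : Type) where
  val : α
  time : ℕ

namespace Timed

instance : Monad Timed where
  pure a := ⟨a, 0⟩
  bind x f := ⟨(f x.val).val, x.time + (f x.val).time⟩

/-- One elementary step with result `a`. -/
def op {α : Type} (a : α) : Timed α := ⟨a, 1⟩

/-- `k` elementary steps with result `a` (for copying a stretch of a list entry by entry). -/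
def steps {α : Type} (k : ℕ) (a : α) : Timed α := ⟨a, k⟩

/-- A loop that runs `f` on each key and stores the results in a fresh array, all of whose other
cells are `0`. -/
def tabulate {ι R : Type} [DecidableEq ι] [Zero R] (f : ι → Timed R) : List ι → Timed (ι → R)
  | [] => op fun _ => 0
  | k :: l => do
    let a ← f k
    let tab ← tabulate f l
    op (Function.update tab k a)

/-- A loop that adds up the results of `f`. -/
def sumOver {ι R : Type} [AddMonoid R] (f : ι → Timed R) : List ι → Timed R
  | [] => op 0
  | k :: l => do
    let a ← f k
    let s ← sumOver f l
    op (a + s)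

/-- A loop that lists the results of `f`. -/
def mapList {ι R : Type} (f : ι → Timed R) : List ι → Timed (List R)
  | [] => op []
  | k :: l => do
    let a ← f k
    let s ← mapList f l
    op (a :: s)

end Timed

/-- A randomised step-counted computation: the law of its result and number of steps. -/
def RandTimed (α : Type) : Type := PMF (Timed α)

namespace RandTimed

noncomputable instance : Monad RandTimed where
  pure a := PMF.pure ⟨a, 0⟩
  bind x f := PMF.bind x fun a =>
    PMF.map (fun b => (⟨b.val, a.time + b.time⟩ : Timed _)) (f a.val)

/-- A deterministic computation. -/
noncomputable def lift {α : Type} (x : Timed α) : RandTimed α := PMF.pure x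

/-- One step that draws a uniform element, independently of all other draws. -/
noncomputable def draw (α : Type) [Fintype α] [Nonempty α] : RandTimed α :=
  PMF.map Timed.op (PMF.uniformOfFintype α)

/-- The law of the result. -/
noncomputable def law {α : Type} (x : RandTimed α) : PMF α := PMF.map Timed.val x

/-- Every possible run takes at most `T` steps. -/
def RunsWithin {α : Type} (x : RandTimed α) (T : ℝ) : Prop :=
  ∀ y ∈ PMF.support x, (y.time : ℝ) ≤ T

end RandTimed

/-! ### Listing the free trees

A tree rooted at a vertex is stored as its level sequence: the list of the depths of its vertices in
the order of a depth-first search, so that vertex `j` is the entry of index `j`. -/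

namespace FreeTrees

open Timed

/-- Read an entry; past the end of the list there is a sentinel `0`. -/
def rd (L : List ℕ) (i : ℕ) : Timed ℕ := op (L.getD i 0)

/-- The last index `q` in `1, …, s` with entry `l`; `0` if there is none. -/
def findLevel (L : List ℕ) (l : ℕ) : ℕ → Timed ℕ
  | 0 => op 0
  | q + 1 => do
    let a ← rd L (q + 1)
    if ← op (decide (a = l)) then op (q + 1) else findLevel L l q

/-- The parent of the vertex `j`. -/
def parent (L : List ℕ) (j : ℕ) : Timed ℕ := do
  let a ← rd L j
  let l ← op (a - 1)
  let s ← op (j - 1)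
  findLevel L l s

/-- The last index in `1, …, s` whose entry is not `1`; `0` if there is none. -/
def lastDeep (L : List ℕ) : ℕ → Timed ℕ
  | 0 => op 0
  | p + 1 => do
    let a ← rd L (p + 1)
    if ← op (decide (a = 1)) then lastDeep L p else op (p + 1)

/-- Append `k` entries, each a copy of the entry `d` places before it. -/
def pushCopies (d : ℕ) : ℕ → List ℕ → Timed (List ℕ)
  | 0, acc => op acc
  | k + 1, acc => do
    let i ← op (acc.length - d)
    let a ← rd acc i
    let acc' ← op (acc ++ [a])
    pushCopies d k acc'

/-- Successor step of Beyer and Hedetniemi at position `p`: from position `p` on, repeat the stretch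
that begins at the parent of `p` and ends before `p`. -/
def successorAt (L : List ℕ) (p : ℕ) : Timed (List ℕ) := do
  let q ← parent L p
  let d ← op (p - q)
  let k ← op (L.length - p)
  let pre ← steps p (L.take p)
  pushCopies d k pre

/-- The successor of a level sequence in the list of all rooted trees. -/
def nextRooted (L : List ℕ) : Timed (Option (List ℕ)) := do
  let s ← op (L.length - 1)
  let p ← lastDeep L s
  if ← op (decide (p = 0)) then op none
  else do
    let L' ← successorAt L p
    op (some L')

/-- The first index in `i, …, i + k - 1` whose entry is `1`; `i + k` if there is none. -/
def findOne (L : List ℕ) : ℕ → ℕ → Timed ℕ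
  | 0, i => op i
  | k + 1, i => do
    let a ← rd L i
    if ← op (decide (a = 1)) then op i
    else do
      let j ← op (i + 1)
      findOne L k j

/-- The subtree of the first child of the root, and the tree that is left after removing it. -/
def split (L : List ℕ) : Timed (List ℕ × List ℕ) := do
  let k ← op (L.length - 2)
  let m ← findOne L k 2
  let left ← steps m (((L.take m).drop 1).map fun a => a - 1)
  let rest ← steps L.length (0 :: L.drop m)
  op (left, rest)

/-- The height of a tree. -/
def height : List ℕ → Timed ℕ
  | [] => op 0
  | a :: l => do
    let b ← height l
    op (max a b)

/-- Is the first list lexicographically greater than the second one? -/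
def lexGreater : List ℕ → List ℕ → Timed Bool
  | [], _ => op false
  | _ :: _, [] => op true
  | a :: l, b :: l' => do
    if ← op (decide (b < a)) then op true
    else if ← op (decide (a < b)) then op false
    else lexGreater l l'

/-- Is the root the centre by which the free tree is represented? The first subtree must not be
higher than the rest, and if the heights agree, it must not be larger, nor, if the sizes agree too,
lexicographically greater. -/
def isPrimary (left rest : List ℕ) : Timed Bool := do
  let hl ← height left
  let hr ← height rest
  if ← op (decide (hr < hl)) then op false
  else if ← op (decide (hl < hr)) then op true
  else if ← op (decide (rest.length < left.length)) then op false
  else if ← op (decide (left.length < rest.length)) then op true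
  else do
    let g ← lexGreater left rest
    op !g

/-- Step of Wright, Richmond, Odlyzko and McKay: the first level sequence, from `L` on, that
represents a free tree. -/
def nextFree (L : List ℕ) : Timed (List ℕ) := do
  let lr ← split L
  if ← isPrimary lr.1 lr.2 then op L
  else do
    let p ← op lr.1.length
    let L' ← successorAt L p
    let a ← rd L p
    if ← op (decide (2 < a)) then do
      let lr' ← split L'
      let h ← height lr'.1
      let s ← op (h + 1)
      let k ← op (L.length - s)
      let pre ← steps k (L'.take k)
      steps s (pre ++ List.range' 1 s)
    else op L'

/-- The main loop of the generation; the first argument only bounds the number of rounds, so that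
the recursion is structural. -/
def generate : ℕ → List ℕ → Timed (List (List ℕ))
  | 0, _ => op []
  | f + 1, L => do
    let L' ← nextFree L
    let next ← nextRooted L'
    match next with
    | none => op [L']
    | some L'' => do
      let l ← generate f L''
      op (L' :: l)

/-- Level sequences of all free trees with `K ≥ 1` edges, each once and rooted at a centre: the
generation starts with the path, rooted at a centre, and ends after the star (long before `4 ^ K`
rounds have passed). -/
def freeTrees (K : ℕ) : Timed (List (List ℕ)) := do
  let start ← steps (K + 1) (List.range ((K + 1) / 2 + 1) ++ List.range' 1 ((K + 2) / 2 - 1))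
  generate (4 ^ K) start

/-! ### The number of automorphisms of a tree

The tree is rooted at a centre and its level sequence is canonical, so isomorphic subtrees of
siblings follow each other and have equal level sequences. The number of automorphisms fixing the
root is the product, over all vertices and all isomorphism classes of subtrees of its children, of
the factorials of the multiplicities. -/

/-- The last index `u` in `1, …, s` with entry at most `l`; `0` if there is none. -/
def findAtMost (L : List ℕ) (l : ℕ) : ℕ → Timed ℕ
  | 0 => op 0
  | u + 1 => do
    let a ← rd L (u + 1)
    if ← op (decide (a ≤ l)) then op (u + 1) else findAtMost L l u

/-- Compare the entries after `u` and after `v`, at the offsets `j, …, j + k - 1`, and check that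
the subtree of `v`, whose depth is `l`, ends at offset `j + k`. -/
def sameEntries (L : List ℕ) (u v l : ℕ) : ℕ → ℕ → Timed Bool
  | 0, j => do
    let i ← op (v + j)
    let a ← rd L i
    op (decide (a ≤ l))
  | k + 1, j => do
    let i ← op (u + j)
    let a ← rd L i
    let i' ← op (v + j)
    let b ← rd L i'
    if ← op (decide (a = b)) then do
      let j' ← op (j + 1)
      sameEntries L u v l k j'
    else op false

/-- Number the isomorphic siblings: the vertex `v` gets the number of its left neighbour among its
siblings plus one if their subtrees agree, and `1` otherwise. The numbers of the vertices before `v`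
are stored in `ms`. -/
def siblingNumber (L ms : List ℕ) (v : ℕ) : Timed ℕ := do
  let l ← rd L v
  let s ← op (v - 1)
  let u ← findAtMost L l s
  let l' ← rd L u
  if ← op (decide (l' = l)) then do
    let d ← op (v - u)
    if ← sameEntries L u v l d 0 then do
      let m ← rd ms u
      op (m + 1)
    else op 1
  else op 1

/-- The product of the numbers of the vertices `v, …, v + k - 1` and of `prod`. -/
def siblingProduct (L : List ℕ) : ℕ → ℕ → List ℕ → ℕ → Timed ℕ
  | 0, _, _, prod => op prod
  | k + 1, v, ms, prod => do
    let m ← siblingNumber L ms v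
    let ms' ← op (ms ++ [m])
    let prod' ← op (prod * m)
    let v' ← op (v + 1)
    siblingProduct L k v' ms' prod'

/-- The number of automorphisms of the tree: the number of those that fix the root, doubled if the
tree has two centres and its two halves are isomorphic. -/
def autCount (L : List ℕ) : Timed ℕ := do
  let k ← op (L.length - 1)
  let a ← siblingProduct L k 1 [1] 1
  let lr ← split L
  let g ← lexGreater lr.1 lr.2
  let g' ← lexGreater lr.2 lr.1
  if ← op (g || g') then op a else op (2 * a)

end FreeTrees

/-! ### Colour coding: computation of `X_H(M, μ)` by dynamic programming -/

namespace ColorCoding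

open Timed FreeTrees

/-- Insert a colour into each of the listed sets. -/
def insertAll {K : ℕ} (c : Fin (K + 1)) :
    List (Finset (Fin (K + 1))) → Timed (List (Finset (Fin (K + 1)))) :=
  mapList fun C => op (insert c C)

/-- The sets of `s` colours among the given ones. -/
def subsetsOfSize {K : ℕ} : ℕ → List (Fin (K + 1)) → Timed (List (Finset (Fin (K + 1))))
  | 0, _ => op [∅]
  | _ + 1, [] => op []
  | s + 1, c :: cs => do
    let r ← subsetsOfSize s cs
    let r' ← insertAll c r
    let r'' ← subsetsOfSize (s + 1) cs
    steps (r'.length + 1) (r' ++ r'')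

/-- Put the colour `c` into the first or into the second part of each of the listed pairs. -/
def distribute {K : ℕ} (c : Fin (K + 1)) :
    List (Finset (Fin (K + 1)) × Finset (Fin (K + 1))) →
      Timed (List (Finset (Fin (K + 1)) × Finset (Fin (K + 1))))
  | [] => op []
  | (P, Q) :: l => do
    let P' ← op (insert c P)
    let Q' ← op (insert c Q)
    let l' ← distribute c l
    let l'' ← op ((P, Q') :: l')
    op ((P', Q) :: l'')

/-- The pairs `(C₁, C₂)` of disjoint sets whose union consists of the given colours that lie
in `C`. -/
def splits {K : ℕ} (C : Finset (Fin (K + 1))) :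
    List (Fin (K + 1)) → Timed (List (Finset (Fin (K + 1)) × Finset (Fin (K + 1))))
  | [] => op [(∅, ∅)]
  | c :: cs => do
    let r ← splits C cs
    if ← op (decide (c ∈ C)) then distribute c r else pure r

/-- A table of the values `Y(x, T, C, μ)` for one tree `T`. -/
abbrev Table (R : Type) (n K : ℕ) : Type := Fin n × Finset (Fin (K + 1)) → R

/-- The table of the tree `T_0` with one vertex: `Y(x, T_0, C, μ) = 1` if `{μ(x)} = C` and `0`
otherwise. -/
def tableZero {R : Type} [Field R] {n K : ℕ} (μ : TreeStat.Coloring n K) :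
    Timed (Table R n K) := do
  let sets ← subsetsOfSize 1 (List.finRange (K + 1))
  tabulate (fun key : Fin n × Finset (Fin (K + 1)) => do
    let c ← op (μ key.1)
    let C ← op ({c} : Finset (Fin (K + 1)))
    if ← op (decide (C = key.2)) then op 1 else op 0) (List.finRange n ×ˢ sets)

/-- One entry of the table of `T_i`, from the tables of `T_{a_i}` and `T_{b_i}`:
`∑_{y ≠ x} ∑_{(C₁, C₂)} Y(x, T_{a_i}, C₁, μ) Y(y, T_{b_i}, C₂, μ) M x y`, the inner sum over the
partitions of `C` into two nonempty sets. -/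
def entry {R : Type} [Field R] {n K : ℕ} (M : Matrix (Fin n) (Fin n) R) (Ya Yb : Table R n K)
    (key : Fin n × Finset (Fin (K + 1))) : Timed R := do
  let parts ← splits key.2 (List.finRange (K + 1))
  sumOver (fun y => do
    if ← op (decide (y = key.1)) then op 0
    else sumOver (fun part => do
      if ← op (decide (part.1 = ∅)) then op 0
      else if ← op (decide (part.2 = ∅)) then op 0
      else do
        let u ← op (Ya (key.1, part.1))
        let v ← op (Yb (y, part.2))
        let w ← op (M key.1 y)
        let uv ← op (u * v)
        op (uv * w)) parts) (List.finRange n)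

/-- The edges `e_i = (p_i, c_i)`, `1 ≤ i ≤ K`, from parent to child, in the reverse order of the
depth-first search: `c_i` is the vertex `K + 1 - i`. -/
def edges (K : ℕ) (L : List ℕ) : Timed (ℕ → ℕ × ℕ) :=
  tabulate (fun i => do
    let c ← op (K + 1 - i)
    let p ← parent L c
    op (p, c)) (List.range' 1 K)

/-- The largest index `j` in `1, …, s` such that `e_j` is incident to `v`; `0` if there is none. -/
def lastIncident (e : ℕ → ℕ × ℕ) (v : ℕ) : ℕ → Timed ℕ
  | 0 => op 0
  | j + 1 => do
    let f ← op (e (j + 1))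
    if ← op (decide (f.1 = v)) then op (j + 1)
    else if ← op (decide (f.2 = v)) then op (j + 1)
    else lastIncident e v j

/-- The arrays of the numbers of vertices and of the tables of the trees `T_0, …, T_i`. Removing
`e_i` from `T_i` leaves `T_{a_i}`, rooted at `p_i`, and `T_{b_i}`, rooted at `c_i`. -/
def tables {R : Type} [Field R] {n K : ℕ} (M : Matrix (Fin n) (Fin n) R)
    (μ : TreeStat.Coloring n K) (e : ℕ → ℕ × ℕ) : ℕ → Timed ((ℕ → ℕ) × (ℕ → Table R n K))
  | 0 => do
    let Y₀ ← tableZero μ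
    let sz ← op (Function.update (fun _ => 0) 0 1)
    let Y ← op (Function.update (fun _ _ => 0) 0 Y₀)
    pure (sz, Y)
  | i + 1 => do
    let (sz, Y) ← tables M μ e i
    let f ← op (e (i + 1))
    let a ← lastIncident e f.1 i
    let b ← lastIncident e f.2 i
    let sa ← op (sz a)
    let sb ← op (sz b)
    let s ← op (sa + sb)
    let Ya ← op (Y a)
    let Yb ← op (Y b)
    let sets ← subsetsOfSize s (List.finRange (K + 1))
    let Yi ← tabulate (entry M Ya Yb) (List.finRange n ×ˢ sets)
    let sz' ← op (Function.update sz (i + 1) s)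
    let Y' ← op (Function.update Y (i + 1) Yi)
    pure (sz', Y')

/-- Computation of `X_H(M, μ)` for the tree `H` with level sequence `L` and `a` automorphisms:
`1 / a ∑_x Y(x, T_K, [K + 1], μ)`. -/
def countColorful {R : Type} [Field R] {n K : ℕ} (M : Matrix (Fin n) (Fin n) R)
    (μ : TreeStat.Coloring n K) (L : List ℕ) (a : ℕ) : Timed R := do
  let e ← edges K L
  let szY ← tables M μ e K
  let YK ← op (szY.2 K)
  let s ← sumOver (fun x => op (YK (x, Finset.univ))) (List.finRange n)
  op (s / (a : R))

/-! ### The whole algorithm -/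

/-- The power `b ^ k` by repeated multiplication. -/
def power (b : ℕ) : ℕ → Timed ℕ
  | 0 => op 1
  | k + 1 => do
    let p ← power b k
    op (p * b)

/-- The factorial of `k`. -/
def fact : ℕ → Timed ℕ
  | 0 => op 1
  | k + 1 => do
    let p ← fact k
    let m ← op (k + 1)
    op (p * m)

/-- The number `t = ⌈(K+1)^(K+1) / (K+1)!⌉` of rounds. -/
def rounds (K : ℕ) : Timed ℕ := do
  let b ← op (K + 1)
  let p ← power b b
  let f ← fact b
  let s ← op (p + f)
  let s' ← op (s - 1)
  op (s' / f)

/-- Each listed tree `H`, with the sums of `X_H(Abar, μ_i)` and of `X_H(Bbar, ν_i)` over the rounds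
so far: the sums after one more round, with the colourings `μ` and `ν`. -/
def addRound {R : Type} [Field R] {n K : ℕ} (Abar Bbar : Matrix (Fin n) (Fin n) R)
    (μ ν : TreeStat.Coloring n K) :
    List ((List ℕ × ℕ) × (R × R)) → Timed (List ((List ℕ × ℕ) × (R × R))) :=
  mapList fun h => do
    let x ← countColorful Abar μ h.1.1 h.1.2
    let y ← countColorful Bbar ν h.1.1 h.1.2
    let sx ← op (h.2.1 + x)
    let sy ← op (h.2.2 + y)
    op (h.1, (sx, sy))

/-- The loop over the rounds. -/
def allRounds {R : Type} [Field R] {n K : ℕ} (Abar Bbar : Matrix (Fin n) (Fin n) R) :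
    List (TreeStat.Coloring n K) → List (TreeStat.Coloring n K) →
      List ((List ℕ × ℕ) × (R × R)) → Timed (List ((List ℕ × ℕ) × (R × R)))
  | μ :: μs, ν :: νs, sums => do
    let sums' ← addRound Abar Bbar μ ν sums
    allRounds Abar Bbar μs νs sums'
  | _, _, sums => op sums

/-- The trees with their numbers of automorphisms. -/
def treesWithAut (K : ℕ) : Timed (List (List ℕ × ℕ)) := do
  let T ← freeTrees K
  mapList (fun L => do
    let a ← autCount L
    op (L, a)) T

/-- The part of the algorithm after the colourings have been drawn. -/
def evaluate {R : Type} [Field R] {n K : ℕ} (Abar Bbar : Matrix (Fin n) (Fin n) R)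
    (t : ℕ) (T : List (List ℕ × ℕ)) (μs νs : List (TreeStat.Coloring n K)) : Timed R := do
  let start ← mapList (fun h => op (h, ((0 : R), (0 : R)))) T
  let sums ← allRounds Abar Bbar μs νs start
  sumOver (fun h => do
    let x ← op (h.2.1 / (t : R))
    let y ← op (h.2.2 / (t : R))
    let ax ← op ((h.1.2 : R) * x)
    op (ax * y)) sums

/-- Draw the colours of the listed vertices, one after the other. -/
noncomputable def drawColors (n K : ℕ) : List (Fin n) → RandTimed (TreeStat.Coloring n K)
  | [] => RandTimed.lift (op fun _ => 0)
  | x :: l => do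
    let c ← RandTimed.draw (Fin (K + 1))
    let μ ← drawColors n K l
    RandTimed.lift (op (Function.update μ x c))

/-- Draw `t` random colourings. -/
noncomputable def drawColorings (n K : ℕ) : ℕ → RandTimed (List (TreeStat.Coloring n K))
  | 0 => RandTimed.lift (op [])
  | t + 1 => do
    let μ ← drawColors n K (List.finRange n)
    let l ← drawColorings n K t
    RandTimed.lift (op (μ :: l))

/-- The algorithm. The input consists of `K` and of the two centred adjacency matrices. The result
is the list of the colourings `μ_i` that were drawn, the list of the `ν_i`, and the statistic. -/
noncomputable def algorithm {n : ℕ} (K : ℕ) (Abar Bbar : Matrix (Fin n) (Fin n) ℝ) :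
    RandTimed (List (TreeStat.Coloring n K) × List (TreeStat.Coloring n K) × ℝ) := do
  let T ← RandTimed.lift (treesWithAut K)
  let t ← RandTimed.lift (rounds K)
  let μs ← drawColorings n K t
  let νs ← drawColorings n K t
  let y ← RandTimed.lift (evaluate Abar Bbar t T μs νs)
  pure (μs, νs, y)

end ColorCoding

/-!
A rooted tree with ordered children is a `PlaneTree`, and its level sequence determines it. Sorting
the subtrees of siblings in decreasing order shows that the canonical plane trees represent the
rooted trees up to isomorphism (`PlaneTree.eq_of_rootIsomorphic`). A free tree is represented by the
canonical tree rooted at a centre, and by a fixed rule if there are two centres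
(`PlaneTree.eq_of_isPrimary`, `PlaneTree.exists_isPrimary`). Two facts make the listing correct. The
periodic extension of a canonical sequence is the largest canonical sequence that falls below it at
or before a given position (`PlaneTree.exists_successor`). If a sequence is not primary, then
everything between it and the sequence to which the algorithm jumps is not primary either
(`FreeTrees.nextFree_spec`). Hence the loop visits every free tree once, in decreasing order
(`FreeTrees.freeTrees_spec`), with `O(K)` steps for each.

An automorphism of a tree that fixes the root permutes the children with isomorphic subtrees, which
are adjacent in a canonical tree. So the number of these automorphisms is the product of the
positions of the vertices among their equal preceding siblings. If the tree has two centres and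
equal halves, the exchange of the halves gives a factor `2` (`PlaneTree.card_aut`,
`FreeTrees.val_autCount`).

Each round of colour coding cuts a subtree at the edge from its root to its first child. By
induction a table holds the sums of the edge products over the maps of the subtree into `[n]` that
are injective on colours and use a given set of colours (`PlaneTree.treeSum_eq`,
`ColorCoding.val_tables`). The maps of the whole tree with a given image are as many as the tree has
automorphisms, which gives `X_H(M, μ)` (`ColorCoding.val_countColorful`). A table for a subtree with
`s` vertices takes about `n² * (K + 1).choose s * 2 ^ s` steps. At each cut the smaller part has at
most half of the vertices, so that, up to `O(K²)` terms of size `O(8 ^ (K / 2))`, every `s` occurs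
at most once. The sum over all `s` is `3 ^ (K + 1)`, and one tree and one colouring take `O(n² 3 ^
K)` steps (`ColorCoding.exists_time_countColorful_le`).

There are `O(e ^ K)` rounds, by the exponential series, and `O(α⁻¹ ^ K)` trees. The latter has to be
shown without a polynomial loss, and with `α` defined by an upper limit. Joining two trees with `K`
edges by an edge shows that the number `N K` of trees satisfies `(N K) ^ 2 ≤ 2 * N (2 * K + 1)`,
because only one edge of the result cuts it into equal halves. Iterating this along the doublings of
a given `K` gives `N K ≤ 2 * α⁻¹ ^ (K + 1)` (`TreeStat.card_unlabeledTree_le_growthRate`). The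
product of the three bounds is the bound for the time. In the second part `K` is `O(log n / log log
n)`, so that `(3 e / α) ^ K` is `n ^ o(1)`.
-/

/-! ### Joining two graphs by an edge -/

namespace SimpleGraph

/-- Two graphs joined by a new edge between `a` and `b`. -/
def joinEdge {V W : Type} (G : SimpleGraph V) (H : SimpleGraph W) (a : V) (b : W) :
    SimpleGraph (V ⊕ W) :=
  (G ⊕g H) ⊔ edge (.inl a) (.inr b)

section joinEdge

variable {V W V' W' X : Type} {G : SimpleGraph V} {H : SimpleGraph W} {a : V} {b : W}
  {G' : SimpleGraph V'} {H' : SimpleGraph W'} {a' : V'} {b' : W'} {F : SimpleGraph X}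

@[simp] lemma joinEdge_inl_inl {u v : V} :
    (joinEdge G H a b).Adj (.inl u) (.inl v) ↔ G.Adj u v := by
  simp [joinEdge, edge_adj]

@[simp] lemma joinEdge_inr_inr {u v : W} :
    (joinEdge G H a b).Adj (.inr u) (.inr v) ↔ H.Adj u v := by
  simp [joinEdge, edge_adj]

@[simp] lemma joinEdge_inl_inr {u : V} {v : W} :
    (joinEdge G H a b).Adj (.inl u) (.inr v) ↔ u = a ∧ v = b := by
  simp [joinEdge, edge_adj]

@[simp] lemma joinEdge_inr_inl {u : V} {v : W} :
    (joinEdge G H a b).Adj (.inr v) (.inl u) ↔ u = a ∧ v = b := by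
  rw [adj_comm, joinEdge_inl_inr]

lemma IsTree.joinEdge (hG : G.IsTree) (hH : H.IsTree) : (joinEdge G H a b).IsTree := by
  refine ⟨hG.connected.sum_sup_edge hH.connected, ?_⟩
  refine IsAcyclic.sup_edge_of_not_reachable (not_reachable_sum_inl_inr _ _) ?_
  -- in the disjoint sum every edge is a bridge, as it is one on its own side
  rw [isAcyclic_iff_forall_adj_isBridge]
  have key : ∀ {x y : V ⊕ W}, (G ⊕g H).Adj x y → ((G ⊕g H).deleteEdges {s(x, y)}).Reachable x y →
      False := by
    rintro (x | x) (y | y) hxy hr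
    · -- a path in the sum that begins on the left stays there
      have hb := isAcyclic_iff_forall_adj_isBridge.1 hG.isAcyclic (show G.Adj x y by simpa using hxy)
      apply hb
      have : ∀ {u w : V ⊕ W}, ((G ⊕g H).deleteEdges {s(.inl x, .inl y)}).Reachable u w →
          ∀ u', u = .inl u' → ∃ w', w = .inl w' ∧ (G.deleteEdges {s(x, y)}).Reachable u' w' := by
        rintro u w ⟨p⟩
        induction p with
        | nil => exact fun u' h => ⟨u', h, Reachable.refl _⟩
        | @cons u v w h p ih =>
          rintro u' rfl
          rcases v with v | v
          · obtain ⟨w', hw, hr⟩ := ih v rfl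
            refine ⟨w', hw, Reachable.trans (Adj.reachable ?_) hr⟩
            simpa using h
          · simp at h
      obtain ⟨w', hw, hr⟩ := this hr x rfl
      simp only [Sum.inl.injEq] at hw
      subst hw; exact hr
    · simp at hxy
    · simp at hxy
    · have hb := isAcyclic_iff_forall_adj_isBridge.1 hH.isAcyclic (show H.Adj x y by simpa using hxy)
      apply hb
      have : ∀ {u w : V ⊕ W}, ((G ⊕g H).deleteEdges {s(.inr x, .inr y)}).Reachable u w →
          ∀ u', u = .inr u' → ∃ w', w = .inr w' ∧ (H.deleteEdges {s(x, y)}).Reachable u' w' := by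
        rintro u w ⟨p⟩
        induction p with
        | nil => exact fun u' h => ⟨u', h, Reachable.refl _⟩
        | @cons u v w h p ih =>
          rintro u' rfl
          rcases v with v | v
          · simp at h
          · obtain ⟨w', hw, hr⟩ := ih v rfl
            refine ⟨w', hw, Reachable.trans (Adj.reachable ?_) hr⟩
            simpa using h
      obtain ⟨w', hw, hr⟩ := this hr x rfl
      simp only [Sum.inr.injEq] at hw
      subst hw; exact hr
  exact fun x y h hr => key h hr

/-- A connected graph mapped into a join stays on one side if it misses an end of the joining
edge. -/
lemma isLeft_eq_of_preconnected (hF : F.Preconnected) (f : F →g joinEdge G H a b)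
    (h : (∀ x, f x ≠ .inl a) ∨ ∀ x, f x ≠ .inr b) (x y : X) : (f x).isLeft = (f y).isLeft := by
  obtain ⟨p⟩ := hF x y
  induction p with
  | nil => rfl
  | @cons u v w huv p ih =>
    rw [← ih]
    have hadj := f.map_adj huv
    cases hu : f u <;> cases hv : f v <;> simp only [hu, hv] at hadj
    · rfl
    · rw [joinEdge_inl_inr] at hadj
      rcases h with h | h
      · exact absurd (hadj.1 ▸ hu) (h u)
      · exact absurd (hadj.2 ▸ hv) (h v)
    · rw [joinEdge_inr_inl] at hadj
      rcases h with h | h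
      · exact absurd (hadj.1 ▸ hv) (h v)
      · exact absurd (hadj.2 ▸ hu) (h u)
    · rfl

/-- Isomorphisms of the two sides that match the ends of the joining edges give an isomorphism of
the joins. -/
def joinEdgeCongr (α : G ≃g G') (β : H ≃g H') (ha : α a = a') (hb : β b = b') :
    joinEdge G H a b ≃g joinEdge G' H' a' b' where
  toEquiv := Equiv.sumCongr α.toEquiv β.toEquiv
  map_rel_iff' := by
    subst ha hb
    rintro (u | u) (v | v) <;> simp [Iso.map_adj_iff]

/-- The join does not depend on the order of its two sides. -/
def joinEdgeComm : joinEdge G H a b ≃g joinEdge H G b a where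
  toEquiv := Equiv.sumComm V W
  map_rel_iff' := by
    rintro (u | u) (v | v) <;> simp [and_comm]

/-- Two graphs attached to the same graph can be attached in either order. -/
def joinEdgeRightComm {a₁ : V} {c : X} :
    joinEdge (joinEdge G H a b) F (.inl a₁) c ≃g joinEdge (joinEdge G F a₁ c) H (.inl a) b where
  toFun := Sum.elim (Sum.elim (fun u => .inl (.inl u)) .inr) fun x => .inl (.inr x)
  invFun := Sum.elim (Sum.elim (fun u => .inl (.inl u)) .inr) fun x => .inl (.inr x)
  left_inv := by rintro ((u | u) | u) <;> rfl
  right_inv := by rintro ((u | u) | u) <;> rfl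
  map_rel_iff' := by rintro ((u | u) | u) ((v | v) | v) <;> simp

/-- Attaching a graph to the second side of a join. -/
def joinEdgeAssoc {b₁ : W} {c : X} :
    joinEdge (joinEdge G H a b) F (.inr b₁) c ≃g joinEdge G (joinEdge H F b₁ c) a (.inl b) where
  toFun := Sum.elim (Sum.elim .inl fun w => .inr (.inl w)) fun x => .inr (.inr x)
  invFun := Sum.elim (fun u => .inl (.inl u)) (Sum.elim (fun w => .inl (.inr w)) .inr)
  left_inv := by rintro ((u | u) | u) <;> rfl
  right_inv := by rintro (u | u | u) <;> rfl
  map_rel_iff' := by rintro ((u | u) | u) ((v | v) | v) <;> simp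

/-- An isomorphism of joins that respects the sides splits. -/
lemma exists_joinEdgeCongr (φ : joinEdge G H a b ≃g joinEdge G' H' a' b')
    (hl : ∀ u, (φ (.inl u)).isLeft) (hr : ∀ u, (φ (.inr u)).isLeft = false) :
    ∃ (α : G ≃g G') (β : H ≃g H') (ha : α a = a') (hb : β b = b'),
      φ = joinEdgeCongr α β ha hb := by
  have hl' : ∀ u, (φ.symm (.inl u)).isLeft := by
    intro u
    cases h : φ.symm (.inl u) with
    | inl v => rfl
    | inr v => have := hr v; rw [← h] at this; simp at this
  have hr' : ∀ u, (φ.symm (.inr u)).isLeft = false := by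
    intro u
    cases h : φ.symm (.inr u) with
    | inl v => have := hl v; rw [← h] at this; simp at this
    | inr v => rfl
  have hl2 : ∀ u, ∃ v, φ (.inl u) = .inl v := fun u => by
    have := hl u; cases h : φ (.inl u) <;> simp_all
  have hr2 : ∀ u, ∃ v, φ (.inr u) = .inr v := fun u => by
    have := hr u; cases h : φ (.inr u) <;> simp_all
  have hl2' : ∀ u, ∃ v, φ.symm (.inl u) = .inl v := fun u => by
    have := hl' u; cases h : φ.symm (.inl u) <;> simp_all
  have hr2' : ∀ u, ∃ v, φ.symm (.inr u) = .inr v := fun u => by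
    have := hr' u; cases h : φ.symm (.inr u) <;> simp_all
  choose f hf using hl2
  choose g hg using hr2
  choose f' hf' using hl2'
  choose g' hg' using hr2'
  let α : G ≃g G' :=
    { toFun := f
      invFun := f'
      left_inv := fun u => Sum.inl_injective (by rw [← hf', ← hf, RelIso.symm_apply_apply])
      right_inv := fun u => Sum.inl_injective (by rw [← hf, ← hf', RelIso.apply_symm_apply])
      map_rel_iff' := by
        intro u v
        have := φ.map_adj_iff (v := .inl u) (w := .inl v)
        simpa [hf] using this }
  let β : H ≃g H' :=
    { toFun := g
      invFun := g'
      left_inv := fun u => Sum.inr_injective (by rw [← hg', ← hg, RelIso.symm_apply_apply])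
      right_inv := fun u => Sum.inr_injective (by rw [← hg, ← hg', RelIso.apply_symm_apply])
      map_rel_iff' := by
        intro u v
        have := φ.map_adj_iff (v := .inr u) (w := .inr v)
        simpa [hg] using this }
  have hab : f a = a' ∧ g b = b' := by
    have := φ.map_adj_iff (v := .inl a) (w := .inr b)
    simpa [hf, hg] using this
  refine ⟨α, β, hab.1, hab.2, ?_⟩
  ext x
  rcases x with x | x
  · exact hf x
  · exact hg x

/-- An isomorphism of joins of connected graphs that matches the ends of the joining edges respects
the sides. -/
lemma respects_sides (hG : G.Connected) (hH : H.Connected)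
    (φ : joinEdge G H a b ≃g joinEdge G' H' a' b')
    (ha : φ (.inl a) = .inl a') (hb : φ (.inr b) = .inr b') :
    (∀ u, (φ (.inl u)).isLeft) ∧ ∀ u, (φ (.inr u)).isLeft = false := by
  let il : G →g joinEdge G H a b := ⟨Sum.inl, by simp⟩
  let ir : H →g joinEdge G H a b := ⟨Sum.inr, by simp⟩
  constructor
  · intro u
    have := isLeft_eq_of_preconnected hG.preconnected (φ.toHom.comp il) (Or.inr ?_) u a
    · simpa [il, ha] using this
    · intro x hx
      have : φ (.inl x) = φ (.inr b) := by rw [hb]; exact hx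
      simpa using φ.injective this
  · intro u
    have := isLeft_eq_of_preconnected hH.preconnected (φ.toHom.comp ir) (Or.inl ?_) u b
    · simpa [ir, hb] using this
    · intro x hx
      have : φ (.inr x) = φ (.inl a) := by rw [ha]; exact hx
      simpa using φ.injective this

/-- If all four sides of two isomorphic joins of connected graphs have the same size, the
isomorphism respects or exchanges the sides: the image of one of the sides misses an end of the
joining edge. -/
lemma respects_or_exchanges_sides [Fintype V] [Fintype W] [Fintype V'] [Fintype W']
    (hG : G.Connected) (hH : H.Connected) (φ : joinEdge G H a b ≃g joinEdge G' H' a' b')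
    (h₁ : Fintype.card V = Fintype.card V') (h₂ : Fintype.card V = Fintype.card W')
    (h₃ : Fintype.card W = Fintype.card V') :
    ((∀ u, (φ (.inl u)).isLeft) ∧ ∀ u, (φ (.inr u)).isLeft = false) ∨
      ((∀ u, (φ (.inl u)).isLeft = false) ∧ ∀ u, (φ (.inr u)).isLeft) := by
  classical
  let il : G →g joinEdge G H a b := ⟨Sum.inl, by simp⟩
  let ir : H →g joinEdge G H a b := ⟨Sum.inr, by simp⟩
  have bij : ∀ (s t : Finset (V' ⊕ W')), s ⊆ t → t.card ≤ s.card → s = t :=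
    fun s t h h' => Finset.eq_of_subset_of_card_le h h'
  let SL : Finset (V' ⊕ W') := Finset.univ.image fun u : V => φ (.inl u)
  let SR : Finset (V' ⊕ W') := Finset.univ.image fun u : W => φ (.inr u)
  let TL : Finset (V' ⊕ W') := Finset.univ.image Sum.inl
  let TR : Finset (V' ⊕ W') := Finset.univ.image Sum.inr
  have cSL : SL.card = Fintype.card V :=
    Finset.card_image_of_injective _ (φ.injective.comp Sum.inl_injective)
  have cSR : SR.card = Fintype.card W :=
    Finset.card_image_of_injective _ (φ.injective.comp Sum.inr_injective)
  have cTL : TL.card = Fintype.card V' := Finset.card_image_of_injective _ Sum.inl_injective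
  have cTR : TR.card = Fintype.card W' := Finset.card_image_of_injective _ Sum.inr_injective
  have memL : ∀ x, x ∈ TL ↔ x.isLeft := by intro x; cases x <;> simp [TL]
  have memR : ∀ x, x ∈ TR ↔ x.isLeft = false := by intro x; cases x <;> simp [TR]
  have disj : ∀ u w, φ (.inl u) ≠ φ (.inr w) := fun u w h => by simpa using φ.injective h
  have hV : Nonempty V := hG.nonempty
  have hW : Nonempty W := hH.nonempty
  -- what one constant side says about the other
  have key1 : (∀ u, (φ (.inl u)).isLeft) → ∀ u, (φ (.inr u)).isLeft = false := by
    intro h u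
    by_contra hu
    have : SL = TL := bij _ _ (by intro x; simp only [SL, Finset.mem_image]
                                  rintro ⟨v, -, rfl⟩; exact (memL _).2 (h v)) (by omega)
    have hm : φ (.inr u) ∈ SL := this ▸ (memL _).2 (by simpa using hu)
    simp only [SL, Finset.mem_image] at hm
    obtain ⟨v, -, hv⟩ := hm
    exact disj _ _ hv
  have key2 : (∀ u, (φ (.inl u)).isLeft = false) → ∀ u, (φ (.inr u)).isLeft := by
    intro h u
    by_contra hu
    have : SL = TR := bij _ _ (by intro x; simp only [SL, Finset.mem_image]
                                  rintro ⟨v, -, rfl⟩; exact (memR _).2 (h v)) (by omega)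
    have hm : φ (.inr u) ∈ SL := this ▸ (memR _).2 (by simpa using hu)
    simp only [SL, Finset.mem_image] at hm
    obtain ⟨v, -, hv⟩ := hm
    exact disj _ _ hv
  have key3 : (∀ u, (φ (.inr u)).isLeft) → ∀ u, (φ (.inl u)).isLeft = false := by
    intro h u
    by_contra hu
    have : SR = TL := bij _ _ (by intro x; simp only [SR, Finset.mem_image]
                                  rintro ⟨v, -, rfl⟩; exact (memL _).2 (h v)) (by omega)
    have hm : φ (.inl u) ∈ SR := this ▸ (memL _).2 (by simpa using hu)
    simp only [SR, Finset.mem_image] at hm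
    obtain ⟨v, -, hv⟩ := hm
    exact disj _ _ hv.symm
  have key4 : (∀ u, (φ (.inr u)).isLeft = false) → ∀ u, (φ (.inl u)).isLeft := by
    intro h u
    by_contra hu
    have : SR = TR := bij _ _ (by intro x; simp only [SR, Finset.mem_image]
                                  rintro ⟨v, -, rfl⟩; exact (memR _).2 (h v)) (by omega)
    have hm : φ (.inl u) ∈ SR := this ▸ (memR _).2 (by simpa using hu)
    simp only [SR, Finset.mem_image] at hm
    obtain ⟨v, -, hv⟩ := hm
    exact disj _ _ hv.symm
  -- if the first side covers both ends of the joining edge, the second side misses them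
  by_cases hc : ((∀ x, φ (.inl x) ≠ .inl a') ∨ ∀ x, φ (.inl x) ≠ .inr b')
  · have hconst := isLeft_eq_of_preconnected hG.preconnected (φ.toHom.comp il) hc
    obtain ⟨v⟩ := hV
    cases hv : (φ (.inl v)).isLeft with
    | true =>
      have h : ∀ u, (φ (.inl u)).isLeft := fun u => (hconst u v).trans hv
      exact Or.inl ⟨h, key1 h⟩
    | false =>
      have h : ∀ u, (φ (.inl u)).isLeft = false := fun u => (hconst u v).trans hv
      exact Or.inr ⟨h, key2 h⟩
  · push Not at hc
    obtain ⟨⟨x, hx⟩, y, hy⟩ := hc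
    have hconst := isLeft_eq_of_preconnected hH.preconnected (φ.toHom.comp ir)
      (Or.inl fun z hz => disj x z (hx.trans hz.symm))
    obtain ⟨w⟩ := hW
    cases hw : (φ (.inr w)).isLeft with
    | true =>
      have h : ∀ u, (φ (.inr u)).isLeft := fun u => (hconst u w).trans hw
      exact Or.inr ⟨key3 h, h⟩
    | false =>
      have h : ∀ u, (φ (.inr u)).isLeft = false := fun u => (hconst u w).trans hw
      exact Or.inl ⟨key4 h, h⟩

end joinEdge
end SimpleGraph

/-! ### Plane trees and level sequences -/

/-- Plane trees, rooted and with ordered children. A tree with at least two vertices is written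
`graft A B`: `B` is the subtree of the first child of the root, and `A` is what is left after
removing it. -/
inductive PlaneTree : Type
  | leaf : PlaneTree
  | graft (A B : PlaneTree) : PlaneTree

namespace PlaneTree

open SimpleGraph

/-- The number of vertices. -/
def size : PlaneTree → ℕ
  | leaf => 1
  | graft A B => A.size + B.size

/-- The greatest depth of a vertex. -/
def height : PlaneTree → ℕ
  | leaf => 0
  | graft A B => max A.height (B.height + 1)

/-- The depths of the vertices other than the root, in depth-first order, if the root has
depth `d`. -/
def tail : ℕ → PlaneTree → List ℕ
  | _, leaf => []
  | d, graft A B => (d + 1) :: (tail (d + 1) B ++ tail d A)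

/-- The level sequence. -/
def levels (T : PlaneTree) : List ℕ := 0 :: tail 0 T

lemma size_pos (T : PlaneTree) : 0 < T.size := by
  induction T with
  | leaf => simp [size]
  | graft A B => simp only [size]; omega

lemma length_tail (d : ℕ) (T : PlaneTree) : (tail d T).length + 1 = T.size := by
  induction T generalizing d with
  | leaf => rfl
  | graft A B ihA ihB =>
    have := ihA d
    have := ihB (d + 1)
    simp only [tail, size, List.length_cons, List.length_append]
    omega

@[simp] lemma length_levels (T : PlaneTree) : T.levels.length = T.size := by
  simp [levels, length_tail]

lemma lt_of_mem_tail {d : ℕ} {T : PlaneTree} {x : ℕ} (hx : x ∈ tail d T) : d < x := by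
  induction T generalizing d with
  | leaf => simp [tail] at hx
  | graft A B ihA ihB =>
    simp only [tail, List.mem_cons, List.mem_append] at hx
    rcases hx with rfl | hx | hx
    · omega
    · have := ihB hx; omega
    · exact ihA hx

lemma le_of_mem_tail {d : ℕ} {T : PlaneTree} {x : ℕ} (hx : x ∈ tail d T) : x ≤ d + T.height := by
  induction T generalizing d with
  | leaf => simp [tail] at hx
  | graft A B ihA ihB =>
    simp only [tail, List.mem_cons, List.mem_append] at hx
    simp only [height]
    rcases hx with rfl | hx | hx
    · omega
    · have := ihB hx; omega
    · have := ihA hx; omega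

lemma tail_succ (d : ℕ) (T : PlaneTree) : tail (d + 1) T = (tail d T).map (· + 1) := by
  induction T generalizing d with
  | leaf => rfl
  | graft A B ihA ihB => simp [tail, ihA, ihB]

lemma levels_graft (A B : PlaneTree) :
    (graft A B).levels = 0 :: (B.levels.map (· + 1) ++ tail 0 A) := by
  simp [levels, tail, tail_succ]

/-- The list of depths determines the tree, and where it ends if it is continued by smaller
depths. -/
lemma tail_append_inj {d : ℕ} {T T' : PlaneTree} {l l' : List ℕ}
    (hl : ∀ x ∈ l.head?, x ≤ d) (hl' : ∀ x ∈ l'.head?, x ≤ d)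
    (h : tail d T ++ l = tail d T' ++ l') : T = T' ∧ l = l' := by
  induction T generalizing d T' l l' with
  | leaf =>
    cases T' with
    | leaf => simpa [tail] using h
    | graft A B =>
      simp only [tail, List.nil_append, List.cons_append] at h
      subst h
      simp at hl
  | graft A B ihA ihB =>
    cases T' with
    | leaf =>
      simp only [tail, List.nil_append, List.cons_append] at h
      subst h
      simp at hl'
    | graft A' B' =>
      simp only [tail, List.cons_append, List.append_assoc, List.cons.injEq, true_and] at h
      have aux : ∀ (A : PlaneTree) (l : List ℕ), (∀ x ∈ l.head?, x ≤ d) →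
          ∀ x ∈ (tail d A ++ l).head?, x ≤ d + 1 := by
        intro A l hl x hx
        cases A with
        | leaf => have := hl x (by simpa [tail] using hx); omega
        | graft A B => simp [tail] at hx; omega
      obtain ⟨rfl, h₁⟩ := ihB (aux A l hl) (aux A' l' hl') h
      obtain ⟨rfl, h₂⟩ := ihA hl hl' h₁
      exact ⟨rfl, h₂⟩

lemma levels_injective : Function.Injective levels := by
  intro T T' h
  simp only [levels, List.cons.injEq, true_and] at h
  exact (tail_append_inj (l := []) (l' := []) (by simp) (by simp) (by simpa using h)).1

/-- Plane trees are compared by their level sequences, lexicographically. -/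
noncomputable instance : LinearOrder PlaneTree := LinearOrder.lift' levels levels_injective

lemma le_iff_levels {T T' : PlaneTree} : T ≤ T' ↔ T.levels ≤ T'.levels := Iff.rfl

lemma lt_iff_levels {T T' : PlaneTree} : T < T' ↔ T.levels < T'.levels := by
  rw [lt_iff_not_ge, lt_iff_not_ge, le_iff_levels]

/-- A list of depths greater than `d` is the list of the vertices below a vertex of depth `d` if it
begins with `d + 1` and each entry exceeds the one before by one at most. The entries up to the next
`d + 1` form the first subtree. -/
lemma exists_tail (d : ℕ) (l : List ℕ) (hl : ∀ x ∈ l, d < x) (hh : ∀ x ∈ l.head?, x ≤ d + 1)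
    (hc : l.IsChain fun x y => y ≤ x + 1) : ∃ T, tail d T = l := by
  induction hn : l.length using Nat.strong_induction_on generalizing d l with
  | _ n ih =>
    cases l with
    | nil => exact ⟨leaf, rfl⟩
    | cons x l =>
      have hx : x = d + 1 := by
        have h1 := hl x (by simp)
        have h2 := hh x (by simp)
        omega
      subst hx
      set p : ℕ → Bool := fun y => decide (d + 1 < y) with hp
      have hsplit : l.takeWhile p ++ l.dropWhile p = l := List.takeWhile_append_dropWhile
      have hlen := congrArg List.length hsplit
      simp only [List.length_append] at hlen
      simp only [List.length_cons] at hn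
      have hcl : (l.takeWhile p ++ l.dropWhile p).IsChain fun x y => y ≤ x + 1 := by
        rw [hsplit]; exact hc.tail
      have hc1 := hcl.left_of_append
      have hc2 := hcl.right_of_append
      obtain ⟨B, hB⟩ := ih (l.takeWhile p).length (by omega) (d + 1) (l.takeWhile p)
        (fun y hy => by have := List.mem_takeWhile_imp hy; simpa [hp] using this)
        (by
          intro y hy
          cases l with
          | nil => simp at hy
          | cons z l =>
            have hz : z ≤ d + 1 + 1 := by
              have := hc.rel; simpa using this
            by_cases hpz : p z
            · simp only [List.takeWhile_cons, hpz, if_true] at hy; simp at hy; omega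
            · simp [hpz] at hy) hc1 rfl
      obtain ⟨A, hA⟩ := ih (l.dropWhile p).length (by omega) d (l.dropWhile p)
        (fun y hy => hl y (List.mem_cons_of_mem _ ((List.dropWhile_sublist p).subset hy)))
        (by
          intro y hy
          have := List.head?_dropWhile_not p l
          rw [Option.mem_def.1 hy] at this
          simpa [hp] using this) hc2 rfl
      exact ⟨graft A B, by simp [tail, hA, hB, hsplit]⟩

/-- The vertices of a plane tree. -/
@[reducible] def Vert : PlaneTree → Type
  | leaf => Unit
  | graft A B => Vert A ⊕ Vert B

/-- The root. -/
def root : (T : PlaneTree) → Vert T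
  | leaf => ()
  | graft A _ => Sum.inl (root A)

/-- The underlying graph. -/
def graph : (T : PlaneTree) → SimpleGraph (Vert T)
  | leaf => (⊥ : SimpleGraph Unit)
  | graft A B => joinEdge (graph A) (graph B) (root A) (root B)

instance instFintypeVert : (T : PlaneTree) → Fintype (Vert T)
  | leaf => inferInstanceAs (Fintype Unit)
  | graft A B =>
    letI := instFintypeVert A
    letI := instFintypeVert B
    inferInstanceAs (Fintype (Vert A ⊕ Vert B))

lemma card_vert (T : PlaneTree) : Fintype.card (Vert T) = T.size := by
  induction T with
  | leaf => rfl
  | graft A B ihA ihB =>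
    rw [size, ← ihA, ← ihB]
    exact Fintype.card_sum

lemma isTree_graph (T : PlaneTree) : T.graph.IsTree := by
  induction T with
  | leaf => exact IsTree.of_subsingleton (V := Unit)
  | graft A B ihA ihB => exact ihA.joinEdge ihB

lemma connected_graph (T : PlaneTree) : T.graph.Connected := T.isTree_graph.connected

/-- Attaching a new leaf to a plane tree at a given vertex. -/
lemma exists_attach_leaf (T : PlaneTree) (x : Vert T) : ∃ (T' : PlaneTree)
    (φ : T'.graph ≃g joinEdge T.graph (⊥ : SimpleGraph Unit) x ()), φ T'.root = .inl T.root := by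
  induction T with
  | leaf => exact ⟨graft leaf leaf, Iso.refl, rfl⟩
  | graft A B ihA ihB =>
    rcases x with x | x
    · obtain ⟨A', φ, hφ⟩ := ihA x
      refine ⟨graft A' B, (joinEdgeCongr φ Iso.refl hφ rfl).trans joinEdgeRightComm, ?_⟩
      exact congrArg (fun z => joinEdgeRightComm (G := A.graph) (H := (⊥ : SimpleGraph Unit))
        (F := B.graph) (a := x) (b := ()) (a₁ := A.root) (c := B.root) (.inl z)) hφ
    · obtain ⟨B', φ, hφ⟩ := ihB x
      refine ⟨graft A B', (joinEdgeCongr Iso.refl φ rfl hφ).trans joinEdgeAssoc.symm, rfl⟩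

/-- Every finite tree is the underlying graph of a plane tree. -/
theorem exists_iso_graph {V : Type} [Fintype V] {G : SimpleGraph V} (hG : G.IsTree) :
    ∃ T : PlaneTree, Nonempty (T.graph ≃g G) := by
  induction hn : Fintype.card V using Nat.strong_induction_on generalizing V with
  | _ n ih =>
    classical
    -- remove a vertex of degree one and attach it again
    by_cases hV : Nontrivial V
    · obtain ⟨v, hv⟩ := hG.exists_vert_degree_one_of_nontrivial
      have hc := hG.connected.induce_compl_singleton_of_degree_eq_one hv
      obtain ⟨u, huv, hu⟩ := degree_eq_one_iff_existsUnique_adj.1 hv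
      have hne : u ≠ v := huv.ne'
      have hcard : Fintype.card ({v}ᶜ : Set V) < n := by
        rw [← hn]
        exact Fintype.card_lt_of_injective_of_notMem _ Subtype.val_injective
          (b := v) (by simp)
      obtain ⟨T, ⟨φ⟩⟩ := ih _ hcard (G := G.induce {v}ᶜ) ⟨hc, hG.isAcyclic.induce _⟩ rfl
      obtain ⟨T', ψ, -⟩ := T.exists_attach_leaf (φ.symm ⟨u, hne⟩)
      refine ⟨T', ⟨ψ.trans ?_⟩⟩
      refine (joinEdgeCongr φ Iso.refl (φ.apply_symm_apply _) rfl).trans ?_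
      let e : ({v}ᶜ : Set V) ⊕ Unit ≃ V :=
        { toFun := Sum.elim (fun x => x.1) fun _ => v
          invFun := fun x => if h : x = v then .inr () else .inl ⟨x, h⟩
          left_inv := by
            rintro (⟨x, hx⟩ | x)
            · have : x ≠ v := hx
              simp [this]
            · simp
          right_inv := by
            intro x
            by_cases h : x = v <;> simp [h] }
      refine ⟨e, ?_⟩
      rintro (⟨x, hx⟩ | x) (⟨y, hy⟩ | y)
      · simp [e]
      · simp only [e, Equiv.coe_fn_mk, Sum.elim_inl, Sum.elim_inr, joinEdge_inl_inr,
          and_true]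
        exact ⟨fun h => Subtype.ext (hu _ h.symm), fun h => by
          have : x = u := congrArg Subtype.val h
          exact this ▸ huv.symm⟩
      · simp only [e, Equiv.coe_fn_mk, Sum.elim_inl, Sum.elim_inr, joinEdge_inr_inl,
          and_true]
        exact ⟨fun h => Subtype.ext (hu _ h), fun h => by
          have : y = u := congrArg Subtype.val h
          exact this ▸ huv⟩
      · simp [e]
    · rw [not_nontrivial_iff_subsingleton] at hV
      obtain ⟨x⟩ := hG.connected.nonempty
      have e : Unit ≃ V := ⟨fun _ => x, fun _ => (), fun _ => rfl, fun _ => Subsingleton.elim _ _⟩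
      refine ⟨leaf, ⟨⟨e, ?_⟩⟩⟩
      intro a b
      have h1 : ¬ G.Adj (e a) (e b) := fun h => h.ne (Subsingleton.elim _ _)
      exact ⟨fun h => absurd h h1, fun h => h.elim⟩

end PlaneTree

/-! ### Isomorphisms of rooted trees -/

namespace PlaneTree

open SimpleGraph

/-- Isomorphisms that respect the roots. -/
abbrev RootedIso (T T' : PlaneTree) : Type := {φ : T.graph ≃g T'.graph // φ T.root = T'.root}

instance (T T' : PlaneTree) : Finite (RootedIso T T') :=
  Finite.of_injective (fun φ => (φ.1 : T.Vert → T'.Vert)) fun _ _ h =>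
    Subtype.ext (DFunLike.coe_injective h)

/-- The trees are isomorphic as rooted trees. -/
abbrev RootIsomorphic (T T' : PlaneTree) : Prop := Nonempty (RootedIso T T')

/-- Isomorphisms that respect the roots compose. -/
def RootedIso.trans {T T' T'' : PlaneTree} (φ : RootedIso T T') (ψ : RootedIso T' T'') :
    RootedIso T T'' := ⟨φ.1.trans ψ.1, by simp [φ.2, ψ.2]⟩

/-- The inverse of an isomorphism that respects the roots. -/
def RootedIso.symm {T T' : PlaneTree} (φ : RootedIso T T') : RootedIso T' T :=
  ⟨φ.1.symm, by rw [RelIso.symm_apply_eq, φ.2]⟩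

/-- The number of isomorphisms that respect the roots. -/
noncomputable def isoCount (T T' : PlaneTree) : ℕ := Nat.card (RootedIso T T')

/-- The children of the root. -/
@[reducible] def Kids : PlaneTree → Type
  | leaf => Empty
  | graft A _ => Option (Kids A)

instance instFintypeKids : (T : PlaneTree) → Fintype (Kids T)
  | leaf => inferInstanceAs (Fintype Empty)
  | graft A _ =>
    letI := instFintypeKids A
    inferInstanceAs (Fintype (Option (Kids A)))

/-- The subtree of a child of the root. -/
def kid : (T : PlaneTree) → Kids T → PlaneTree
  | leaf, k => k.elim
  | graft _ B, none => B
  | graft A _, some k => kid A k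

/-- What is left of the tree without the subtree of a child of the root. -/
def rem : (T : PlaneTree) → Kids T → PlaneTree
  | leaf, k => k.elim
  | graft A _, none => A
  | graft A B, some k => graft (rem A k) B

/-- A child of the root as a vertex. -/
def kidVert : (T : PlaneTree) → (k : Kids T) → Vert T
  | leaf, k => k.elim
  | graft _ B, none => Sum.inr B.root
  | graft A _, some k => Sum.inl (kidVert A k)

/-- Any child of the root can be moved to the first place. -/
lemma exists_kidIso (T : PlaneTree) (k : Kids T) :
    ∃ φ : RootedIso (graft (rem T k) (kid T k)) T, φ.1 (.inr (kid T k).root) = kidVert T k := by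
  induction T with
  | leaf => exact k.elim
  | graft A B ihA ihB =>
    cases k with
    | none => exact ⟨⟨Iso.refl, rfl⟩, rfl⟩
    | some k =>
      obtain ⟨⟨φ, h₁⟩, h₂⟩ := ihA k
      refine ⟨⟨joinEdgeRightComm.trans (joinEdgeCongr φ (Iso.refl (G := B.graph)) h₁ rfl), ?_⟩, ?_⟩
      · exact congrArg Sum.inl h₁
      · exact congrArg Sum.inl h₂

lemma kidVert_injective (T : PlaneTree) : Function.Injective (kidVert T) := by
  induction T with
  | leaf => exact fun k => k.elim
  | graft A B ihA ihB =>
    intro k k' h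
    cases k <;> cases k' <;> simp only [kidVert] at h
    · rfl
    · exact absurd h Sum.inr_ne_inl
    · exact absurd h Sum.inl_ne_inr
    · exact congrArg some (ihA (Sum.inl_injective h))

lemma exists_kidVert {T : PlaneTree} {y : Vert T} (h : T.graph.Adj T.root y) :
    ∃ k, kidVert T k = y := by
  induction T with
  | leaf => exact h.elim
  | graft A B ihA ihB =>
    rcases y with y | y
    · obtain ⟨k, rfl⟩ := ihA (joinEdge_inl_inl.1 h)
      exact ⟨some k, rfl⟩
    · obtain ⟨-, rfl⟩ := joinEdge_inl_inr.1 h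
      exact ⟨none, rfl⟩

/-- Isomorphisms that respect the roots and the first children are pairs of isomorphisms. -/
noncomputable def graftIsoEquiv (A B A' B' : PlaneTree) :
    {φ : RootedIso (graft A B) (graft A' B') // φ.1 (.inr B.root) = .inr B'.root} ≃
      RootedIso A A' × RootedIso B B' := by
  symm
  refine Equiv.ofBijective (fun p => ⟨⟨joinEdgeCongr p.1.1 p.2.1 p.1.2 p.2.2,
    congrArg Sum.inl p.1.2⟩, congrArg Sum.inr p.2.2⟩) ⟨?_, ?_⟩
  · rintro ⟨⟨α, hα⟩, ⟨β, hβ⟩⟩ ⟨⟨α', hα'⟩, ⟨β', hβ'⟩⟩ h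
    have h : joinEdgeCongr α β hα hβ = joinEdgeCongr α' β' hα' hβ' :=
      congrArg (fun φ => φ.1.1) h
    have h1 : α = α' := by
      ext u
      exact Sum.inl_injective (DFunLike.congr_fun h (.inl u))
    have h2 : β = β' := by
      ext u
      exact Sum.inr_injective (DFunLike.congr_fun h (.inr u))
    subst h1 h2
    rfl
  · rintro ⟨⟨φ, ha⟩, hb⟩
    obtain ⟨hl, hr⟩ := respects_sides A.connected_graph B.connected_graph φ ha hb
    obtain ⟨α, β, hα, hβ, rfl⟩ := exists_joinEdgeCongr φ hl hr
    exact ⟨⟨⟨α, hα⟩, ⟨β, hβ⟩⟩, rfl⟩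

/-- Sorting the isomorphisms by the image of the first child of the root. -/
lemma isoCount_graft (A B T : PlaneTree) :
    isoCount (graft A B) T = ∑ k : Kids T, isoCount A (rem T k) * isoCount B (kid T k) := by
  classical
  have hk : ∀ φ : RootedIso (graft A B) T, ∃ k, kidVert T k = φ.1 (.inr B.root) := by
    rintro ⟨φ, hφ⟩
    apply exists_kidVert
    have : T.graph.Adj (φ (graft A B).root) (φ (.inr B.root)) :=
      (φ.map_adj_iff).2 (joinEdge_inl_inr.2 ⟨rfl, rfl⟩)
    rwa [hφ] at this
  choose f hf using hk
  have e : RootedIso (graft A B) T ≃ Σ k : Kids T, RootedIso A (rem T k) × RootedIso B (kid T k) := by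
    refine (Equiv.sigmaFiberEquiv f).symm.trans (Equiv.sigmaCongrRight fun k => ?_)
    refine Equiv.trans ?_ (graftIsoEquiv A B (rem T k) (kid T k))
    have hψ := (exists_kidIso T k).choose_spec
    set ψ := (exists_kidIso T k).choose
    refine ⟨fun φ => ⟨φ.1.trans ψ.symm, ?_⟩, fun φ => ⟨φ.1.trans ψ, ?_⟩, ?_, ?_⟩
    · have : φ.1.1 (.inr B.root) = kidVert T k := by rw [← hf, φ.2]
      change ψ.1.symm (φ.1.1 (.inr B.root)) = _
      rw [this]
      exact (RelIso.symm_apply_eq ψ.1).2 hψ.symm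
    · apply kidVert_injective
      rw [hf]
      change ψ.1 (φ.1.1 (.inr B.root)) = _
      rw [φ.2, hψ]
    · intro φ
      refine Subtype.ext (Subtype.ext ?_)
      ext u
      exact ψ.1.apply_symm_apply _
    · intro φ
      refine Subtype.ext (Subtype.ext ?_)
      ext u
      exact ψ.1.symm_apply_apply _
  simp only [isoCount]
  rw [Nat.card_congr e, Nat.card_sigma]
  exact Finset.sum_congr rfl fun k _ => Nat.card_prod _ _

lemma isoCount_pos {T T' : PlaneTree} : 0 < isoCount T T' ↔ RootIsomorphic T T' := by
  rw [isoCount, Nat.card_pos_iff]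
  exact ⟨fun h => h.1, fun h => ⟨h, inferInstance⟩⟩

lemma size_eq_of_iso {T T' : PlaneTree} (φ : T.graph ≃g T'.graph) : T.size = T'.size := by
  rw [← card_vert, ← card_vert]
  exact Fintype.card_congr φ.toEquiv

/-- Insert a subtree among the children of the root, before the first child that is not
larger. -/
noncomputable def insertKid (x : PlaneTree) : PlaneTree → PlaneTree
  | leaf => graft leaf x
  | graft A B => if B ≤ x then graft (graft A B) x else graft (insertKid x A) B

/-- Sort the children of every vertex in decreasing order. -/
noncomputable def sortKids : PlaneTree → PlaneTree
  | leaf => leaf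
  | graft A B => insertKid (sortKids B) (sortKids A)

/-- No child of the root has a subtree larger than `x`, for trees whose children are sorted: the
first child has none. -/
def FirstLE : PlaneTree → PlaneTree → Prop
  | leaf, _ => True
  | graft _ B, x => B ≤ x

/-- A plane tree is canonical if the subtrees of the children of every vertex are in decreasing
order. -/
def IsCanonical : PlaneTree → Prop
  | leaf => True
  | graft A B => A.IsCanonical ∧ B.IsCanonical ∧ A.FirstLE B

lemma insertKid_comm (x y T : PlaneTree) :
    insertKid x (insertKid y T) = insertKid y (insertKid x T) := by
  induction T with
  | leaf =>
    simp only [insertKid]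
    rcases lt_trichotomy x y with h | h | h
    · simp [h.le, not_le.2 h]
    · simp [h]
    · simp [h.le, not_le.2 h]
  | graft A B ihA ihB =>
    by_cases hx : B ≤ x <;> by_cases hy : B ≤ y
    · rcases lt_trichotomy x y with h | h | h
      · simp [insertKid, hx, hy, h.le, not_le.2 h]
      · simp [h]
      · simp [insertKid, hx, hy, h.le, not_le.2 h]
    · have : ¬ x ≤ y := fun h => hy (hx.trans h)
      simp [insertKid, hx, hy, this]
    · have : ¬ y ≤ x := fun h => hx (hy.trans h)
      simp [insertKid, hx, hy, this]
    · simp [insertKid, hx, hy, ihA]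

lemma firstLE_insertKid {x y T : PlaneTree} (hx : x ≤ y) (hT : T.FirstLE y) :
    (insertKid x T).FirstLE y := by
  cases T with
  | leaf => exact hx
  | graft A B =>
    simp only [insertKid]
    split_ifs
    · exact hx
    · exact hT

lemma FirstLE.trans {x y T : PlaneTree} (hT : T.FirstLE x) (h : x ≤ y) : T.FirstLE y := by
  cases T with
  | leaf => trivial
  | graft A B => exact le_trans hT h

lemma isCanonical_insertKid {x T : PlaneTree} (hx : x.IsCanonical) (hT : T.IsCanonical) :
    (insertKid x T).IsCanonical := by
  induction T with
  | leaf => exact ⟨trivial, hx, trivial⟩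
  | graft A B ihA ihB =>
    simp only [insertKid]
    split_ifs with h
    · exact ⟨hT, hx, h⟩
    · exact ⟨ihA hT.1, hT.2.1, firstLE_insertKid (not_le.1 h).le hT.2.2⟩

lemma isCanonical_sortKids (T : PlaneTree) : T.sortKids.IsCanonical := by
  induction T with
  | leaf => trivial
  | graft A B ihA ihB => exact isCanonical_insertKid ihB ihA

lemma insertKid_of_firstLE {x T : PlaneTree} (h : T.FirstLE x) : insertKid x T = graft T x := by
  cases T with
  | leaf => rfl
  | graft A B => exact if_pos h

lemma sortKids_of_isCanonical {T : PlaneTree} (h : T.IsCanonical) : T.sortKids = T := by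
  induction T with
  | leaf => rfl
  | graft A B ihA ihB =>
    rw [sortKids, ihA h.1, ihB h.2.1, insertKid_of_firstLE h.2.2]

lemma rootIsomorphic_insertKid (x T : PlaneTree) : RootIsomorphic (graft T x) (insertKid x T) := by
  induction T with
  | leaf => exact ⟨⟨Iso.refl, rfl⟩⟩
  | graft A B ihA ihB =>
    simp only [insertKid]
    split_ifs
    · exact ⟨⟨Iso.refl, rfl⟩⟩
    · obtain ⟨⟨φ, h₁⟩⟩ := ihA
      exact ⟨⟨joinEdgeRightComm.trans (joinEdgeCongr φ (Iso.refl (G := B.graph)) h₁ rfl),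
        congrArg Sum.inl h₁⟩⟩

lemma RootIsomorphic.graft {A B A' B' : PlaneTree} :
    RootIsomorphic A A' → RootIsomorphic B B' →
      RootIsomorphic (PlaneTree.graft A B) (PlaneTree.graft A' B')
  | ⟨φ⟩, ⟨ψ⟩ => ⟨⟨joinEdgeCongr φ.1 ψ.1 φ.2 ψ.2, congrArg Sum.inl φ.2⟩⟩

lemma rootIsomorphic_sortKids (T : PlaneTree) : RootIsomorphic T T.sortKids := by
  induction T with
  | leaf => exact ⟨⟨Iso.refl, rfl⟩⟩
  | graft A B ihA ihB =>
    obtain ⟨φ⟩ := ihA.graft ihB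
    obtain ⟨ψ⟩ := rootIsomorphic_insertKid B.sortKids A.sortKids
    exact ⟨φ.trans ψ⟩

/-- Sorting does not depend on which child of the root is inserted last. -/
lemma sortKids_eq_insertKid (T : PlaneTree) (k : Kids T) :
    T.sortKids = insertKid (kid T k).sortKids (rem T k).sortKids := by
  induction T with
  | leaf => exact k.elim
  | graft A B ihA ihB =>
    cases k with
    | none => rfl
    | some k =>
      simp only [sortKids, kid, rem]
      rw [insertKid_comm, ← ihA k]

lemma sortKids_eq_of_rootIsomorphic {T T' : PlaneTree} (h : RootIsomorphic T T') :
    T.sortKids = T'.sortKids := by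
  induction T generalizing T' with
  | leaf =>
    obtain ⟨φ⟩ := h
    have := size_eq_of_iso φ.1
    cases T' with
    | leaf => rfl
    | graft A B =>
      have := A.size_pos
      have := B.size_pos
      simp only [size] at *
      omega
  | graft A B ihA ihB =>
    rw [← isoCount_pos, isoCount_graft] at h
    obtain ⟨k, -, hk⟩ := Finset.exists_ne_zero_of_sum_ne_zero h.ne'
    have h1 : 0 < isoCount A (rem T' k) := Nat.pos_of_ne_zero (left_ne_zero_of_mul hk)
    have h2 : 0 < isoCount B (kid T' k) := Nat.pos_of_ne_zero (right_ne_zero_of_mul hk)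
    rw [sortKids_eq_insertKid T' k, sortKids, ihA (isoCount_pos.1 h1), ihB (isoCount_pos.1 h2)]

/-- Canonical plane trees represent the isomorphism classes of rooted trees. -/
theorem eq_of_rootIsomorphic {T T' : PlaneTree} (hT : T.IsCanonical) (hT' : T'.IsCanonical)
    (h : RootIsomorphic T T') : T = T' := by
  rw [← sortKids_of_isCanonical hT, ← sortKids_of_isCanonical hT', sortKids_eq_of_rootIsomorphic h]

/-- The number of first children of the root that have the subtree `x`. -/
noncomputable def leadRun (x : PlaneTree) : PlaneTree → ℕ
  | leaf => 0
  | graft A B => if B = x then leadRun x A + 1 else 0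

lemma isCanonical_kid {T : PlaneTree} (h : T.IsCanonical) (k : Kids T) :
    (kid T k).IsCanonical := by
  induction T with
  | leaf => exact k.elim
  | graft A B ihA ihB =>
    cases k with
    | none => exact h.2.1
    | some k => exact ihA h.1 k

lemma kid_le {T x : PlaneTree} (h : T.IsCanonical) (hx : T.FirstLE x) (k : Kids T) :
    kid T k ≤ x := by
  induction T with
  | leaf => exact k.elim
  | graft A B ihA ihB =>
    cases k with
    | none => exact hx
    | some k => exact ihA h.1 (h.2.2.trans hx) k

lemma rem_eq_of_kid_eq {A B : PlaneTree} (h : (graft A B).IsCanonical) (k : Kids (graft A B))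
    (hk : kid (graft A B) k = B) : rem (graft A B) k = A := by
  induction A generalizing B with
  | leaf =>
    cases k with
    | none => rfl
    | some k => exact k.elim
  | graft A₂ B₂ ih _ =>
    cases k with
    | none => rfl
    | some k =>
      have h1 : B ≤ B₂ := hk ▸ kid_le h.1 (le_refl B₂) k
      have h2 : B₂ = B := le_antisymm h.2.2 h1
      subst h2
      change graft (rem (graft A₂ B₂) k) B₂ = graft A₂ B₂
      rw [ih h.1 k hk]

open Classical in
lemma card_kid_eq {T x : PlaneTree} (h : T.IsCanonical) (hx : T.FirstLE x) :
    Fintype.card {k : Kids T // kid T k = x} = leadRun x T := by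
  induction T with
  | leaf => exact Fintype.card_eq_zero_iff.2 ⟨fun k => k.1.elim⟩
  | graft A B ihA ihB =>
    rw [leadRun, Fintype.card_subtype]
    rw [Finset.card_filter]
    refine (Fintype.sum_option (α := Kids A) _).trans ?_
    simp only [kid]
    by_cases hB : B = x
    · subst hB
      rw [← ihA h.1 h.2.2, Fintype.card_subtype]
      simp only [if_true, Finset.card_filter]
      exact add_comm _ _
    · have : ∀ k : Kids A, kid A k ≠ x := fun k hk =>
        hB (le_antisymm hx (hk ▸ kid_le h.1 h.2.2 k))
      simp [hB, this]

lemma isoCount_eq_zero {T T' : PlaneTree} (hT : T.IsCanonical) (hT' : T'.IsCanonical)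
    (h : T ≠ T') : isoCount T T' = 0 := by
  by_contra h0
  exact h (eq_of_rootIsomorphic hT hT' (isoCount_pos.1 (Nat.pos_of_ne_zero h0)))

lemma isoCount_self_graft {A B : PlaneTree} (h : (graft A B).IsCanonical) :
    isoCount (graft A B) (graft A B) = (leadRun B A + 1) * isoCount A A * isoCount B B := by
  classical
  rw [isoCount_graft]
  have : ∀ k : Kids (graft A B), isoCount A (rem (graft A B) k) * isoCount B (kid (graft A B) k) =
      if kid (graft A B) k = B then isoCount A A * isoCount B B else 0 := by
    intro k
    split_ifs with hk
    · rw [hk, rem_eq_of_kid_eq h k hk]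
    · rw [isoCount_eq_zero h.2.1 (isCanonical_kid h k) (Ne.symm hk), mul_zero]
  rw [Finset.sum_congr rfl fun k _ => this k, ← Finset.sum_filter, Finset.sum_const,
    ← Fintype.card_subtype, card_kid_eq h (le_refl B), leadRun, if_pos rfl, smul_eq_mul, mul_assoc]

/-- The product of the numbers that the vertices other than the root get if equal subtrees of
siblings are numbered consecutively, provided that the children of the root are preceded by a
sibling with the given subtree and number. -/
noncomputable def siblingProd : Option (PlaneTree × ℕ) → PlaneTree → ℕ
  | _, leaf => 1
  | none, graft A B => siblingProd none B * siblingProd (some (B, 1)) A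
  | some (x, m), graft A B =>
    if x = B then (m + 1) * siblingProd none B * siblingProd (some (B, m + 1)) A
    else siblingProd none B * siblingProd (some (B, 1)) A

/-- The leading children equal to the preceding sibling get the numbers `m + 1, m + 2, …` in place
of `1, 2, …`. -/
lemma siblingProd_some (x : PlaneTree) (m : ℕ) (T : PlaneTree) :
    siblingProd (some (x, m)) T * (m.factorial * (leadRun x T).factorial) =
      siblingProd none T * (m + leadRun x T).factorial := by
  induction T generalizing m with
  | leaf => simp [siblingProd, leadRun]
  | graft A B ihA ihB =>
    by_cases h : x = B
    · subst h
      have h1 := ihA (m + 1)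
      have h2 := ihA 1
      simp only [siblingProd, leadRun, if_true]
      set r := leadRun x A
      have hr : 0 < r.factorial := r.factorial_pos
      have h3 : siblingProd (some (x, 1)) A = siblingProd none A * (r + 1) := by
        apply Nat.eq_of_mul_eq_mul_right hr
        rw [Nat.factorial_one, one_mul, add_comm 1 r, Nat.factorial_succ] at h2
        rw [h2]; ring
      rw [h3]
      rw [Nat.factorial_succ, show m + 1 + r = m + (r + 1) by ring] at h1
      rw [Nat.factorial_succ r]
      calc _ = siblingProd none x * (r + 1) *
            (siblingProd (some (x, m + 1)) A * ((m + 1) * m.factorial * r.factorial)) := by ring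
        _ = _ := by rw [h1]; ring
    · simp [siblingProd, leadRun, h, Ne.symm h, mul_comm]

lemma siblingProd_eq_isoCount {T : PlaneTree} (h : T.IsCanonical) :
    siblingProd none T = isoCount T T := by
  induction T with
  | leaf =>
    have : Unique (RootedIso leaf leaf) :=
      { default := ⟨Iso.refl, rfl⟩
        uniq := fun _ => Subtype.ext (by ext u) }
    simp [siblingProd, isoCount]
  | graft A B ihA ihB =>
    have h2 := siblingProd_some B 1 A
    rw [Nat.factorial_one, one_mul, add_comm 1, Nat.factorial_succ] at h2
    have hr : 0 < (leadRun B A).factorial := Nat.factorial_pos _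
    have h3 : siblingProd (some (B, 1)) A = siblingProd none A * (leadRun B A + 1) := by
      apply Nat.eq_of_mul_eq_mul_right hr
      rw [h2]; ring
    rw [siblingProd, h3, isoCount_self_graft h, ← ihA h.1, ← ihB h.2.1, mul_comm,
      mul_comm (siblingProd none A)]

end PlaneTree

/-! ### Comparison of level sequences -/

/-- Lexicographic comparison of lists of natural numbers, read as sequences that are continued
by zeros. -/
lemma List.lt_of_getD {L M : List ℕ} {j : ℕ} (h : ∀ i < j, L.getD i 0 = M.getD i 0)
    (hj : L.getD j 0 < M.getD j 0) : L < M := by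
  induction j generalizing L M with
  | zero =>
    cases M with
    | nil => simp at hj
    | cons b M =>
      cases L with
      | nil => exact List.Lex.nil
      | cons a L => exact List.Lex.rel (by simpa using hj)
  | succ j ih =>
    cases M with
    | nil => simp at hj
    | cons b M =>
      cases L with
      | nil => exact List.Lex.nil
      | cons a L =>
        have h0 := h 0 (by omega)
        simp only [List.getD_cons_zero] at h0
        subst h0
        refine List.Lex.cons (ih (fun i hi => ?_) (by simpa using hj))
        simpa using h (i + 1) (by omega)

/-- If the entries after the first one are positive, the comparison sees the first difference of
the sequences. -/
lemma List.exists_getD_of_lt {L M : List ℕ} (hM : ∀ x ∈ M, 0 < x) (h : L < M) :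
    ∃ j, (∀ i < j, L.getD i 0 = M.getD i 0) ∧ L.getD j 0 < M.getD j 0 := by
  induction h with
  | @nil b M => exact ⟨0, by simp, by simpa using hM b (by simp)⟩
  | @cons a L M h ih =>
    obtain ⟨j, h1, h2⟩ := ih fun x hx => hM x (List.mem_cons_of_mem _ hx)
    refine ⟨j + 1, fun i hi => ?_, by simpa using h2⟩
    cases i with
    | zero => rfl
    | succ i => simpa using h1 i (by omega)
  | @rel a b L M h => exact ⟨0, by simp, by simpa using h⟩

namespace PlaneTree
open SimpleGraph

/-- The depth of the vertex of index `i` in depth-first order, and `0` past the last vertex. -/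
def lev (T : PlaneTree) (i : ℕ) : ℕ := T.levels.getD i 0

@[simp] lemma lev_zero (T : PlaneTree) : T.lev 0 = 0 := rfl

lemma lev_of_le {T : PlaneTree} {i : ℕ} (h : T.size ≤ i) : T.lev i = 0 :=
  List.getD_eq_default _ _ (by simpa using h)

lemma lev_pos {T : PlaneTree} {i : ℕ} (h0 : 0 < i) (h : i < T.size) : 0 < T.lev i := by
  have hl := length_tail 0 T
  obtain ⟨i, rfl⟩ : ∃ j, i = j + 1 := ⟨i - 1, by omega⟩
  simp only [lev, levels, List.getD_cons_succ]
  rw [List.getD_eq_getElem _ _ (by omega)]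
  exact lt_of_mem_tail (List.getElem_mem _)

lemma lev_le_height (T : PlaneTree) (i : ℕ) : T.lev i ≤ T.height := by
  by_cases h : i < T.size
  · cases i with
    | zero => simp
    | succ i =>
      have hl := length_tail 0 T
      simp only [lev, levels, List.getD_cons_succ]
      rw [List.getD_eq_getElem _ _ (by omega)]
      simpa using le_of_mem_tail (List.getElem_mem (l := tail 0 T) (by omega))
  · rw [lev_of_le (not_lt.1 h)]; omega

lemma lev_graft_left (A : PlaneTree) {B : PlaneTree} {i : ℕ} (h : i < B.size) :
    (graft A B).lev (i + 1) = B.lev i + 1 := by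
  simp only [lev, levels_graft, List.getD_cons_succ]
  rw [List.getD_append _ _ _ _ (by simpa using h), List.getD_eq_getElem _ _ (by simpa using h),
    List.getElem_map, List.getD_eq_getElem _ _ (by simpa using h)]

lemma lev_graft_right (A B : PlaneTree) {i : ℕ} (h : 0 < i) :
    (graft A B).lev (B.size + i) = A.lev i := by
  obtain ⟨i, rfl⟩ : ∃ j, i = j + 1 := ⟨i - 1, by omega⟩
  simp only [lev, levels_graft, ← add_assoc, List.getD_cons_succ]
  have := length_tail 0 B
  rw [List.getD_append_right _ _ _ _ (by simp)]
  simp only [levels, List.length_map, List.length_cons, List.getD_cons_succ]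
  congr 1
  omega

lemma height_lt_size (T : PlaneTree) : T.height < T.size := by
  induction T with
  | leaf => simp [height, size]
  | graft A B ihA ihB =>
    have := A.size_pos
    simp only [height, size]
    omega

lemma lt_of_lev {T T' : PlaneTree} {j : ℕ} (h : ∀ i < j, T.lev i = T'.lev i)
    (hj : T.lev j < T'.lev j) : T < T' :=
  lt_iff_levels.2 (List.lt_of_getD h hj)

lemma exists_lev_of_lt {T T' : PlaneTree} (h : T < T') :
    ∃ j, (∀ i < j, T.lev i = T'.lev i) ∧ T.lev j < T'.lev j := by
  rw [lt_iff_levels] at h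
  have h' : tail 0 T < tail 0 T' := by
    simp only [levels] at h
    rcases h with _ | h | h
    · exact absurd h (lt_irrefl 0)
    · exact h
  obtain ⟨j, h1, h2⟩ := List.exists_getD_of_lt (fun x hx => lt_of_mem_tail hx) h'
  refine ⟨j + 1, fun i hi => ?_, by simpa [lev, levels] using h2⟩
  cases i with
  | zero => rfl
  | succ i => simpa [lev, levels] using h1 i (by omega)

/-- The level sequence of a canonical plane tree begins with `0, 1, 2, …` up to the height. -/
lemma lev_eq_self_aux {T : PlaneTree} (h : T.IsCanonical) :
    (∀ i ≤ T.height, T.lev i = i) ∧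
      ∀ x : PlaneTree, T.FirstLE x → (∀ i ≤ x.height, x.lev i = i) → T.height ≤ x.height + 1 := by
  induction T with
  | leaf =>
    refine ⟨fun i hi => ?_, fun x _ _ => by simp [height]⟩
    simp only [height, Nat.le_zero] at hi
    simp [hi]
  | graft A B ihA ihB =>
    obtain ⟨hA1, hA2⟩ := ihA h.1
    obtain ⟨hB1, hB2⟩ := ihB h.2.1
    have hAB := hA2 B h.2.2 hB1
    have hh : (graft A B).height = B.height + 1 := by simp only [height]; omega
    refine ⟨fun i hi => ?_, fun x hx hx1 => ?_⟩
    · cases i with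
      | zero => simp
      | succ i =>
        have := B.height_lt_size
        rw [lev_graft_left A (by omega), hB1 i (by omega)]
    · rw [hh]
      by_contra hlt
      refine absurd hx (not_le.2 ?_)
      refine lt_of_lev (j := x.height + 1) (fun i hi => ?_) ?_
      · rw [hx1 i (by omega), hB1 i (by omega)]
      · have := x.lev_le_height (x.height + 1)
        rw [hB1 _ (by omega)]
        omega

lemma lev_eq_self {T : PlaneTree} (h : T.IsCanonical) {i : ℕ} (hi : i ≤ T.height) :
    T.lev i = i := (lev_eq_self_aux h).1 i hi

lemma height_rest_le {A B : PlaneTree} (h : (graft A B).IsCanonical) :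
    A.height ≤ B.height + 1 :=
  (lev_eq_self_aux h.1).2 B h.2.2 (lev_eq_self_aux h.2.1).1

lemma height_graft {A B : PlaneTree} (h : (graft A B).IsCanonical) :
    (graft A B).height = B.height + 1 := by
  have := height_rest_le h
  simp only [height]; omega

lemma lt_of_height_lt {T T' : PlaneTree} (h : T.IsCanonical) (h' : T'.IsCanonical)
    (hlt : T.height < T'.height) : T < T' := by
  refine lt_of_lev (j := T.height + 1) (fun i hi => ?_) ?_
  · rw [lev_eq_self h (by omega), lev_eq_self h' (by omega)]
  · have := T.lev_le_height (T.height + 1)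
    rw [lev_eq_self h' (by omega)]
    omega

lemma height_le_of_le {T T' : PlaneTree} (h : T.IsCanonical) (h' : T'.IsCanonical)
    (hle : T ≤ T') : T.height ≤ T'.height := by
  by_contra hlt
  exact absurd hle (not_le.2 (lt_of_height_lt h' h (not_le.1 hlt)))

/-! ### Centres -/

/-- The depth of a vertex. -/
def depth : (T : PlaneTree) → Vert T → ℕ
  | leaf, _ => 0
  | graft A _, .inl v => depth A v
  | graft _ B, .inr v => depth B v + 1

lemma depth_root (T : PlaneTree) : T.depth T.root = 0 := by
  induction T with
  | leaf => rfl
  | graft A B ihA ihB => exact ihA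

lemma eq_root_of_depth {T : PlaneTree} {v : Vert T} (h : T.depth v = 0) : v = T.root := by
  induction T with
  | leaf => rfl
  | graft A B ihA ihB =>
    rcases v with v | v
    · exact congrArg Sum.inl (ihA h)
    · simp [depth] at h

lemma exists_depth_eq_height (T : PlaneTree) : ∃ v, T.depth v = T.height := by
  induction T with
  | leaf => exact ⟨(), rfl⟩
  | graft A B ihA ihB =>
    obtain ⟨a, ha⟩ := ihA
    obtain ⟨b, hb⟩ := ihB
    rcases le_total A.height (B.height + 1) with h | h
    · exact ⟨.inr b, by simp [depth, height, hb, h]⟩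
    · exact ⟨.inl a, by simp [depth, height, ha, h]⟩

lemma depth_le_height (T : PlaneTree) (v : Vert T) : T.depth v ≤ T.height := by
  induction T with
  | leaf => exact le_rfl
  | graft A B ihA ihB =>
    rcases v with v | v
    · have := ihA v
      simp only [depth, height]; omega
    · have := ihB v
      simp only [depth, height]; omega

lemma depth_adj {T : PlaneTree} {u v : Vert T} (h : T.graph.Adj u v) :
    T.depth u ≤ T.depth v + 1 := by
  induction T with
  | leaf => exact h.elim
  | graft A B ihA ihB =>
    rcases u with u | u <;> rcases v with v | v <;> simp only [depth]
    · exact ihA (joinEdge_inl_inl.1 h)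
    · obtain ⟨rfl, rfl⟩ := joinEdge_inl_inr.1 h
      rw [depth_root]; omega
    · obtain ⟨rfl, rfl⟩ := joinEdge_inr_inl.1 h
      rw [depth_root]; omega
    · have := ihB (joinEdge_inr_inr.1 h); omega

/-- A vertex whose greatest distance from the others is as small as possible. -/
def IsCentral {V : Type} (G : SimpleGraph V) (v : V) : Prop :=
  ∀ w, ∃ u', ∀ u, G.dist v u ≤ G.dist w u'

lemma dist_map_le {V W : Type} {G : SimpleGraph V} {H : SimpleGraph W} (hG : G.Connected)
    (f : G →g H) (u v : V) : H.dist (f u) (f v) ≤ G.dist u v := by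
  obtain ⟨p, hp⟩ := hG.exists_walk_length_eq_dist u v
  rw [← hp, ← p.length_map f]
  exact dist_le _

lemma dist_iso {V W : Type} {G : SimpleGraph V} {H : SimpleGraph W} (hG : G.Connected)
    (f : G ≃g H) (u v : V) : H.dist (f u) (f v) = G.dist u v := by
  refine le_antisymm (dist_map_le hG f.toHom u v) ?_
  have := dist_map_le (f.connected_iff.1 hG) f.symm.toHom (f u) (f v)
  simpa using this

lemma IsCentral.map {V W : Type} {G : SimpleGraph V} {H : SimpleGraph W} (hG : G.Connected)
    (f : G ≃g H) {v : V} (h : IsCentral G v) : IsCentral H (f v) := by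
  intro w
  obtain ⟨u', hu'⟩ := h (f.symm w)
  refine ⟨f u', fun u => ?_⟩
  have h1 := hu' (f.symm u)
  rw [← dist_iso hG f, ← dist_iso hG f] at h1
  simpa using h1

lemma dist_root_le (T : PlaneTree) (v : Vert T) : T.graph.dist T.root v ≤ T.depth v := by
  induction T with
  | leaf => exact (dist_self (G := (⊥ : SimpleGraph Unit))).le
  | graft A B ihA ihB =>
    let il : A.graph →g (graft A B).graph := ⟨Sum.inl, joinEdge_inl_inl.2⟩
    let ir : B.graph →g (graft A B).graph := ⟨Sum.inr, joinEdge_inr_inr.2⟩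
    rcases v with v | v
    · exact (dist_map_le A.connected_graph il _ _).trans (ihA v)
    · have h1 := dist_map_le B.connected_graph ir B.root v
      have h2 := (graft A B).connected_graph.dist_triangle (u := (graft A B).root)
        (v := .inr B.root) (w := .inr v)
      have h3 : (graft A B).graph.dist (graft A B).root (.inr B.root) = 1 :=
        dist_eq_one_iff_adj.2 (joinEdge_inl_inr.2 ⟨rfl, rfl⟩)
      have h4 := ihB v
      change (graft A B).graph.dist (.inr B.root) (.inr v) ≤ _ at h1
      simp only [depth]
      omega

lemma le_dist_of_lipschitz {V : Type} {G : SimpleGraph V} (hG : G.Connected) (f : V → ℤ)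
    (hf : ∀ u v, G.Adj u v → f u ≤ f v + 1) (u v : V) : f u - f v ≤ G.dist u v := by
  obtain ⟨p, hp⟩ := hG.exists_walk_length_eq_dist u v
  rw [← hp]
  clear hp
  induction p with
  | nil => simp
  | @cons u v w h p ih =>
    have := hf u v h
    simp only [Walk.length_cons]
    push_cast
    omega

/-- The distance from the edge between the root and its first child, with a sign for the side. -/
def signedDepth (A B : PlaneTree) : Vert A ⊕ Vert B → ℤ :=
  Sum.elim (fun v => A.depth v) fun v => -1 - B.depth v

lemma signedDepth_sub_le (A B : PlaneTree) (u v : Vert A ⊕ Vert B) :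
    signedDepth A B u - signedDepth A B v ≤ (graft A B).graph.dist u v := by
  refine le_dist_of_lipschitz (graft A B).connected_graph (signedDepth A B) ?_ u v
  rintro (u | u) (v | v) h <;> simp only [signedDepth, Sum.elim_inl, Sum.elim_inr]
  · have := depth_adj (joinEdge_inl_inl.1 h); omega
  · obtain ⟨rfl, rfl⟩ := joinEdge_inl_inr.1 h
    simp [depth_root]
  · obtain ⟨rfl, rfl⟩ := joinEdge_inr_inl.1 h
    simp [depth_root]
  · have := depth_adj (joinEdge_inr_inr.1 h).symm; omega

lemma exists_dist_inl (A B : PlaneTree) (v : Vert A) :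
    ∃ u, A.depth v + 1 + B.height ≤ (graft A B).graph.dist (.inl v) u := by
  obtain ⟨u, hu⟩ := B.exists_depth_eq_height
  refine ⟨.inr u, ?_⟩
  have := signedDepth_sub_le A B (.inl v) (.inr u)
  simp only [signedDepth, Sum.elim_inl, Sum.elim_inr] at this
  omega

lemma exists_dist_inr (A B : PlaneTree) (v : Vert B) :
    ∃ u, B.depth v + 1 + A.height ≤ (graft A B).graph.dist (.inr v) u := by
  obtain ⟨u, hu⟩ := A.exists_depth_eq_height
  refine ⟨.inl u, ?_⟩
  have := signedDepth_sub_le A B (.inl u) (.inr v)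
  simp only [signedDepth, Sum.elim_inl, Sum.elim_inr] at this
  rw [dist_comm]
  omega

lemma dist_inr_root_le (A B : PlaneTree) (u : Vert A ⊕ Vert B) :
    (graft A B).graph.dist (.inr B.root) u ≤ max B.height (A.height + 1) := by
  have h := dist_iso (graft A B).connected_graph
    (joinEdgeComm : (graft A B).graph ≃g (graft B A).graph) (.inr B.root) u
  rw [← h]
  exact ((graft B A).dist_root_le _).trans ((graft B A).depth_le_height _)

/-- If the rest is one level higher than the first subtree, the root is the only centre. -/
lemma isCentral_iff_of_lt {A B : PlaneTree} (h : A.height = B.height + 1)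
    (v : Vert (graft A B)) : IsCentral (graft A B).graph v ↔ v = (graft A B).root := by
  have hroot : ∀ u, (graft A B).graph.dist (graft A B).root u ≤ A.height := fun u =>
    ((graft A B).dist_root_le u).trans (((graft A B).depth_le_height u).trans
      (by simp [height, h]))
  constructor
  · intro hv
    obtain ⟨u', hu'⟩ := hv (graft A B).root
    have h1 := hroot u'
    rcases v with v | v
    · obtain ⟨u, hu⟩ := exists_dist_inl A B v
      have h2 := hu' u
      exact congrArg Sum.inl (eq_root_of_depth (by omega))
    · obtain ⟨u, hu⟩ := exists_dist_inr A B v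
      have h2 := hu' u
      omega
  · rintro rfl w
    rcases w with w | w
    · obtain ⟨u, hu⟩ := exists_dist_inl A B w
      exact ⟨u, fun u' => (hroot u').trans (by omega)⟩
    · obtain ⟨u, hu⟩ := exists_dist_inr A B w
      exact ⟨u, fun u' => (hroot u').trans (by omega)⟩

/-- If the first subtree and the rest have the same height, their roots are the centres. -/
lemma isCentral_iff_of_eq {A B : PlaneTree} (h : A.height = B.height) (v : Vert (graft A B)) :
    IsCentral (graft A B).graph v ↔ v = (graft A B).root ∨ v = .inr B.root := by
  have hroot : ∀ u, (graft A B).graph.dist (graft A B).root u ≤ A.height + 1 := fun u =>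
    ((graft A B).dist_root_le u).trans (((graft A B).depth_le_height u).trans
      (by simp [height, h]))
  have hroot' : ∀ u, (graft A B).graph.dist (.inr B.root) u ≤ A.height + 1 := fun u =>
    (dist_inr_root_le A B u).trans (by simp [h])
  have hw : ∀ w, ∃ u, A.height + 1 ≤ (graft A B).graph.dist w u := by
    rintro (w | w)
    · obtain ⟨u, hu⟩ := exists_dist_inl A B w
      exact ⟨u, by omega⟩
    · obtain ⟨u, hu⟩ := exists_dist_inr A B w
      exact ⟨u, by omega⟩
  constructor
  · intro hv
    obtain ⟨u', hu'⟩ := hv (graft A B).root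
    have h1 := hroot u'
    rcases v with v | v
    · obtain ⟨u, hu⟩ := exists_dist_inl A B v
      have h2 := hu' u
      exact Or.inl (congrArg Sum.inl (eq_root_of_depth (by omega)))
    · obtain ⟨u, hu⟩ := exists_dist_inr A B v
      have h2 := hu' u
      exact Or.inr (congrArg Sum.inr (eq_root_of_depth (by omega)))
  · rintro (rfl | rfl) w
    · obtain ⟨u, hu⟩ := hw w
      exact ⟨u, fun u' => (hroot u').trans hu⟩
    · obtain ⟨u, hu⟩ := hw w
      exact ⟨u, fun u' => (hroot' u').trans hu⟩

/-- The root is the centre by which the free tree is represented: it is a centre, and of two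
centres it is the one whose half is larger, in size and then in the lexicographic order. -/
def IsPrimary : PlaneTree → Prop
  | leaf => True
  | graft A B => B.height < A.height ∨
      B.height = A.height ∧ (B.size < A.size ∨ B.size = A.size ∧ B ≤ A)

/-- Canonical plane trees with primary root represent the isomorphism classes of free trees. -/
theorem eq_of_isPrimary {T T' : PlaneTree} (hT : T.IsCanonical) (hT' : T'.IsCanonical)
    (hp : T.IsPrimary) (hp' : T'.IsPrimary) (φ : T.graph ≃g T'.graph) : T = T' := by
  have hsize := size_eq_of_iso φ
  cases T with
  | leaf =>
    cases T' with
    | leaf => rfl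
    | graft A' B' =>
      have := A'.size_pos
      have := B'.size_pos
      simp only [size] at hsize
      omega
  | graft A B =>
    cases T' with
    | leaf =>
      have := A.size_pos
      have := B.size_pos
      simp only [size] at hsize
      omega
    | graft A' B' =>
      have hle := height_rest_le hT
      have hle' := height_rest_le hT'
      have hc : ∀ v, IsCentral (graft A B).graph v → IsCentral (graft A' B').graph (φ v) :=
        fun v hv => hv.map (graft A B).connected_graph φ
      have hc' : ∀ v, IsCentral (graft A' B').graph v → IsCentral (graft A B).graph (φ.symm v) :=
        fun v hv => hv.map (graft A' B').connected_graph φ.symm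
      have hne : ∀ (A B : PlaneTree), (graft A B).root ≠ .inr B.root := fun A B => Sum.inl_ne_inr
      rcases hp with hlt | ⟨heq, hs⟩
      · have h1 : A.height = B.height + 1 := by omega
        rcases hp' with hlt' | ⟨heq', hs'⟩
        · have h1' : A'.height = B'.height + 1 := by omega
          refine eq_of_rootIsomorphic hT hT' ⟨φ, ?_⟩
          exact (isCentral_iff_of_lt h1' _).1 (hc _ ((isCentral_iff_of_lt h1 _).2 rfl))
        · have e1 := (isCentral_iff_of_lt h1 _).1
            (hc' _ ((isCentral_iff_of_eq heq'.symm _).2 (Or.inl rfl)))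
          have e2 := (isCentral_iff_of_lt h1 _).1
            (hc' _ ((isCentral_iff_of_eq heq'.symm _).2 (Or.inr rfl)))
          exact absurd (φ.symm.injective (e1.trans e2.symm)) (hne _ _)
      · rcases hp' with hlt' | ⟨heq', hs'⟩
        · have h1' : A'.height = B'.height + 1 := by omega
          have e1 := (isCentral_iff_of_lt h1' _).1
            (hc _ ((isCentral_iff_of_eq heq.symm _).2 (Or.inl rfl)))
          have e2 := (isCentral_iff_of_lt h1' _).1
            (hc _ ((isCentral_iff_of_eq heq.symm _).2 (Or.inr rfl)))
          exact absurd (φ.injective (e1.trans e2.symm)) (hne _ _)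
        · have e1 := (isCentral_iff_of_eq heq'.symm _).1
            (hc _ ((isCentral_iff_of_eq heq.symm _).2 (Or.inl rfl)))
          have e2 := (isCentral_iff_of_eq heq'.symm _).1
            (hc _ ((isCentral_iff_of_eq heq.symm _).2 (Or.inr rfl)))
          rcases e1 with e1 | e1
          · exact eq_of_rootIsomorphic hT hT' ⟨φ, e1⟩
          · -- the two halves are exchanged, and by the rule for two centres they are equal
            have e3 : φ (.inr B.root) = (graft A' B').root := by
              rcases e2 with e2 | e2
              · exact e2
              · exact absurd (φ.injective (e1.trans e2.symm)) (hne _ _)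
            let ψ : (graft A B).graph ≃g (graft B' A').graph := φ.trans joinEdgeComm
            have f1 : ψ (.inl A.root) = .inl B'.root := congrArg Sum.swap e1
            have f2 : ψ (.inr B.root) = .inr A'.root := congrArg Sum.swap e3
            obtain ⟨hl, hr⟩ := respects_sides A.connected_graph B.connected_graph ψ f1 f2
            obtain ⟨α, β, hα, hβ, -⟩ := exists_joinEdgeCongr ψ hl hr
            obtain rfl := eq_of_rootIsomorphic hT.1 hT'.2.1 ⟨α, hα⟩
            obtain rfl := eq_of_rootIsomorphic hT.2.1 hT'.1 ⟨β, hβ⟩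
            have : A = B := by
              rcases hs with hs | ⟨hs, hs2⟩ <;> rcases hs' with hs' | ⟨hs', hs2'⟩
              · omega
              · omega
              · omega
              · exact le_antisymm hs2' hs2
            rw [this]

lemma height_insertKid (x T : PlaneTree) :
    (insertKid x T).height = max T.height (x.height + 1) := by
  induction T with
  | leaf => rfl
  | graft A B ihA ihB =>
    simp only [insertKid]
    split_ifs
    · rfl
    · simp only [height, ihA]; omega

lemma height_sortKids (T : PlaneTree) : T.sortKids.height = T.height := by
  induction T with
  | leaf => rfl
  | graft A B ihA ihB => rw [sortKids, height_insertKid, ihA, ihB, height]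

/-- Every free tree is represented: among the roots of least height take the primary one. -/
theorem exists_isPrimary (T₀ : PlaneTree) : ∃ T : PlaneTree, T.IsCanonical ∧ T.IsPrimary ∧
    Nonempty (T.graph ≃g T₀.graph) := by
  classical
  have hex : ∃ h, ∃ T : PlaneTree, T.IsCanonical ∧ T.height = h ∧ Nonempty (T.graph ≃g T₀.graph) := by
    obtain ⟨φ⟩ := T₀.rootIsomorphic_sortKids
    exact ⟨_, T₀.sortKids, T₀.isCanonical_sortKids, rfl, ⟨φ.1.symm⟩⟩
  obtain ⟨T, hT, hh, ⟨φ⟩⟩ := Nat.find_spec hex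
  have hmin : ∀ T' : PlaneTree, Nonempty (T'.graph ≃g T₀.graph) → T.height ≤ T'.sortKids.height := by
    rintro T' ⟨φ'⟩
    rw [hh]
    obtain ⟨ψ⟩ := T'.rootIsomorphic_sortKids
    exact Nat.find_min' hex ⟨_, T'.isCanonical_sortKids, rfl, ⟨ψ.1.symm.trans φ'⟩⟩
  cases T with
  | leaf => exact ⟨leaf, hT, trivial, ⟨φ⟩⟩
  | graft A B =>
    have hAB := height_rest_le hT
    have hswap : (graft B A).graph ≃g T₀.graph := joinEdgeComm.trans φ
    -- otherwise moving the root to its first child would decrease the height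
    have hle : B.height ≤ A.height := by
      by_contra hlt
      rw [not_le] at hlt
      have h1 := hmin _ ⟨hswap⟩
      have h2 : (graft B A).sortKids.height = B.height := by
        rw [height_sortKids, height]; omega
      rw [h2, height_graft hT] at h1
      omega
    rcases lt_or_eq_of_le hle with hlt | heq
    · exact ⟨graft A B, hT, Or.inl hlt, ⟨φ⟩⟩
    · by_cases hs : B.size < A.size ∨ B.size = A.size ∧ B ≤ A
      · exact ⟨graft A B, hT, Or.inr ⟨heq, hs⟩, ⟨φ⟩⟩
      · refine ⟨graft B A, ⟨hT.2.1, hT.1, ?_⟩, Or.inr ⟨heq.symm, ?_⟩, ⟨hswap⟩⟩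
        · cases B with
          | leaf => trivial
          | graft B₁ B₂ =>
            have := height_graft hT.2.1
            exact (lt_of_height_lt hT.2.1.2.1 hT.1 (by omega)).le
        · push Not at hs
          rcases lt_or_eq_of_le hs.1 with h | h
          · exact Or.inl h
          · exact Or.inr ⟨h, (hs.2 h.symm).le⟩

/-- An automorphism fixes the root or, if there are two centres, exchanges the centres. -/
theorem card_aut {A B : PlaneTree} (hT : (graft A B).IsCanonical) (hp : (graft A B).IsPrimary) :
    Nat.card ((graft A B).graph ≃g (graft A B).graph) =
      isoCount (graft A B) (graft A B) * if A = B then 2 else 1 := by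
  classical
  have hle := height_rest_le hT
  set T := graft A B with hTdef
  have hfin : Finite (T.graph ≃g T.graph) :=
    Finite.of_injective (fun φ => (φ : T.Vert → T.Vert)) DFunLike.coe_injective
  have hc : ∀ (φ : T.graph ≃g T.graph) v, IsCentral T.graph v → IsCentral T.graph (φ v) :=
    fun φ v hv => hv.map T.connected_graph φ
  -- besides those that fix the root there are the automorphisms that move it to its first child
  have hsplit : Nat.card (T.graph ≃g T.graph) = isoCount T T +
      Nat.card {φ : T.graph ≃g T.graph // φ T.root ≠ T.root} := by
    rw [isoCount, ← Nat.card_sum]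
    exact Nat.card_congr (Equiv.sumCompl fun φ : T.graph ≃g T.graph => φ T.root = T.root).symm
  rw [hsplit]
  by_cases hAB : A = B
  · -- composition with the exchange of the equal halves
    rw [if_pos hAB, mul_two]
    congr 1
    rw [isoCount]
    subst hAB
    let σ : T.graph ≃g T.graph := joinEdgeComm
    have hσ : σ T.root = .inr A.root := rfl
    have hσ' : σ (.inr A.root) = T.root := rfl
    have hr : ∀ φ : T.graph ≃g T.graph, φ T.root = T.root ∨ φ T.root = .inr A.root := fun φ =>
      (isCentral_iff_of_eq rfl _).1 (hc φ _ ((isCentral_iff_of_eq rfl _).2 (Or.inl rfl)))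
    have hne : T.root ≠ .inr A.root := Sum.inl_ne_inr
    refine Nat.card_congr ⟨fun φ => ⟨φ.1.trans σ, ?_⟩, fun φ => ⟨φ.1.trans σ, ?_⟩, ?_, ?_⟩
    · have := (hr φ.1).resolve_left φ.2
      change σ (φ.1 T.root) = _
      rw [this, hσ']
    · change σ (φ.1 T.root) ≠ _
      rw [φ.2, hσ]
      exact hne.symm
    · intro φ
      refine Subtype.ext ?_
      ext u
      exact Sum.swap_swap _
    · intro φ
      refine Subtype.ext ?_
      ext u
      exact Sum.swap_swap _
  · -- an automorphism that moves the root is an isomorphism of the two halves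
    rw [if_neg hAB, mul_one]
    have : IsEmpty {φ : T.graph ≃g T.graph // φ T.root ≠ T.root} := by
      refine ⟨fun ⟨φ, hφ⟩ => ?_⟩
      rcases hp with hlt | ⟨heq, hs⟩
      · have h1 : A.height = B.height + 1 := by omega
        exact hφ ((isCentral_iff_of_lt h1 _).1 (hc φ _ ((isCentral_iff_of_lt h1 _).2 rfl)))
      · have e1 := (isCentral_iff_of_eq heq.symm _).1
          (hc φ _ ((isCentral_iff_of_eq heq.symm _).2 (Or.inl rfl)))
        have e2 := (isCentral_iff_of_eq heq.symm _).1
          (hc φ _ ((isCentral_iff_of_eq heq.symm _).2 (Or.inr rfl)))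
        have e1 := e1.resolve_left hφ
        have e3 : φ (.inr B.root) = T.root := by
          rcases e2 with e2 | e2
          · exact e2
          · exact absurd (φ.injective (e1.trans e2.symm)) Sum.inl_ne_inr
        let ψ : (graft A B).graph ≃g (graft B A).graph := φ.trans joinEdgeComm
        have f1 : ψ (.inl A.root) = .inl B.root := congrArg Sum.swap e1
        have f2 : ψ (.inr B.root) = .inr A.root := congrArg Sum.swap e3
        obtain ⟨hl, hr⟩ := respects_sides A.connected_graph B.connected_graph ψ f1 f2
        obtain ⟨α, β, hα, hβ, -⟩ := exists_joinEdgeCongr ψ hl hr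
        exact hAB (eq_of_rootIsomorphic hT.1 hT.2.1 ⟨α, hα⟩)
    rw [Nat.card_of_isEmpty, add_zero]

end PlaneTree

namespace PlaneTree

/-! ### Canonical level sequences -/

/-- Canonicity of a level sequence, read as a function that vanishes past the end: if `v` is the
next sibling of `u`, then the sequence from `v` on is at the first difference, up to the end of the
subtree of `u`, not larger than the sequence from `u` on. -/
def IdxCanonical (f : ℕ → ℕ) : Prop :=
  ∀ u v, u < v → f u = f v → (∀ i, u < i → i < v → f u < f i) →
    ∀ j ≤ v - u, (∀ i < j, f (v + i) = f (u + i)) → f (v + j) ≤ f (u + j)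

lemma lev_one_le (T : PlaneTree) : T.lev 1 ≤ 1 := by
  cases T with
  | leaf => rw [lev_of_le (by simp [size])]; omega
  | graft A B =>
    have := lev_graft_left A B.size_pos
    simp at this
    omega

lemma lev_one {T : PlaneTree} (h : 1 < T.size) : T.lev 1 = 1 := by
  have := lev_one_le T
  have := lev_pos (T := T) (i := 1) (by omega) h
  omega

lemma two_le_lev_graft (A : PlaneTree) {B : PlaneTree} {i : ℕ} (h2 : 2 ≤ i) (hi : i ≤ B.size) :
    2 ≤ (graft A B).lev i := by
  obtain ⟨i, rfl⟩ : ∃ j, i = j + 1 := ⟨i - 1, by omega⟩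
  rw [lev_graft_left A (by omega)]
  have := lev_pos (T := B) (i := i) (by omega) (by omega)
  omega

lemma lev_graft_size_succ_le (A B : PlaneTree) : (graft A B).lev (B.size + 1) ≤ 1 := by
  rw [lev_graft_right A B (by omega)]
  exact A.lev_one_le

lemma idxCanonical_of_isCanonical {T : PlaneTree} (h : T.IsCanonical) : IdxCanonical T.lev := by
  induction T with
  | leaf =>
    intro u v huv _ _ j _ _
    rw [lev_of_le (by simp only [size]; omega)]
    omega
  | graft A B ihA ihB =>
    have ihA := ihA h.1
    have ihB := ihB h.2.1
    intro u v huv he hb j hj ha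
    set T := graft A B with hT
    have hsize : T.size = A.size + B.size := rfl
    have hA := A.size_pos
    have hB := B.size_pos
    have eL : ∀ i, i < B.size → T.lev (i + 1) = B.lev i + 1 := fun i hi => lev_graft_left A hi
    have eR : ∀ i, 0 < i → T.lev (B.size + i) = A.lev i := fun i hi => lev_graft_right A B hi
    by_cases hv : T.size ≤ v
    · rw [lev_of_le (by omega)]; omega
    rw [not_le] at hv
    have hvpos := lev_pos (T := T) (i := v) (by omega) hv
    have hu : 0 < u := by
      rcases Nat.eq_zero_or_pos u with rfl | h
      · rw [lev_zero] at he; omega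
      · exact h
    have hsucc : T.lev (B.size + 1) ≤ 1 := lev_graft_size_succ_le A B
    by_cases hvB : v ≤ B.size
    · -- both vertices lie in the first subtree
      have h2 : 2 ≤ T.lev v := two_le_lev_graft A (by omega) hvB
      by_cases hvj : v + j ≤ B.size
      · have key := ihB (u - 1) (v - 1) (by omega) ?_ ?_ j (by omega) ?_
        · have e1 := eL (v - 1 + j) (by omega)
          have e2 := eL (u - 1 + j) (by omega)
          rw [show v - 1 + j + 1 = v + j by omega] at e1
          rw [show u - 1 + j + 1 = u + j by omega] at e2
          omega
        · have e1 := eL (v - 1) (by omega)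
          have e2 := eL (u - 1) (by omega)
          rw [show v - 1 + 1 = v by omega] at e1
          rw [show u - 1 + 1 = u by omega] at e2
          omega
        · intro i hi1 hi2
          have e1 := eL (i) (by omega)
          have e2 := eL (u - 1) (by omega)
          rw [show u - 1 + 1 = u by omega] at e2
          have := hb (i + 1) (by omega) (by omega)
          omega
        · intro i hi
          have e1 := eL (v - 1 + i) (by omega)
          have e2 := eL (u - 1 + i) (by omega)
          rw [show v - 1 + i + 1 = v + i by omega] at e1
          rw [show u - 1 + i + 1 = u + i by omega] at e2
          have := ha i hi
          omega
      · -- the comparison leaves the first subtree, after which there is an entry `≤ 1`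
        have hle : T.lev u ≤ T.lev (u + j) := by
          rcases Nat.eq_zero_or_pos j with rfl | hj0
          · exact le_rfl
          · rcases Nat.lt_or_ge (u + j) v with hlt | hge
            · exact (hb (u + j) (by omega) hlt).le
            · rw [show u + j = v by omega, he]
        by_cases hvj' : v + j = B.size + 1
        · rw [hvj']; omega
        · exfalso
          have e := ha (B.size + 1 - v) (by omega)
          rw [show v + (B.size + 1 - v) = B.size + 1 by omega] at e
          have := hb (u + (B.size + 1 - v)) (by omega) (by omega)
          omega
    · rw [not_le] at hvB
      by_cases huB : B.size < u
      · -- both vertices lie in the rest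
        have key := ihA (u - B.size) (v - B.size) (by omega) ?_ ?_ j (by omega) ?_
        · have e1 := eR (v - B.size + j) (by omega)
          have e2 := eR (u - B.size + j) (by omega)
          rw [show B.size + (v - B.size + j) = v + j by omega] at e1
          rw [show B.size + (u - B.size + j) = u + j by omega] at e2
          omega
        · have e1 := eR (v - B.size) (by omega)
          have e2 := eR (u - B.size) (by omega)
          rw [show B.size + (v - B.size) = v by omega] at e1
          rw [show B.size + (u - B.size) = u by omega] at e2
          omega
        · intro i hi1 hi2
          have e1 := eR (i) (by omega)
          have e2 := eR (u - B.size) (by omega)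
          rw [show B.size + (u - B.size) = u by omega] at e2
          have := hb (B.size + i) (by omega) (by omega)
          omega
        · intro i hi
          have e1 := eR (v - B.size + i) (by omega)
          have e2 := eR (u - B.size + i) (by omega)
          rw [show B.size + (v - B.size + i) = v + i by omega] at e1
          rw [show B.size + (u - B.size + i) = u + i by omega] at e2
          have := ha i hi
          omega
      · -- only the roots of the first two subtrees are siblings across the end of the first one
        rw [not_lt] at huB
        have hv1 : v = B.size + 1 := by
          by_contra hne
          have := hb (B.size + 1) (by omega) (by omega)
          rcases Nat.lt_or_ge u 2 with h1 | h1
          · obtain rfl : u = 1 := by omega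
            have := lev_one (T := T) (by omega)
            omega
          · have := two_le_lev_graft A h1 huB
            omega
        subst hv1
        have hu1 : u = 1 := by
          by_contra hne
          have : 2 ≤ T.lev u := two_le_lev_graft A (by omega) huB
          omega
        subst hu1
        cases A with
        | leaf =>
          simp only [size] at hsize
          omega
        | graft A₂ B₂ =>
          -- the entries of the two subtrees, and the entry after the second one
          have hle : B₂ ≤ B := h.2.2
          have hB2 := B₂.size_pos
          have r1 : ∀ i, i < B₂.size → T.lev (B.size + 1 + i) = B₂.lev i + 1 := by
            intro i hi
            rw [show B.size + 1 + i = B.size + (i + 1) by omega, hT,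
              lev_graft_right _ B (by omega), lev_graft_left _ hi]
          have r2 : ∀ i, i < B.size → T.lev (1 + i) = B.lev i + 1 := by
            intro i hi
            rw [add_comm 1 i, hT, lev_graft_left _ hi]
          have r3 : T.lev (B.size + 1 + B₂.size) ≤ 1 := by
            rw [show B.size + 1 + B₂.size = B.size + (B₂.size + 1) by omega, hT,
              lev_graft_right _ B (by omega)]
            exact lev_graft_size_succ_le _ _
          rcases Nat.lt_or_ge B₂.size j with h1 | h1
          · exfalso
            have e := ha B₂.size h1
            have : 2 ≤ T.lev (1 + B₂.size) := two_le_lev_graft _ (by omega) (by omega)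
            omega
          · rcases Nat.lt_or_ge j B.size with h2 | h2
            · rcases h1.lt_or_eq with h3 | h3
              · rw [r1 j h3, r2 j h2]
                by_contra hlt
                refine absurd hle (not_le.2 (lt_of_lev (j := j) (fun i hi => ?_) (by omega)))
                have := ha i hi
                rw [r1 i (by omega), r2 i (by omega)] at this
                omega
              · have := lev_pos (T := T) (i := 1 + j) (by omega) (by omega)
                rw [h3] at *
                omega
            · obtain rfl : j = B.size := by omega
              rcases h1.lt_or_eq with h3 | h3
              · exfalso
                refine absurd hle (not_le.2 (lt_of_lev (j := B.size) (fun i hi => ?_) ?_))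
                · have := ha i hi
                  rw [r1 i (by omega), r2 i (by omega)] at this
                  omega
                · rw [lev_of_le le_rfl]
                  exact lev_pos hB h3
              · have := lev_one (T := T) (by omega)
                rw [show 1 + B.size = B.size + 1 by omega, ← he, this]
                exact h3 ▸ r3

lemma isCanonical_of_idxCanonical {T : PlaneTree} (h : IdxCanonical T.lev) : T.IsCanonical := by
  induction T with
  | leaf => trivial
  | graft A B ihA ihB =>
    have hA := A.size_pos
    have hB := B.size_pos
    have hsize : (graft A B).size = A.size + B.size := rfl
    refine ⟨ihA ?_, ihB ?_, ?_⟩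
    · intro u v huv he hb j hj ha
      by_cases hv : A.size ≤ v
      · rw [lev_of_le (by omega)]; omega
      have hvpos := lev_pos (T := A) (i := v) (by omega) (by omega)
      have hu : 0 < u := by
        rcases Nat.eq_zero_or_pos u with rfl | h
        · rw [lev_zero] at he; omega
        · exact h
      have key := h (B.size + u) (B.size + v) (by omega)
        (by rw [lev_graft_right A B hu, lev_graft_right A B (by omega), he]) ?_ j (by omega) ?_
      · rwa [add_assoc, add_assoc, lev_graft_right A B (by omega),
          lev_graft_right A B (by omega)] at key
      · intro i hi1 hi2
        have := hb (i - B.size) (by omega) (by omega)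
        have e := lev_graft_right A B (i := i - B.size) (by omega)
        rw [show B.size + (i - B.size) = i by omega] at e
        rw [lev_graft_right A B hu, e]
        exact this
      · intro i hi
        rw [add_assoc, add_assoc, lev_graft_right A B (by omega), lev_graft_right A B (by omega)]
        exact ha i hi
    · intro u v huv he hb j hj ha
      by_cases hvj : B.size ≤ v + j
      · rw [lev_of_le hvj]; omega
      have key := h (u + 1) (v + 1) (by omega)
        (by rw [lev_graft_left A (by omega), lev_graft_left A (by omega), he]) ?_ j (by omega) ?_
      · rw [show v + 1 + j = v + j + 1 by omega, show u + 1 + j = u + j + 1 by omega,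
          lev_graft_left A (by omega), lev_graft_left A (by omega)] at key
        omega
      · intro i hi1 hi2
        obtain ⟨i, rfl⟩ : ∃ j, i = j + 1 := ⟨i - 1, by omega⟩
        have := hb i (by omega) (by omega)
        rw [lev_graft_left A (by omega), lev_graft_left A (by omega)]
        omega
      · intro i hi
        have := ha i hi
        rw [show v + 1 + i = v + i + 1 by omega, show u + 1 + i = u + i + 1 by omega,
          lev_graft_left A (by omega), lev_graft_left A (by omega)]
        omega
    · -- compare the first two children of the root
      cases A with
      | leaf => trivial
      | graft A₂ B₂ =>
        change B₂ ≤ B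
        by_contra hlt
        rw [not_le] at hlt
        obtain ⟨j, h1, h2⟩ := exists_lev_of_lt hlt
        have hB2 := B₂.size_pos
        have hj2 : j < B₂.size := by
          by_contra hj
          rw [lev_of_le (T := B₂) (by omega)] at h2
          omega
        have hj1 : j ≤ B.size := by
          by_contra hj
          have := h1 B.size (by omega)
          rw [lev_of_le le_rfl] at this
          have := lev_pos (T := B₂) hB (by omega)
          omega
        have r1 : ∀ i, i < B₂.size →
            (graft (graft A₂ B₂) B).lev (B.size + 1 + i) = B₂.lev i + 1 := by
          intro i hi
          rw [show B.size + 1 + i = B.size + (i + 1) by omega,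
            lev_graft_right _ B (by omega), lev_graft_left _ hi]
        have r2 : ∀ i, i < B.size → (graft (graft A₂ B₂) B).lev (1 + i) = B.lev i + 1 := by
          intro i hi
          rw [add_comm 1 i, lev_graft_left _ hi]
        have r0 := r1 0 hB2
        have r0' := r2 0 hB
        simp only [add_zero, lev_zero] at r0 r0'
        have key := h 1 (B.size + 1) (by omega) (by rw [r0, r0']) ?_ j (by omega) ?_
        · rw [r1 j hj2] at key
          rcases hj1.lt_or_eq with h3 | h3
          · rw [r2 j h3] at key; omega
          · subst h3
            rw [show 1 + B.size = B.size + 1 by omega, r0] at key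
            rw [lev_of_le le_rfl] at h2
            omega
        · intro i hi1 hi2
          rw [r0']
          have := two_le_lev_graft (graft A₂ B₂) (B := B) (i := i) (by omega) (by omega)
          omega
        · intro i hi
          rw [r1 i (by omega), r2 i (by omega), h1 i hi]

/-- A list is a level sequence if it starts with `0`, has no other entry `0`, and each entry exceeds
the one before by one at most. -/
lemma exists_levels (L : List ℕ) (hL : 0 < L.length) (h0 : L.getD 0 0 = 0)
    (hpos : ∀ i, 0 < i → i < L.length → 0 < L.getD i 0)
    (hstep : ∀ i, i + 1 < L.length → L.getD (i + 1) 0 ≤ L.getD i 0 + 1) :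
    ∃ T : PlaneTree, T.levels = L := by
  cases L with
  | nil => simp at hL
  | cons a l =>
    simp only [List.getD_cons_zero] at h0
    subst h0
    have hex : ∃ T, tail 0 T = l := by
      refine exists_tail 0 l ?_ ?_ ?_
      · intro x hx
        obtain ⟨i, hi, rfl⟩ := List.mem_iff_getElem.1 hx
        have := hpos (i + 1) (by omega) (by simpa using hi)
        rwa [List.getD_cons_succ, List.getD_eq_getElem _ _ hi] at this
      · intro x hx
        cases l with
        | nil => simp at hx
        | cons y l =>
          have := hstep 0 (by simp)
          simp at this hx
          omega
      · rw [List.isChain_iff_getElem]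
        intro i hi
        have := hstep (i + 1) (by simpa using hi)
        rwa [List.getD_cons_succ, List.getD_cons_succ, List.getD_eq_getElem _ _ hi,
          List.getD_eq_getElem _ _ (by omega)] at this
    obtain ⟨T, hT⟩ := hex
    exact ⟨T, by simp [levels, hT]⟩

lemma lev_succ_le (T : PlaneTree) (i : ℕ) : T.lev (i + 1) ≤ T.lev i + 1 := by
  induction T generalizing i with
  | leaf => rw [lev_of_le (by simp [size])]; omega
  | graft A B ihA ihB =>
    have hB := B.size_pos
    rcases lt_trichotomy i B.size with h | h | h
    · rw [lev_graft_left A h]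
      cases i with
      | zero => simp
      | succ i =>
        rw [lev_graft_left A (by omega)]
        have := ihB i
        omega
    · subst h
      have := lev_graft_size_succ_le A B
      omega
    · obtain ⟨i, rfl⟩ := Nat.exists_eq_add_of_lt h
      rw [show B.size + i + 1 + 1 = B.size + (i + 1 + 1) by omega,
        show B.size + i + 1 = B.size + (i + 1) by omega,
        lev_graft_right A B (by omega), lev_graft_right A B (by omega)]
      exact ihA _

lemma eq_of_lev {T T' : PlaneTree} (hs : T.size = T'.size) (h : ∀ i < T.size, T.lev i = T'.lev i) :
    T = T' := by
  apply levels_injective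
  apply List.ext_getElem (by simpa using hs)
  intro i h1 h2
  have := h i (by simpa using h1)
  rwa [lev, lev, List.getD_eq_getElem _ _ h1, List.getD_eq_getElem _ _ h2] at this

/-- The level sequence of the first subtree and the next entry determine the first subtree. -/
lemma first_eq {A B A' B' : PlaneTree} (h : ∀ i ≤ B.size, (graft A B).lev i = (graft A' B').lev i)
    (h' : (graft A' B').lev (B.size + 1) ≤ 1) : B = B' := by
  have hB := B.size_pos
  have hB' := B'.size_pos
  have hs : B.size = B'.size := by
    rcases lt_trichotomy B.size B'.size with hlt | heq | hlt
    · have := two_le_lev_graft A' (B := B') (i := B.size + 1) (by omega) (by omega)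
      omega
    · exact heq
    · have h1 := lev_graft_size_succ_le A' B'
      have h2 := two_le_lev_graft A (B := B) (i := B'.size + 1) (by omega) (by omega)
      have := h (B'.size + 1) (by omega)
      omega
  refine eq_of_lev hs fun i hi => ?_
  have := h (i + 1) (by omega)
  rw [lev_graft_left A hi, lev_graft_left A' (by omega)] at this
  omega

/-! ### The successor step -/

/-- `g` agrees with `f` before `p` and repeats from `p` to `n` the stretch that begins at the parent
`q` of `p`. -/
structure PeriodicExt (f g : ℕ → ℕ) (n q p : ℕ) : Prop where
  q_lt : q < p
  p_lt : p < n
  parent : f q + 1 = f p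
  between : ∀ i, q < i → i < p → f q < f i
  pre : ∀ i < p, g i = f i
  per : ∀ i, p ≤ i → i < n → g i = g (i - (p - q))
  zero : ∀ i, n ≤ i → g i = 0

namespace PeriodicExt

variable {f g : ℕ → ℕ} {n q p : ℕ}

lemma le (h : PeriodicExt f g n q p) (i : ℕ) (h1 : q ≤ i) (h2 : i < n) : f q ≤ g i := by
  induction i using Nat.strong_induction_on with
  | _ i ih =>
    have := h.q_lt
    rcases Nat.lt_or_ge i p with hi | hi
    · rw [h.pre i hi]
      rcases h1.lt_or_eq with h3 | h3
      · exact (h.between i h3 hi).le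
      · rw [h3]
    · rw [h.per i hi h2]
      exact ih _ (by omega) (by omega) (by omega)

/-- The level of `q` is reached only where the repeated stretch begins again. -/
lemma dvd (h : PeriodicExt f g n q p) (i : ℕ) (h1 : q ≤ i) (h2 : i < n) (h3 : g i = f q) :
    p - q ∣ i - q := by
  induction i using Nat.strong_induction_on with
  | _ i ih =>
    have := h.q_lt
    rcases Nat.lt_or_ge i p with hi | hi
    · rw [h.pre i hi] at h3
      rcases h1.lt_or_eq with h4 | h4
      · have := h.between i h4 hi
        omega
      · simp [← h4]
    · rw [h.per i hi h2] at h3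
      have := ih _ (by omega) (by omega) (by omega) h3
      rw [show i - q = (i - (p - q) - q) + (p - q) by omega]
      exact Dvd.dvd.add this dvd_rfl

/-- The stretch in which the entry before index `j` lies begins at `w`. -/
lemma exists_block (h : PeriodicExt f g n q p) (j : ℕ) (h1 : p < j) (h2 : j ≤ n) :
    ∃ w, p ≤ w ∧ w < j ∧ j ≤ w + (p - q) ∧ g w = f q := by
  induction j using Nat.strong_induction_on with
  | _ j ih =>
    have hq := h.q_lt
    by_cases hj : j ≤ p + (p - q)
    · refine ⟨p, le_rfl, h1, hj, ?_⟩
      rw [h.per p le_rfl h.p_lt, show p - (p - q) = q by omega, h.pre q hq]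
    · obtain ⟨w, hw1, hw2, hw3, hw4⟩ := ih (j - (p - q)) (by omega) (by omega) (by omega)
      refine ⟨w + (p - q), by omega, by omega, by omega, ?_⟩
      rw [h.per _ (by omega) (by omega), show w + (p - q) - (p - q) = w by omega, hw4]

lemma lt_of_between (h : PeriodicExt f g n q p) {w i : ℕ} (hw : p ≤ w) (hwn : w ≤ n)
    (hd : p - q ∣ w - q) (h1 : w - (p - q) < i) (h2 : i < w) : f q < g i := by
  have hq := h.q_lt
  refine lt_of_le_of_ne (h.le i (by omega) (by omega)) fun he => ?_
  have hdi := h.dvd i (by omega) (by omega) he.symm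
  have h3 : p - q ∣ (w - q) - (i - q) := Nat.dvd_sub hd hdi
  have := Nat.le_of_dvd (by omega) h3
  omega

/-- Siblings past `p` are either the beginnings of two stretches, after which the sequence is the
same, or lie in one stretch, so that they can be moved back by a period. -/
lemma idxCanonical (h : PeriodicExt f g n q p) (hf : IdxCanonical f) : IdxCanonical g := by
  intro u v
  induction v using Nat.strong_induction_on generalizing u with
  | _ v ih =>
    intro huv he hb j hj ha
    have hq := h.q_lt
    have hp := h.p_lt
    by_cases hvj : n ≤ v + j
    · rw [h.zero _ hvj]; omega
    rw [not_le] at hvj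
    rcases Nat.lt_or_ge v p with hv | hv
    · -- before `p` the sequences agree, and at `p` the value has decreased
      have hgp : g p + 1 = f p := by
        rw [h.per p le_rfl hp, show p - (p - q) = q by omega, h.pre q hq, h.parent]
      have hf' := hf u v huv (by rw [← h.pre u (by omega), ← h.pre v hv, he])
        (fun i h1 h2 => by
          rw [← h.pre u (by omega), ← h.pre i (by omega)]; exact hb i h1 h2)
      have hag : ∀ i < j, v + i < p → f (v + i) = f (u + i) := fun i hi hip => by
        rw [← h.pre _ hip, ← h.pre _ (by omega)]; exact ha i hi
      rcases lt_trichotomy (v + j) p with h1 | h1 | h1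
      · rw [h.pre _ h1, h.pre _ (by omega)]
        exact hf' j hj fun i hi => hag i hi (by omega)
      · have := hf' j hj fun i hi => hag i hi (by omega)
        rw [h1] at this ⊢
        rw [h.pre (u + j) (by omega)]
        omega
      · -- agreement at `p` would contradict the canonicity of `f`, where the value is larger
        exfalso
        have h3 := hf' (p - v) (by omega) fun i hi => hag i (by omega) (by omega)
        have h4 := ha (p - v) (by omega)
        rw [show v + (p - v) = p by omega] at h3 h4
        rw [h.pre (u + (p - v)) (by omega)] at h4
        omega
    · rcases (h.le v (by omega) (by omega)).lt_or_eq with hlt | heq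
      · -- inside a block: compare with the block before
        have hvp : p < v := by
          refine lt_of_le_of_ne hv fun hpv => ?_
          rw [← hpv, h.per p le_rfl hp, show p - (p - q) = q by omega, h.pre q hq] at hlt
          omega
        obtain ⟨w, hw1, hw2, hw3, hw4⟩ := h.exists_block v hvp (by omega)
        -- a sibling of `v` does not come before the beginning of the block, which is less deep
        have huw : w < u := by
          by_contra hle
          rcases (not_lt.1 hle).lt_or_eq with h3 | h3
          · have := hb w h3 hw2
            omega
          · rw [h3] at he; omega
        have sh : ∀ i, w ≤ i → i < n → g i = g (i - (p - q)) := fun i h1 h2 =>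
          h.per i (by omega) h2
        have key := ih (v - (p - q)) (by omega) (u - (p - q)) (by omega)
          (by rw [← sh u huw.le (by omega), ← sh v (by omega) (by omega), he]) ?_ j (by omega) ?_
        · rw [sh (v + j) (by omega) hvj, sh (u + j) (by omega) (by omega),
            show v + j - (p - q) = v - (p - q) + j by omega,
            show u + j - (p - q) = u - (p - q) + j by omega]
          exact key
        · intro i h1 h2
          have := hb (i + (p - q)) (by omega) (by omega)
          rwa [sh u huw.le (by omega), sh (i + (p - q)) (by omega) (by omega),
            show i + (p - q) - (p - q) = i by omega] at this
        · intro i hi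
          have := ha i hi
          rwa [sh (v + i) (by omega) (by omega), sh (u + i) (by omega) (by omega),
            show v + i - (p - q) = v - (p - q) + i by omega,
            show u + i - (p - q) = u - (p - q) + i by omega] at this
      · -- at the beginning of a block
        have hdv := h.dvd v (by omega) (by omega) heq.symm
        have hu : u = v - (p - q) := by
          rcases lt_trichotomy u (v - (p - q)) with h1 | h1 | h1
          · have := hb (v - (p - q)) h1 (by omega)
            rw [← h.per v hv (by omega)] at this
            omega
          · exact h1
          · have := h.lt_of_between hv (by omega) hdv h1 huv
            omega
        subst hu
        rw [h.per (v + j) (by omega) hvj, show v + j - (p - q) = v - (p - q) + j by omega]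

/-- The periodic extension is the largest canonical sequence that falls below `f` at an index
`≤ p` first. -/
lemma not_lt (h : PeriodicExt f g n q p) {N : ℕ → ℕ} (hN : IdxCanonical N)
    (hNn : ∀ i, n ≤ i → N i = 0) {j : ℕ} (hj : j ≤ p) (h1 : ∀ i < j, N i = f i) (h2 : N j < f j)
    {j₀ : ℕ} (h3 : ∀ i < j₀, g i = N i) : ¬ g j₀ < N j₀ := by
  intro h4
  have hq := h.q_lt
  have hp := h.p_lt
  have hgp : g p + 1 = f p := by
    rw [h.per p le_rfl hp, show p - (p - q) = q by omega, h.pre q hq, h.parent]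
  have hjn : j₀ < n := by
    by_contra hle
    rw [hNn j₀ (by omega)] at h4
    omega
  rcases lt_trichotomy j₀ j with hlt | heq | hgt
  · have := h1 j₀ hlt
    rw [h.pre j₀ (by omega)] at h4
    omega
  · subst heq
    rcases hj.lt_or_eq with h5 | h5
    · rw [h.pre _ h5] at h4; omega
    · subst h5; omega
  · have hjp : j = p := by
      by_contra hne
      have := h3 j hgt
      rw [h.pre j (by omega)] at this
      omega
    subst hjp
    -- compare the stretch that contains `j₀` with the one before, of which it is a copy in `g`
    obtain ⟨w, hw1, hw2, hw3, hw4⟩ := h.exists_block j₀ hgt hjn.le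
    have hd := h.dvd w (by omega) (by omega) hw4
    have key := hN (w - (j - q)) w (by omega) ?_ ?_ (j₀ - w) (by omega) ?_
    · rw [show w + (j₀ - w) = j₀ by omega, ← h3 (w - (j - q) + (j₀ - w)) (by omega),
        show w - (j - q) + (j₀ - w) = j₀ - (j - q) by omega, ← h.per j₀ (by omega) hjn] at key
      omega
    · rw [← h3 _ (by omega), ← h3 w hw2, h.per w hw1 (by omega)]
    · intro i hi1 hi2
      rw [← h3 _ (by omega), ← h3 i (by omega), ← h.per w hw1 (by omega), hw4]
      exact h.lt_of_between hw1 (by omega) hd hi1 hi2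
    · intro i hi
      rw [← h3 _ (by omega), ← h3 _ (by omega), h.per (w + i) (by omega) (by omega),
        show w + i - (j - q) = w - (j - q) + i by omega]

end PeriodicExt

/-- The periodic extension of a canonical level sequence is the largest canonical level sequence
that falls below it at an index `≤ p` first. -/
lemma exists_successor {T : PlaneTree} (hT : T.IsCanonical) {L : List ℕ} {q p : ℕ}
    (hlen : L.length = T.size) (hp : 2 ≤ T.lev p)
    (h : PeriodicExt T.lev (fun i => L.getD i 0) T.size q p) :
    ∃ S : PlaneTree, S.levels = L ∧ S.size = T.size ∧ S.IsCanonical ∧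
      (∀ i < p, S.lev i = T.lev i) ∧ S.lev p + 1 = T.lev p ∧ S < T ∧
      PeriodicExt T.lev S.lev T.size q p ∧
      ∀ N : PlaneTree, N.IsCanonical → N.size = T.size → ∀ j ≤ p, (∀ i < j, N.lev i = T.lev i) →
        N.lev j < T.lev j → N ≤ S := by
  have hq := h.q_lt
  have hpn := h.p_lt
  have hq1 : 0 < q := by
    rcases Nat.eq_zero_or_pos q with rfl | hq
    · have := h.parent
      rw [lev_zero] at this
      omega
    · exact hq
  have hgp : L.getD p 0 + 1 = T.lev p := by
    have := h.per p le_rfl hpn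
    rw [this, show p - (p - q) = q by omega, h.pre q hq, h.parent]
  have hex : ∃ S : PlaneTree, S.levels = L := by
    refine exists_levels L (by omega) ((h.pre 0 (by omega)).trans T.lev_zero) ?_ ?_
    · intro i h0 hi
      have hTq : 0 < T.lev q := by have := h.parent; omega
      rcases Nat.lt_or_ge i q with h1 | h1
      · rw [h.pre i (by omega)]
        exact lev_pos h0 (by omega)
      · exact hTq.trans_le (h.le i h1 (by omega))
    · intro i
      induction i using Nat.strong_induction_on with
      | _ i ih =>
        intro hi
        have hstep := T.lev_succ_le i
        rcases lt_trichotomy (i + 1) p with h1 | h1 | h1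
        · rw [h.pre _ h1, h.pre i (by omega)]
          exact hstep
        · rw [h.pre i (by omega), h1]
          rw [h1] at hstep
          omega
        · have e1 := h.per (i + 1) (by omega) (by omega)
          have e2 := h.per i (by omega) (by omega)
          rw [e1, e2, show i + 1 - (p - q) = i - (p - q) + 1 by omega]
          exact ih (i - (p - q)) (by omega) (by omega)
  obtain ⟨S, hS⟩ := hex
  have hlev : S.lev = fun i => L.getD i 0 := by funext i; rw [lev, hS]
  have hsize : S.size = T.size := by rw [← length_levels, hS, hlen]
  have h' : PeriodicExt T.lev S.lev T.size q p := hlev ▸ h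
  have hc : S.IsCanonical := isCanonical_of_idxCanonical
    (h'.idxCanonical (idxCanonical_of_isCanonical hT))
  have hSp : S.lev p + 1 = T.lev p := by rw [hlev]; exact hgp
  refine ⟨S, hS, hsize, hc, h'.pre, hSp, lt_of_lev h'.pre (by omega), h', ?_⟩
  intro N hN hNs j hj h1 h2
  by_contra hlt
  obtain ⟨j₀, h3, h4⟩ := exists_lev_of_lt (not_le.1 hlt)
  exact h'.not_lt (idxCanonical_of_isCanonical hN) (fun i hi => lev_of_le (by omega)) hj h1 h2 h3 h4

/-! ### Primary trees -/

/-- A tree whose first subtree has at least `k` vertices and reaches the level `h + 1` is not primary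
if at most `h + 1` vertices remain: the rest can neither be higher than the first subtree nor as high
and not smaller. -/
lemma not_isPrimary_of_deep {N : PlaneTree} (hN : N.IsPrimary) {k h i₀ : ℕ} (hk : k < N.size)
    (h2 : ∀ i, 2 ≤ i → i ≤ k → 2 ≤ N.lev i) (h0 : 0 < i₀) (hi₀ : i₀ < k) (hd : h + 1 ≤ N.lev i₀)
    (hn : N.size ≤ k + h + 1) (hhk : h + 1 < k) : False := by
  cases N with
  | leaf => simp only [size] at hk; omega
  | graft A B =>
    have hB := B.size_pos
    have hkB : k ≤ B.size := by
      by_contra hlt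
      have := h2 (B.size + 1) (by omega) (by omega)
      have := lev_graft_size_succ_le A B
      omega
    have hhB : h ≤ B.height := by
      obtain ⟨i, rfl⟩ : ∃ j, i₀ = j + 1 := ⟨i₀ - 1, by omega⟩
      rw [lev_graft_left A (by omega)] at hd
      have := B.lev_le_height i
      omega
    have hA := A.height_lt_size
    simp only [size] at hn
    rcases hN with h3 | ⟨h3, h4⟩ <;> omega

/-- Replacing the end of a canonical sequence by a path that hangs from the root: the result is
canonical if the path is not longer than the one with which the sequence begins, and no primary
tree is lost between the two sequences. -/
lemma exists_pathEnd {S : PlaneTree} (hS : S.IsCanonical) {k s h i₀ : ℕ} (hn : k + s = S.size)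
    (hk : 2 ≤ k) (hsk : s < k) (h2 : ∀ i, 2 ≤ i → i < k → 2 ≤ S.lev i)
    (hs : ∀ i ≤ s, S.lev i = i) (h0 : 0 < i₀) (hi₀ : i₀ < k) (hd : h + 1 ≤ S.lev i₀)
    (hsh : s ≤ h + 1) (hhk : h + 1 < k) :
    ∃ M : PlaneTree, M.levels = S.levels.take k ++ List.range' 1 s ∧ M.IsCanonical ∧
      M.size = S.size ∧ (∀ i < k, M.lev i = S.lev i) ∧ (∀ i < s, M.lev (k + i) = i + 1) ∧
      ∀ N : PlaneTree, N.IsPrimary → N.size = S.size → N ≤ S → N ≤ M := by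
  have hlen : (S.levels.take k ++ List.range' 1 s).length = S.size := by
    simp; omega
  have g1 : ∀ i < k, (S.levels.take k ++ List.range' 1 s).getD i 0 = S.lev i := by
    intro i hi
    rw [List.getD_append _ _ _ _ (by simp; omega), lev, List.getD_eq_getElem _ _ (by simp; omega),
      List.getElem_take, List.getD_eq_getElem]
  have g2 : ∀ i < s, (S.levels.take k ++ List.range' 1 s).getD (k + i) 0 = i + 1 := by
    intro i hi
    rw [List.getD_append_right _ _ _ _ (by simp), List.getD_eq_getElem _ _ (by simp; omega),
      List.getElem_range']
    simp
    omega
  have hex : ∃ M : PlaneTree, M.levels = S.levels.take k ++ List.range' 1 s := by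
    refine exists_levels _ (by omega) (by rw [g1 0 (by omega), lev_zero]) ?_ ?_
    · intro i h3 hi
      rcases Nat.lt_or_ge i k with h4 | h4
      · rw [g1 i h4]
        exact lev_pos h3 (by omega)
      · obtain ⟨i, rfl⟩ := Nat.exists_eq_add_of_le h4
        rw [g2 i (by omega)]
        omega
    · intro i hi
      rcases lt_trichotomy (i + 1) k with h4 | h4 | h4
      · rw [g1 _ h4, g1 i (by omega)]
        exact S.lev_succ_le i
      · have := g2 0 (by omega)
        rw [add_zero] at this
        rw [h4, this]
        omega
      · obtain ⟨j, rfl⟩ := Nat.exists_eq_add_of_le (show k ≤ i by omega)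
        rw [g2 j (by omega), add_assoc, g2 (j + 1) (by omega)]
  obtain ⟨M, hM⟩ := hex
  have m1 : ∀ i < k, M.lev i = S.lev i := fun i hi => by rw [lev, hM, g1 i hi]
  have m2 : ∀ i < s, M.lev (k + i) = i + 1 := fun i hi => by rw [lev, hM, g2 i hi]
  have hMs : M.size = S.size := by rw [← length_levels, hM, hlen]
  have mk : M.lev k ≤ 1 := by
    rcases Nat.eq_zero_or_pos s with h3 | h3
    · rw [lev_of_le (by omega)]; omega
    · have := m2 0 h3
      rw [add_zero] at this
      omega
  refine ⟨M, hM, ?_, hMs, m1, m2, ?_⟩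
  · apply isCanonical_of_idxCanonical
    intro u v huv he hb j hj ha
    by_cases hvj : S.size ≤ v + j
    · rw [lev_of_le (by omega)]; omega
    have hvpos := lev_pos (T := M) (i := v) (by omega) (by omega)
    have hu : 0 < u := by
      rcases Nat.eq_zero_or_pos u with rfl | h
      · rw [lev_zero] at he; omega
      · exact h
    -- `v` lies before the path, or it is its first vertex, or a later one, which has no siblings
    rcases lt_trichotomy v k with hv | hv | hv
    · rcases lt_trichotomy (v + j) k with h3 | h3 | h3
      · rw [m1 _ h3, m1 _ (by omega)]
        refine idxCanonical_of_isCanonical hS u v huv ?_ ?_ j hj ?_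
        · rw [← m1 _ (by omega), ← m1 _ hv, he]
        · intro i h4 h5
          rw [← m1 _ (by omega), ← m1 i (by omega)]
          exact hb i h4 h5
        · intro i hi
          rw [← m1 _ (by omega), ← m1 _ (by omega)]
          exact ha i hi
      · rw [h3]
        have := lev_pos (T := M) (i := u + j) (by omega) (by omega)
        omega
      · exfalso
        have h4 := ha (k - v) (by omega)
        rw [show v + (k - v) = k by omega, m1 (u + (k - v)) (by omega)] at h4
        have := h2 (u + (k - v)) (by omega) (by omega)
        omega
    · subst hv
      have hu1 : u = 1 := by
        by_contra hne
        have := h2 u (by omega) huv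
        rw [← m1 u huv] at this
        omega
      subst hu1
      rw [m2 j (by omega)]
      rw [m1 (1 + j) (by omega), hs (1 + j) (by omega)]
      omega
    · exfalso
      obtain ⟨i, rfl⟩ := Nat.exists_eq_add_of_lt hv
      have e1 := m2 (i + 1) (by omega)
      rw [← add_assoc] at e1
      rcases lt_trichotomy u k with h3 | h3 | h3
      · have := hb k h3 hv
        have := lev_pos (T := M) (i := u) hu (by omega)
        omega
      · subst h3; omega
      · obtain ⟨i', rfl⟩ := Nat.exists_eq_add_of_lt h3
        have e2 := m2 (i' + 1) (by omega)
        rw [← add_assoc] at e2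
        omega
  · intro N hN hNs hle
    by_contra hlt
    obtain ⟨j, h3, h4⟩ := exists_lev_of_lt (not_le.1 hlt)
    have hjn : j < N.size := by
      by_contra hj
      rw [lev_of_le (T := N) (by omega)] at h4
      omega
    rcases Nat.lt_or_ge j k with hj | hj
    · refine absurd hle (not_le.2 (lt_of_lev (j := j) (fun i hi => ?_) ?_))
      · rw [← h3 i hi, m1 i (by omega)]
      · rwa [m1 j hj] at h4
    · -- `N` agrees with `M` before `k` and exceeds it later, so that its first subtree has not ended
      have hNk : 2 ≤ N.lev k := by
        by_contra hNk
        have hle2 : ∀ i, N.lev (k + i) ≤ i + 1 := by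
          intro i
          induction i with
          | zero => rw [add_zero]; omega
          | succ i ih =>
            have := N.lev_succ_le (k + i)
            rw [← add_assoc]
            omega
        obtain ⟨i, rfl⟩ := Nat.exists_eq_add_of_le hj
        have := hle2 i
        rw [m2 i (by omega)] at h4
        omega
      refine not_isPrimary_of_deep hN (k := k) (h := h) (i₀ := i₀) (by omega) (fun i h5 h6 => ?_)
        h0 hi₀ ?_ (by omega) hhk
      · rcases h6.lt_or_eq with h7 | h7
        · rw [← h3 i (by omega), m1 i h7]
          exact h2 i h5 h7
        · rw [h7]; exact hNk
      · rw [← h3 i₀ (by omega), m1 i₀ hi₀]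
        exact hd

end PlaneTree

/-! ### Values and times of step-counted computations -/

namespace Timed

@[simp] lemma val_bind {α β : Type} (x : Timed α) (f : α → Timed β) :
    (x >>= f).val = (f x.val).val := rfl

@[simp] lemma time_bind {α β : Type} (x : Timed α) (f : α → Timed β) :
    (x >>= f).time = x.time + (f x.val).time := rfl

@[simp] lemma val_pure {α : Type} (a : α) : (pure a : Timed α).val = a := (rfl)

@[simp] lemma time_pure {α : Type} (a : α) : (pure a : Timed α).time = 0 := rfl

@[simp] lemma val_op {α : Type} (a : α) : (op a).val = a := (rfl)

@[simp] lemma time_op {α : Type} (a : α) : (op a).time = 1 := rfl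

@[simp] lemma val_steps {α : Type} (k : ℕ) (a : α) : (steps k a).val = a := (rfl)

@[simp] lemma time_steps {α : Type} (k : ℕ) (a : α) : (steps k a).time = k := rfl

@[simp] lemma val_ite {α : Type} (c : Prop) [Decidable c] (x y : Timed α) :
    (if c then x else y).val = if c then x.val else y.val := apply_ite _ _ _ _

@[simp] lemma time_ite {α : Type} (c : Prop) [Decidable c] (x y : Timed α) :
    (if c then x else y).time = if c then x.time else y.time := apply_ite _ _ _ _

lemma val_mapList {ι R : Type} (f : ι → Timed R) (l : List ι) :
    (mapList f l).val = l.map fun i => (f i).val := by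
  induction l with
  | nil => rfl
  | cons k l ih => simp [mapList, ih]

lemma time_mapList_le {ι R : Type} {f : ι → Timed R} {l : List ι} {c : ℕ}
    (h : ∀ i ∈ l, (f i).time ≤ c) : (mapList f l).time ≤ l.length * (c + 1) + 1 := by
  induction l with
  | nil => simp [mapList]
  | cons k l ih =>
    have h1 := h k (by simp)
    have h2 := ih fun i hi => h i (by simp [hi])
    simp only [mapList, time_bind, time_op, List.length_cons]
    rw [Nat.add_mul]
    omega

lemma val_sumOver {ι R : Type} [AddMonoid R] (f : ι → Timed R) (l : List ι) :
    (sumOver f l).val = (l.map fun i => (f i).val).sum := by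
  induction l with
  | nil => rfl
  | cons k l ih => simp [sumOver, ih]

lemma time_sumOver_le {ι R : Type} [AddMonoid R] {f : ι → Timed R} {l : List ι} {c : ℕ}
    (h : ∀ i ∈ l, (f i).time ≤ c) : (sumOver f l).time ≤ l.length * (c + 1) + 1 := by
  induction l with
  | nil => simp [sumOver]
  | cons k l ih =>
    have h1 := h k (by simp)
    have h2 := ih fun i hi => h i (by simp [hi])
    simp only [sumOver, time_bind, time_op, List.length_cons]
    rw [Nat.add_mul]
    omega

lemma val_tabulate {ι R : Type} [DecidableEq ι] [Zero R] (f : ι → Timed R) (l : List ι) (i : ι) :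
    (tabulate f l).val i = if i ∈ l then (f i).val else 0 := by
  induction l with
  | nil => rfl
  | cons k l ih =>
    simp only [tabulate, val_bind, val_op]
    by_cases h : i = k
    · subst h; simp
    · rw [Function.update_of_ne h, ih]
      simp [h]

lemma time_tabulate_le {ι R : Type} [DecidableEq ι] [Zero R] {f : ι → Timed R} {l : List ι} {c : ℕ}
    (h : ∀ i ∈ l, (f i).time ≤ c) : (tabulate f l).time ≤ l.length * (c + 1) + 1 := by
  induction l with
  | nil => simp [tabulate]
  | cons k l ih =>
    have h1 := h k (by simp)
    have h2 := ih fun i hi => h i (by simp [hi])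
    simp only [tabulate, time_bind, time_op, List.length_cons]
    rw [Nat.add_mul]
    omega

end Timed

/-! ### The steps of the generation of the free trees -/

namespace FreeTrees

open Timed PlaneTree

@[simp] lemma val_rd (L : List ℕ) (i : ℕ) : (rd L i).val = L.getD i 0 := (rfl)

@[simp] lemma time_rd (L : List ℕ) (i : ℕ) : (rd L i).time = 1 := rfl

lemma findLevel_spec (L : List ℕ) (l s : ℕ) : (findLevel L l s).val ≤ s ∧
    (∀ i, (findLevel L l s).val < i → i ≤ s → L.getD i 0 ≠ l) ∧
    ((findLevel L l s).val = 0 ∨ L.getD (findLevel L l s).val 0 = l) := by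
  induction s with
  | zero => exact ⟨le_rfl, fun i h1 h2 => by simp [findLevel] at h1; omega, Or.inl rfl⟩
  | succ s ih =>
    simp only [findLevel, val_bind, val_rd, val_op, val_ite, decide_eq_true_eq]
    split_ifs with h
    · exact ⟨le_rfl, fun i h1 h2 => by omega, Or.inr h⟩
    · refine ⟨ih.1.trans (by omega), fun i h1 h2 => ?_, ih.2.2⟩
      rcases h2.lt_or_eq with h3 | h3
      · exact ih.2.1 i h1 (by omega)
      · rw [h3]; exact h

lemma time_findLevel_le (L : List ℕ) (l s : ℕ) : (findLevel L l s).time ≤ 2 * s + 1 := by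
  induction s with
  | zero => simp [findLevel]
  | succ s ih =>
    simp only [findLevel, time_bind, time_rd, val_rd, time_op, val_op, time_ite]
    split_ifs <;> omega

lemma time_parent_le (L : List ℕ) (j : ℕ) : (parent L j).time ≤ 2 * j + 4 := by
  have := time_findLevel_le L (L.getD j 0 - 1) (j - 1)
  simp only [parent, time_bind, time_rd, val_rd, time_op, val_op]
  omega

/-- The last vertex before `p` that is one level higher is the parent of `p`. -/
lemma parent_spec (T : PlaneTree) {p : ℕ} (h0 : 0 < p) (hp : p < T.size) :
    (parent T.levels p).val < p ∧ T.lev (parent T.levels p).val + 1 = T.lev p ∧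
      ∀ i, (parent T.levels p).val < i → i < p → T.lev (parent T.levels p).val < T.lev i := by
  obtain ⟨h1, h2, h3⟩ := findLevel_spec T.levels (T.lev p - 1) (p - 1)
  have hval : (parent T.levels p).val = (findLevel T.levels (T.lev p - 1) (p - 1)).val := rfl
  rw [hval]
  set r := (findLevel T.levels (T.lev p - 1) (p - 1)).val
  have hpos := lev_pos h0 hp
  -- levels go up by one at most, so no level between is skipped
  have key : ∀ k i, i + k + 1 = p → r < i → T.lev p ≤ T.lev i := by
    intro k
    induction k with
    | zero =>
      intro i hi hr
      have hs := T.lev_succ_le i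
      have h4 : T.lev i ≠ T.lev p - 1 := h2 i hr (by omega)
      rw [show i + 1 = p by omega] at hs
      omega
    | succ k ih =>
      intro i hi hr
      have hs := T.lev_succ_le i
      have h4 : T.lev i ≠ T.lev p - 1 := h2 i hr (by omega)
      have := ih (i + 1) (by omega) (by omega)
      omega
  have hr : T.lev r + 1 = T.lev p := by
    rcases h3 with h3 | h3
    · rw [h3, lev_zero]
      have hs := T.lev_succ_le 0
      rw [lev_zero] at hs
      rcases Nat.lt_or_ge 1 p with h5 | h5
      · have := key (p - 2) 1 (by omega) (by omega)
        simp only [zero_add] at hs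
        omega
      · obtain rfl : p = 1 := by omega
        simp only [zero_add] at hs
        omega
    · have h3 : T.lev r = T.lev p - 1 := h3
      omega
  refine ⟨by omega, hr, fun i h5 h6 => ?_⟩
  have := key (p - 1 - i) i (by omega) h5
  omega

lemma lastDeep_spec (L : List ℕ) (s : ℕ) : (lastDeep L s).val ≤ s ∧
    (∀ i, (lastDeep L s).val < i → i ≤ s → L.getD i 0 = 1) ∧
    ((lastDeep L s).val = 0 ∨ L.getD (lastDeep L s).val 0 ≠ 1) := by
  induction s with
  | zero => exact ⟨le_rfl, fun i h1 h2 => by simp [lastDeep] at h1; omega, Or.inl rfl⟩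
  | succ s ih =>
    simp only [lastDeep, val_bind, val_rd, val_op, val_ite, decide_eq_true_eq]
    split_ifs with h
    · refine ⟨ih.1.trans (by omega), fun i h1 h2 => ?_, ih.2.2⟩
      rcases h2.lt_or_eq with h3 | h3
      · exact ih.2.1 i h1 (by omega)
      · rw [h3]; exact h
    · exact ⟨le_rfl, fun i h1 h2 => by omega, Or.inr h⟩

lemma time_lastDeep_le (L : List ℕ) (s : ℕ) : (lastDeep L s).time ≤ 2 * s + 1 := by
  induction s with
  | zero => simp [lastDeep]
  | succ s ih =>
    simp only [lastDeep, time_bind, time_rd, val_rd, time_op, val_op, time_ite]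
    split_ifs <;> omega

lemma pushCopies_spec (d k : ℕ) (acc : List ℕ) (hd : 0 < d) (hacc : d ≤ acc.length) :
    (pushCopies d k acc).val.length = acc.length + k ∧
      (∀ i < acc.length, (pushCopies d k acc).val.getD i 0 = acc.getD i 0) ∧
      ∀ i, acc.length ≤ i → i < acc.length + k →
        (pushCopies d k acc).val.getD i 0 = (pushCopies d k acc).val.getD (i - d) 0 := by
  induction k generalizing acc with
  | zero => exact ⟨rfl, fun i _ => rfl, fun i h1 h2 => by omega⟩
  | succ k ih =>
    simp only [pushCopies, val_bind, val_op, val_rd]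
    set a := acc.getD (acc.length - d) 0 with ha
    obtain ⟨h1, h2, h3⟩ := ih (acc ++ [a]) (by simp; omega)
    simp only [List.length_append, List.length_singleton] at h1 h2 h3
    refine ⟨by omega, fun i hi => ?_, fun i hi1 hi2 => ?_⟩
    · rw [h2 i (by omega), List.getD_append _ _ _ _ hi]
    · rcases hi1.lt_or_eq with h4 | h4
      · exact h3 i (by omega) (by omega)
      · subst h4
        rw [h2 _ (by omega), h2 _ (by omega), List.getD_append_right _ _ _ _ le_rfl,
          List.getD_append _ _ _ _ (by omega)]
        simp [ha]

lemma time_pushCopies (d k : ℕ) (acc : List ℕ) : (pushCopies d k acc).time = 3 * k + 1 := by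
  induction k generalizing acc with
  | zero => rfl
  | succ k ih =>
    simp only [pushCopies, time_bind, time_op, time_rd, ih]
    omega

lemma time_successorAt_le (L : List ℕ) (p : ℕ) :
    (successorAt L p).time ≤ 3 * L.length + 3 * p + 7 := by
  have := time_parent_le L p
  simp only [successorAt, time_bind, time_op, time_steps, time_pushCopies, val_op]
  omega

/-- The successor step computes the largest canonical sequence that falls below the given one at an
index `≤ p` first. -/
lemma successorAt_spec {T : PlaneTree} (hT : T.IsCanonical) {p : ℕ} (hp : 2 ≤ T.lev p) :
    ∃ S : PlaneTree, S.levels = (successorAt T.levels p).val ∧ S.size = T.size ∧ S.IsCanonical ∧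
      (∀ i < p, S.lev i = T.lev i) ∧ S.lev p + 1 = T.lev p ∧ S < T ∧
      (∃ q, PeriodicExt T.lev S.lev T.size q p) ∧
      ∀ N : PlaneTree, N.IsCanonical → N.size = T.size → ∀ j ≤ p, (∀ i < j, N.lev i = T.lev i) →
        N.lev j < T.lev j → N ≤ S := by
  have hpn : p < T.size := by
    by_contra h
    rw [lev_of_le (by omega)] at hp
    omega
  have hp0 : 0 < p := by
    rcases Nat.eq_zero_or_pos p with rfl | h
    · rw [lev_zero] at hp; omega
    · exact h
  obtain ⟨h1, h2, h3⟩ := parent_spec T hp0 hpn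
  set q := (parent T.levels p).val with hq
  have hlen : (T.levels.take p).length = p := by simp; omega
  obtain ⟨g1, g2, g3⟩ := pushCopies_spec (p - q) (T.size - p) (T.levels.take p) (by omega)
    (by omega)
  have hval : (successorAt T.levels p).val =
      (pushCopies (p - q) (T.size - p) (T.levels.take p)).val := by
    simp only [successorAt, val_bind, val_op, val_steps, length_levels, ← hq]
  rw [hlen] at g1 g2 g3
  obtain ⟨S, a1, a2, a3, a4, a5, a6, a7, a8⟩ := exists_successor hT (q := q)
    (L := (successorAt T.levels p).val) (by rw [hval]; omega) hp
    ⟨h1, hpn, h2, h3, fun i hi => by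
      rw [hval, g2 i hi, lev, List.getD_eq_getElem _ _ (by omega), List.getElem_take,
        List.getD_eq_getElem], fun i hi1 hi2 => by
      rw [hval, g3 i hi1 (by omega)], fun i hi => by
      rw [hval, List.getD_eq_default]; omega⟩
  exact ⟨S, a1, a2, a3, a4, a5, a6, ⟨q, a7⟩, a8⟩

lemma findOne_spec (L : List ℕ) (k i : ℕ) : i ≤ (findOne L k i).val ∧ (findOne L k i).val ≤ i + k ∧
    (∀ j, i ≤ j → j < (findOne L k i).val → L.getD j 0 ≠ 1) ∧
    ((findOne L k i).val = i + k ∨ L.getD (findOne L k i).val 0 = 1) := by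
  induction k generalizing i with
  | zero => exact ⟨le_rfl, le_rfl, fun j h1 h2 => by simp [findOne] at h2; omega, Or.inl rfl⟩
  | succ k ih =>
    simp only [findOne, val_bind, val_rd, val_op, val_ite, decide_eq_true_eq]
    split_ifs with h
    · exact ⟨le_rfl, by omega, fun j h1 h2 => by omega, Or.inr h⟩
    · obtain ⟨h1, h2, h3, h4⟩ := ih (i + 1)
      refine ⟨by omega, by omega, fun j h5 h6 => ?_, ?_⟩
      · rcases h5.lt_or_eq with h7 | h7
        · exact h3 j h7 h6
        · rw [← h7]; exact h
      · rcases h4 with h4 | h4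
        · exact Or.inl (by omega)
        · exact Or.inr h4

lemma time_findOne_le (L : List ℕ) (k i : ℕ) : (findOne L k i).time ≤ 3 * k + 1 := by
  induction k generalizing i with
  | zero => simp [findOne]
  | succ k ih =>
    have := ih (i + 1)
    simp only [findOne, time_bind, time_rd, val_rd, time_op, val_op, time_ite]
    split_ifs <;> omega

lemma val_split (A B : PlaneTree) : (split (graft A B).levels).val = (B.levels, A.levels) := by
  have hA := A.size_pos
  have hB := B.size_pos
  have hsize : (graft A B).size = A.size + B.size := rfl
  obtain ⟨h1, h2, h3, h4⟩ := findOne_spec (graft A B).levels (A.size + B.size - 2) 2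
  set m := (findOne (graft A B).levels (A.size + B.size - 2) 2).val with hm
  have hmB : m = B.size + 1 := by
    rcases lt_trichotomy m (B.size + 1) with h | h | h
    · rcases h4 with h4 | h4
      · omega
      · have : 2 ≤ (graft A B).lev m := two_le_lev_graft A h1 (by omega)
        rw [lev] at this
        omega
    · exact h
    · exfalso
      apply h3 (B.size + 1) (by omega) h
      have h5 := lev_graft_size_succ_le A B
      have h6 := lev_pos (T := graft A B) (i := B.size + 1) (by omega) (by omega)
      rw [lev] at h5 h6
      omega
  simp only [split, val_bind, val_op, val_steps, length_levels, hsize]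
  rw [← hm, hmB, levels_graft]
  have e1 : (0 :: (B.levels.map (· + 1) ++ tail 0 A)).take (B.size + 1) =
      0 :: B.levels.map (· + 1) := by
    rw [List.take_succ_cons, List.take_left' (by simp)]
  have e2 : (0 :: (B.levels.map (· + 1) ++ tail 0 A)).drop (B.size + 1) = tail 0 A := by
    rw [List.drop_succ_cons, List.drop_left' (by simp)]
  rw [e1, e2]
  simp [levels, Function.comp_def]

lemma time_split_le (L : List ℕ) (hL : 2 ≤ L.length) : (split L).time ≤ 5 * L.length := by
  have h1 := time_findOne_le L (L.length - 2) 2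
  have h2 := (findOne_spec L (L.length - 2) 2).2.1
  simp only [split, time_bind, time_op, time_steps, val_op]
  omega

lemma val_height_append (l l' : List ℕ) :
    (height (l ++ l')).val = max (height l).val (height l').val := by
  induction l with
  | nil => simp [height]
  | cons a l ih => simp [height, ih, max_assoc]

lemma val_height_tail (d : ℕ) (T : PlaneTree) :
    max d (height (tail d T)).val = d + T.height := by
  induction T generalizing d with
  | leaf => simp [tail, height, PlaneTree.height]
  | graft A B ihA ihB =>
    have h1 := ihA d
    have h2 := ihB (d + 1)
    simp only [tail, height, val_bind, val_op, val_height_append, PlaneTree.height]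
    omega

lemma val_height (T : PlaneTree) : (height T.levels).val = T.height := by
  have := val_height_tail 0 T
  simp only [levels, height, val_bind, val_op]
  omega

lemma time_height (L : List ℕ) : (height L).time = L.length + 1 := by
  induction L with
  | nil => rfl
  | cons a l ih => simp [height, ih]

lemma val_lexGreater (l l' : List ℕ) : (lexGreater l l').val = decide (l' < l) := by
  induction l generalizing l' with
  | nil => simp [lexGreater]
  | cons a l ih =>
    cases l' with
    | nil => simp [lexGreater]
    | cons b l' =>
      simp only [lexGreater, val_bind, val_op, val_ite, decide_eq_true_eq, ih]
      split_ifs with h1 h2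
      · simp [List.cons_lt_cons_iff, h1]
      · simp [List.cons_lt_cons_iff, h1, h2.ne']
      · obtain rfl : a = b := by omega
        simp

lemma time_lexGreater_le (l l' : List ℕ) : (lexGreater l l').time ≤ 2 * l.length + 1 := by
  induction l generalizing l' with
  | nil => simp [lexGreater]
  | cons a l ih =>
    cases l' with
    | nil => simp [lexGreater]
    | cons b l' =>
      have := ih l'
      simp only [lexGreater, time_bind, time_op, val_op, time_ite, List.length_cons]
      split_ifs <;> omega

lemma val_isPrimary (A B : PlaneTree) :
    (isPrimary B.levels A.levels).val = true ↔ (graft A B).IsPrimary := by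
  simp only [isPrimary, val_bind, val_op, val_ite, decide_eq_true_eq, val_height, length_levels,
    val_lexGreater, ← lt_iff_levels, PlaneTree.IsPrimary]
  split_ifs with h1 h2 h3 h4
  · simp; omega
  · simp [h2]
  · simp; omega
  · simp; omega
  · have e1 : B.height = A.height := by omega
    have e2 : B.size = A.size := by omega
    simp [e1, e2]

lemma time_isPrimary_le (l l' : List ℕ) :
    (isPrimary l l').time ≤ 3 * l.length + l'.length + 8 := by
  have := time_lexGreater_le l l'
  simp only [isPrimary, time_bind, time_op, val_op, time_ite, time_height]
  split_ifs <;> omega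

/-- What the generation preserves besides canonicity: if the tree is not primary, the rest has room
for a path as long as the height of the first subtree. -/
def Invariant : PlaneTree → Prop
  | leaf => True
  | graft A B => (graft A B).IsPrimary ∨ B.height < A.size

/-- Skipping to the next free tree: the result is the largest primary sequence that is not larger
than the given one. -/
lemma nextFree_spec {T : PlaneTree} (hT : T.IsCanonical) (hI : Invariant T) (hn : 2 ≤ T.size) :
    ∃ P : PlaneTree, (nextFree T.levels).val = P.levels ∧ P.IsCanonical ∧ P.IsPrimary ∧
      P.size = T.size ∧ P ≤ T ∧
      ∀ N : PlaneTree, N.IsCanonical → N.IsPrimary → N.size = T.size → N ≤ T → N ≤ P := by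
  cases T with
  | leaf => simp [size] at hn
  | graft A B =>
    have hA := A.size_pos
    have hB := B.size_pos
    have hsize : (graft A B).size = A.size + B.size := rfl
    by_cases hp : (graft A B).IsPrimary
    · refine ⟨graft A B, ?_, hT, hp, rfl, le_rfl, fun N _ _ _ h => h⟩
      simp only [nextFree, val_bind, val_split, (val_isPrimary A B).2 hp, if_true, val_op]
    have hroom : B.height < A.size := hI.resolve_left hp
    set T := graft A B with hTdef
    -- if the first subtree were a single vertex, the tree, a star, would be primary
    have hB2 : 2 ≤ B.size := by
      by_contra hlt
      have hh := B.height_lt_size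
      have hhA := A.height_lt_size
      apply hp
      by_cases hA0 : 0 < A.height
      · exact Or.inl (by omega)
      · refine Or.inr ⟨by omega, ?_⟩
        rcases Nat.lt_or_ge B.size A.size with h | h
        · exact Or.inl h
        · refine Or.inr ⟨by omega, (eq_of_lev (by omega) fun i hi => ?_).le⟩
          obtain rfl : i = 0 := by omega
          rfl
    have hp2 : 2 ≤ T.lev B.size := two_le_lev_graft A hB2 le_rfl
    obtain ⟨S, s1, s2, s3, s4, s5, s6, ⟨q, s7⟩, s8⟩ := successorAt_spec hT hp2
    have hsucc : T.lev (B.size + 1) ≤ 1 := lev_graft_size_succ_le A B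
    have hTh := height_graft hT
    have hSh : S.height ≤ B.height + 1 := by
      have := height_le_of_le s3 hT s6.le
      rw [hTh] at this
      exact this
    -- no primary tree lies between the successor at the end of the first subtree and the given tree
    have hmax : ∀ N : PlaneTree, N.IsCanonical → N.IsPrimary → N.size = T.size → N ≤ T → N ≤ S := by
      intro N hN hNp hNs hle
      have hne : N ≠ T := fun h => hp (h ▸ hNp)
      obtain ⟨j, j1, j2⟩ := exists_lev_of_lt (lt_of_le_of_ne hle hne)
      rcases Nat.lt_or_ge B.size j with hj | hj
      · -- the first subtree is kept, and the rest only gets smaller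
        exfalso
        cases N with
        | leaf => simp only [size] at hNs; omega
        | graft A' B' =>
          have hBB : B = B' := by
            refine first_eq (A := A) (A' := A') (fun i hi => (j1 i (by omega)).symm) ?_
            rcases Nat.lt_or_ge (B.size + 1) j with h | h
            · rw [j1 _ h]; exact hsucc
            · obtain rfl : j = B.size + 1 := by omega
              omega
          subst hBB
          have hAA : A' < A := by
            refine lt_of_lev (j := j - B.size) (fun i hi => ?_) ?_
            · rcases Nat.eq_zero_or_pos i with rfl | hi0
              · simp
              · have := j1 (B.size + i) (by omega)
                rwa [lev_graft_right _ _ hi0, hTdef, lev_graft_right _ _ hi0] at this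
            · have e1 := lev_graft_right A' B (i := j - B.size) (by omega)
              have e2 := lev_graft_right A B (i := j - B.size) (by omega)
              rw [show B.size + (j - B.size) = j by omega] at e1 e2
              rw [← e1, ← e2]
              exact j2
          have hhA := height_le_of_le hN.1 hT.1 hAA.le
          have hsA : A'.size = A.size := by
            have : A'.size + B.size = A.size + B.size := hNs
            omega
          apply hp
          rcases hNp with h1 | ⟨h1, h2⟩
          · exact Or.inl (by omega)
          · rcases hhA.lt_or_eq with h3 | h3
            · exact Or.inl (by omega)
            · refine Or.inr ⟨by omega, ?_⟩
              rcases h2 with h2 | ⟨h2, h4⟩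
              · exact Or.inl (by omega)
              · exact Or.inr ⟨by omega, h4.trans hAA.le⟩
      · exact s8 N hN hNs j hj j1 j2
    have hval : (nextFree T.levels).val = if 2 < T.lev B.size then
        S.levels.take (T.size - ((height (split S.levels).val.1).val + 1)) ++
          List.range' 1 ((height (split S.levels).val.1).val + 1) else S.levels := by
      have hnp : ¬ (isPrimary B.levels A.levels).val = true := fun h => hp ((val_isPrimary A B).1 h)
      simp only [nextFree, val_bind, hTdef, val_split, val_ite, hnp, val_op, val_rd,
        val_steps, decide_eq_true_eq, length_levels]
      rw [← hTdef, ← s1]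
      rfl
    by_cases ha : 2 < T.lev B.size
    · -- the first subtree of the successor takes everything, and a path is split off
      rw [if_pos ha] at hval
      have hS2 : ∀ i, 2 ≤ i → i < S.size → 2 ≤ S.lev i := by
        intro i h1 h2
        rcases Nat.lt_or_ge i B.size with h3 | h3
        · rw [s4 i h3]; exact two_le_lev_graft A h1 h3.le
        · have := s7.le i (by have := s7.q_lt; omega) (by omega)
          have := s7.parent
          omega
      cases S with
      | leaf => simp only [size] at s2; omega
      | graft A' B' =>
        rw [val_split] at hval
        simp only [val_height] at hval
        set S := graft A' B' with hSdef
        have hSh' : S.height = B'.height + 1 := height_graft s3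
        have hS1 : S.lev (B'.height + 1) = B'.height + 1 := lev_eq_self s3 hSh'.ge
        have hBs := B.height_lt_size
        -- what remains before the path contains a path from the root that is as long
        have hk : B'.height + 1 < T.size - (B'.height + 1) := by
          by_contra hlt
          have h1 : B.height = B'.height := by omega
          have h2 : B.size = B'.height + 1 := by omega
          have h3 : T.lev B.size ≤ T.height := T.lev_le_height _
          rw [hTh] at h3
          rw [h2] at s5 h3
          omega
        obtain ⟨M, m1, m2, m3, m4, m5, m6⟩ := exists_pathEnd (S := S) s3
          (k := T.size - (B'.height + 1)) (s := B'.height + 1) (h := B'.height)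
          (i₀ := B'.height + 1) (by omega) (by omega) hk (fun i h1 h2 => hS2 i h1 (by omega))
          (fun i hi => lev_eq_self s3 (by omega)) (by omega) hk (by omega) le_rfl hk
        have hMS : M < S := by
          refine lt_of_lev m4 ?_
          have h1 := m5 0 (by omega)
          have h2 := hS2 (T.size - (B'.height + 1)) (by omega) (by omega)
          rw [add_zero] at h1
          omega
        refine ⟨M, by rw [hval, m1], m2, ?_, by omega, (hMS.trans s6).le, ?_⟩
        · cases M with
          | leaf => trivial
          | graft A'' B'' =>
            have hB'' := B''.size_pos
            have hMh := height_le_of_le m2 s3 hMS.le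
            rw [height_graft m2, hSh'] at hMh
            have hBk : B''.size + 1 = T.size - (B'.height + 1) := by
              have h1 := lev_graft_size_succ_le A'' B''
              rcases lt_trichotomy (B''.size + 1) (T.size - (B'.height + 1)) with h | h | h
              · rw [m4 _ h] at h1
                have := hS2 (B''.size + 1) (by omega) (by omega)
                omega
              · exact h
              · have h2 := m5 0 (by omega)
                have := two_le_lev_graft A'' (B := B'') (i := T.size - (B'.height + 1)) (by omega)
                  (by omega)
                rw [add_zero] at h2
                omega
            -- the rest, which is the path, is higher than the shortened first subtree
            refine Or.inl ?_
            have h3 := m5 B'.height (by omega)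
            rw [← hBk, show B''.size + 1 + B'.height = B''.size + (B'.height + 1) by omega,
              lev_graft_right _ _ (by omega)] at h3
            have := A''.lev_le_height (B'.height + 1)
            omega
        · intro N hN hNp hNs hle
          exact m6 N hNp (by omega) (hmax N hN hNp hNs hle)
    · -- the first subtree loses its last leaf and is repeated
      rw [if_neg ha] at hval
      refine ⟨S, hval, s3, ?_, s2, s6.le, hmax⟩
      have hTp : T.lev B.size = 2 := by omega
      cases S with
      | leaf => trivial
      | graft A' B' =>
        set S := graft A' B' with hSdef
        have hB' := B'.size_pos
        have hq1 : q = 1 := by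
          have h1 := s7.parent
          have h2 := s7.q_lt
          rcases Nat.lt_or_ge q 2 with h3 | h3
          · rcases Nat.eq_zero_or_pos q with rfl | h4
            · rw [lev_zero] at h1; omega
            · omega
          · have : 2 ≤ T.lev q := two_le_lev_graft A h3 (by omega)
            omega
        subst hq1
        have hBs : B'.size + 1 = B.size := by
          have h1 : S.lev (B'.size + 1) ≤ 1 := lev_graft_size_succ_le A' B'
          rcases lt_trichotomy (B'.size + 1) B.size with h | h | h
          · rw [s4 _ h] at h1
            have : 2 ≤ T.lev (B'.size + 1) := two_le_lev_graft A (by omega) (by omega)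
            omega
          · exact h
          · have : 2 ≤ S.lev B.size := two_le_lev_graft A' (by omega) (by omega)
            omega
        -- the rest begins with a copy of the root and the first subtree, so it is higher
        refine Or.inl ?_
        have hSh' : S.height = B'.height + 1 := height_graft s3
        have hB's := B'.height_lt_size
        have h1 := s7.per (B'.size + (B'.height + 1)) (by omega) (by omega)
        rw [show B'.size + (B'.height + 1) - (B.size - 1) = B'.height + 1 by omega,
          lev_eq_self s3 hSh'.ge, hSdef, lev_graft_right _ _ (by omega)] at h1
        have := A'.lev_le_height (B'.height + 1)
        omega

lemma time_nextFree_le {T : PlaneTree} (hT : T.IsCanonical) (hn : 2 ≤ T.size) :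
    (nextFree T.levels).time ≤ 30 * T.size + 20 := by
  cases T with
  | leaf => simp [size] at hn
  | graft A B =>
    have hA := A.size_pos
    have hB := B.size_pos
    have hsize : (graft A B).size = A.size + B.size := rfl
    have t1 := time_split_le (graft A B).levels (by simpa using hn)
    have t2 := time_isPrimary_le B.levels A.levels
    have t3 := time_successorAt_le (graft A B).levels B.size
    simp only [length_levels] at t1 t2 t3
    simp only [nextFree, time_bind, val_split, time_ite, time_op, val_op, time_rd, val_rd,
      time_steps, time_height, length_levels]
    split_ifs with h1 h2
    · omega
    · have hp2 : 2 ≤ (graft A B).lev B.size := by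
        simp only [decide_eq_true_eq] at h2
        rw [lev]; omega
      obtain ⟨S, s1, s2, s3, -⟩ := successorAt_spec hT hp2
      rw [← s1]
      have t4 := time_split_le S.levels (by rw [length_levels]; omega)
      cases S with
      | leaf => simp only [size] at s2; omega
      | graft A' B' =>
        have hs : (graft A' B').size = A'.size + B'.size := rfl
        have := B'.height_lt_size
        rw [val_split]
        simp only [val_height, length_levels] at *
        omega
    · omega

/-- The successor of a primary sequence in the list of all canonical sequences. -/
lemma nextRooted_spec {P : PlaneTree} (hP : P.IsCanonical) (hp : P.IsPrimary) (hn : 2 ≤ P.size) :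
    ((nextRooted P.levels).val = none ∧ ∀ N : PlaneTree, N.size = P.size → ¬ N < P) ∨
    ∃ S : PlaneTree, (nextRooted P.levels).val = some S.levels ∧ S.IsCanonical ∧ Invariant S ∧
      S.size = P.size ∧ S < P ∧
      ∀ N : PlaneTree, N.IsCanonical → N.size = P.size → N < P → N ≤ S := by
  obtain ⟨h1, h2, h3⟩ := lastDeep_spec P.levels (P.size - 1)
  set r := (lastDeep P.levels (P.size - 1)).val with hr
  have hafter : ∀ i, r < i → i < P.size → P.lev i = 1 := fun i h4 h5 => h2 i h4 (by omega)
  have hfirst : ∀ N : PlaneTree, N.size = P.size → ∀ j, N.lev j < P.lev j → j ≤ r := by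
    intro N hN j hj
    by_contra hlt
    have hjn : j < P.size := by
      by_contra hle
      rw [lev_of_le (T := P) (by omega)] at hj
      omega
    have := lev_pos (T := N) (i := j) (by omega) (by omega)
    rw [hafter j (by omega) hjn] at hj
    omega
  by_cases hr0 : r = 0
  · left
    refine ⟨?_, fun N hN hlt => ?_⟩
    · simp only [nextRooted, val_bind, val_op, length_levels, ← hr, hr0, decide_true,
        if_true]
    · obtain ⟨j, j1, j2⟩ := exists_lev_of_lt hlt
      have := hfirst N hN j j2
      rw [hr0, Nat.le_zero] at this
      subst this
      simp at j2
  · right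
    have hr2 : 2 ≤ P.lev r := by
      have h4 := lev_pos (T := P) (i := r) (by omega) (by omega)
      have h5 : P.lev r ≠ 1 := h3.resolve_left hr0
      omega
    obtain ⟨S, s1, s2, s3, s4, s5, s6, -, s8⟩ := successorAt_spec hP hr2
    refine ⟨S, ?_, s3, ?_, s2, s6, fun N hN hNs hlt => ?_⟩
    · simp only [nextRooted, val_bind, val_op, length_levels, ← hr, decide_eq_true_eq, hr0,
        if_false, s1]
    · cases S with
      | leaf => trivial
      | graft A' B' =>
        cases P with
        | leaf => simp [size] at hn
        | graft A B =>
          have hA := A.size_pos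
          have hB := B.size_pos
          have hA' := A'.size_pos
          have hB' := B'.size_pos
          have e1 : (graft A B).size = A.size + B.size := rfl
          have e2 : (graft A' B').size = A'.size + B'.size := rfl
          have hBA : B.height ≤ A.height := by
            rcases hp with h | h
            · exact h.le
            · exact h.1.le
          refine Or.inr ?_
          rcases Nat.lt_or_ge B.size r with hBr | hBr
          · -- the first subtree is kept
            have h5 := lev_graft_size_succ_le A B
            have h6 : r ≠ B.size + 1 := fun h => by rw [h] at hr2; omega
            have hBB : B = B' := first_eq (A := A) (A' := A')
              (fun i hi => (s4 i (by omega)).symm) (by rw [s4 _ (by omega)]; exact h5)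
            subst hBB
            have := A.height_lt_size
            omega
          · -- the tree has height two at most, and the root gets another child
            have hA1 : A.height ≤ 1 := by
              by_contra hlt
              have h5 := lev_eq_self hP.1 (i := 2) (by omega)
              have h6 := lev_graft_right A B (i := 2) (by omega)
              have h7 := A.height_lt_size
              have := hafter (B.size + 2) (by omega) (by omega)
              omega
            have hh := height_le_of_le s3 hP s6.le
            rw [height_graft hP, height_graft s3] at hh
            have hr2' : (graft A B).lev r ≤ 2 := by
              have := (graft A B).lev_le_height r
              rw [height_graft hP] at this
              omega
            have : B'.size < r := by
              by_contra hlt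
              have hr1 : 2 ≤ r := by
                by_contra h
                have h8 := lev_one_le (graft A B)
                rw [show r = 1 by omega] at hr2
                omega
              have := two_le_lev_graft A' (B := B') hr1 (by omega)
              omega
            omega
    · obtain ⟨j, j1, j2⟩ := exists_lev_of_lt hlt
      exact s8 N hN hNs j (hfirst N hNs j j2) j1 j2

lemma time_nextRooted_le (L : List ℕ) : (nextRooted L).time ≤ 8 * L.length + 11 := by
  have h1 := time_lastDeep_le L (L.length - 1)
  have h2 := time_successorAt_le L (lastDeep L (L.length - 1)).val
  have h3 := (lastDeep_spec L (L.length - 1)).1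
  simp only [nextRooted, time_bind, time_op, val_op, time_ite]
  split_ifs <;> omega

end FreeTrees

/-! ### The list of the free trees -/

namespace PlaneTree

/-- The canonical primary trees with `n` vertices represent the free trees with `n` vertices. -/
def IsFree (n : ℕ) (T : PlaneTree) : Prop := T.IsCanonical ∧ T.IsPrimary ∧ T.size = n

/-- The usual correspondence of plane trees with binary trees. -/
def toBinaryTree : PlaneTree → BinaryTree Unit
  | leaf => .nil
  | graft A B => .node () A.toBinaryTree B.toBinaryTree

lemma numNodes_toBinaryTree (T : PlaneTree) : T.toBinaryTree.numNodes + 1 = T.size := by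
  induction T with
  | leaf => rfl
  | graft A B ihA ihB => simp only [toBinaryTree, BinaryTree.numNodes, size]; omega

lemma toBinaryTree_injective : Function.Injective toBinaryTree := by
  intro T
  induction T with
  | leaf => intro T' h; cases T' <;> simp_all [toBinaryTree]
  | graft A B ihA ihB =>
    intro T' h
    cases T' with
    | leaf => simp [toBinaryTree] at h
    | graft A' B' =>
      simp only [toBinaryTree, BinaryTree.node.injEq, true_and] at h
      rw [ihA h.1, ihB h.2]

lemma catalan_le_four_pow (n : ℕ) : catalan n ≤ 4 ^ n := by
  rw [catalan_eq_centralBinom_div]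
  refine (Nat.div_le_self _ _).trans ?_
  rw [Nat.centralBinom_eq_two_mul_choose]
  refine (Nat.choose_le_two_pow _ _).trans ?_
  rw [pow_mul]
  norm_num

lemma image_toBinaryTree_subset (k : ℕ) : toBinaryTree '' {T | T.size = k + 1} ⊆
    (BinaryTree.treesOfNumNodesEq k : Set (BinaryTree Unit)) := by
  rintro _ ⟨T, hT, rfl⟩
  have := T.numNodes_toBinaryTree
  rw [Finset.mem_coe, BinaryTree.mem_treesOfNumNodesEq]
  have hT : T.size = k + 1 := hT
  omega

lemma finite_setOf_size (n : ℕ) : {T : PlaneTree | T.size = n}.Finite := by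
  rcases n with _ | k
  · convert Set.finite_empty
    ext T
    have := T.size_pos
    simp; omega
  · exact Set.Finite.of_finite_image ((Finset.finite_toSet _).subset (image_toBinaryTree_subset k))
      toBinaryTree_injective.injOn

/-- There are at most `4 ^ k` plane trees with `k` edges. -/
lemma ncard_setOf_size_le (k : ℕ) : {T : PlaneTree | T.size = k + 1}.ncard ≤ 4 ^ k := by
  rw [← Set.ncard_image_of_injective _ toBinaryTree_injective]
  refine (Set.ncard_le_ncard (image_toBinaryTree_subset k) (Finset.finite_toSet _)).trans ?_
  rw [Set.ncard_coe_finset, BinaryTree.treesOfNumNodesEq_card_eq_catalan]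
  exact catalan_le_four_pow k

/-- The path with `k` edges, rooted at an end. -/
def path : ℕ → PlaneTree
  | 0 => leaf
  | k + 1 => graft leaf (path k)

lemma isCanonical_path (k : ℕ) : (path k).IsCanonical := by
  induction k with
  | zero => trivial
  | succ k ih => exact ⟨trivial, ih, trivial⟩

lemma size_path (k : ℕ) : (path k).size = k + 1 := by
  induction k with
  | zero => rfl
  | succ k ih => simp only [path, size, ih]; omega

lemma height_path (k : ℕ) : (path k).height = k := by
  induction k with
  | zero => rfl
  | succ k ih => simp [path, height, ih]

lemma tail_path (d k : ℕ) : tail d (path k) = List.range' (d + 1) k := by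
  induction k generalizing d with
  | zero => rfl
  | succ k ih => simp [path, tail, ih, List.range'_succ]

lemma levels_path (k : ℕ) : (path k).levels = List.range (k + 1) := by
  rw [levels, tail_path, List.range_eq_range', List.range'_succ]

lemma lev_path {k i : ℕ} (h : i ≤ k) : (path k).lev i = i := by
  rw [lev, levels_path, List.getD_eq_getElem _ _ (by simp; omega), List.getElem_range]

lemma lev_le_self (T : PlaneTree) (i : ℕ) : T.lev i ≤ i := by
  induction i with
  | zero => simp
  | succ i ih => have := T.lev_succ_le i; omega

lemma le_path (T : PlaneTree) {k : ℕ} (h : T.size = k + 1) : T ≤ path k := by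
  by_contra hlt
  obtain ⟨j, h1, h2⟩ := exists_lev_of_lt (not_le.1 hlt)
  have h3 := T.lev_le_self j
  rcases Nat.lt_or_ge k j with h4 | h4
  · rw [lev_of_le (T := T) (by omega)] at h2
    omega
  · rw [lev_path h4] at h2
    omega

/-- The path rooted at a centre is the first free tree: it is the largest primary tree below the path
rooted at an end, which is the largest tree. -/
lemma exists_start {K : ℕ} (hK : 1 ≤ K) : ∃ M : PlaneTree,
    M.levels = List.range ((K + 1) / 2 + 1) ++ List.range' 1 ((K + 2) / 2 - 1) ∧
    M.IsFree (K + 1) ∧ ∀ N : PlaneTree, N.IsFree (K + 1) → N ≤ M := by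
  have hS : (path K).size = K + 1 := size_path K
  have hex := exists_pathEnd (S := path K) (isCanonical_path K) (k := (K + 1) / 2 + 1)
    (s := (K + 2) / 2 - 1) (h := (K + 1) / 2 - 1) (i₀ := (K + 1) / 2) (by omega) (by omega)
    (by omega) (fun i h1 h2 => by rw [lev_path (by omega)]; exact h1)
    (fun i hi => lev_path (by omega)) (by omega) (by omega) (by rw [lev_path (by omega)]; omega)
    (by omega) (by omega)
  obtain ⟨M, m1, m2, m3, m4, m5, m6⟩ := hex
  have htake : (path K).levels.take ((K + 1) / 2 + 1) = List.range ((K + 1) / 2 + 1) := by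
    rw [levels_path, List.take_range, min_eq_left (by omega)]
  rw [htake] at m1
  refine ⟨M, m1, ⟨m2, ?_, by omega⟩, fun N hN => m6 N hN.2.1 (by rw [hN.2.2, hS])
    (le_path N hN.2.2)⟩
  have hM : M = graft (path ((K + 2) / 2 - 1)) (path ((K + 1) / 2 - 1)) := by
    apply levels_injective
    rw [m1, levels_graft, levels_path, tail_path]
    rw [show (K + 1) / 2 - 1 + 1 = (K + 1) / 2 by omega, List.range_succ_eq_map]
    simp
  rw [hM, IsPrimary, height_path, height_path, size_path, size_path]
  rcases Nat.even_or_odd' K with ⟨m, rfl | rfl⟩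
  · left; omega
  · right
    rw [show (2 * m + 1 + 2) / 2 - 1 = m by omega, show (2 * m + 1 + 1) / 2 - 1 = m by omega]
    exact ⟨rfl, Or.inr ⟨rfl, le_rfl⟩⟩

/-- The isomorphism classes of trees correspond to the canonical primary plane trees. -/
lemma exists_unlabeledTree_equiv (K : ℕ) :
    ∃ e : TreeStat.UnlabeledTree K ≃ {T : PlaneTree // T.IsFree (K + 1)},
      ∀ τ, Nonempty ((e τ).1.graph ≃g τ.graph) := by
  have h1 : ∀ τ : TreeStat.UnlabeledTree K, ∃ T : {T : PlaneTree // T.IsFree (K + 1)},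
      Nonempty (T.1.graph ≃g τ.graph) := by
    intro τ
    obtain ⟨T₀, ⟨φ⟩⟩ := exists_iso_graph τ.out.2
    obtain ⟨T, h1, h2, ⟨ψ⟩⟩ := exists_isPrimary T₀
    refine ⟨⟨T, h1, h2, ?_⟩, ⟨ψ.trans φ⟩⟩
    rw [← card_vert, Fintype.card_congr (ψ.trans φ).toEquiv, Fintype.card_fin]
  choose f hf using h1
  refine ⟨Equiv.ofBijective f ⟨fun τ τ' h => ?_, fun T => ?_⟩, hf⟩
  · obtain ⟨φ⟩ := hf τ
    obtain ⟨φ'⟩ := hf τ'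
    rw [← h] at φ'
    rw [← Quotient.out_eq τ, ← Quotient.out_eq τ']
    exact Quotient.sound ⟨φ.symm.trans φ'⟩
  · have hc : Fintype.card T.1.Vert = Fintype.card (Fin (K + 1)) := by
      rw [card_vert, T.2.2.2, Fintype.card_fin]
    let e := Fintype.equivOfCardEq hc
    let G : SimpleGraph (Fin (K + 1)) := T.1.graph.map e.toEmbedding
    let iso : T.1.graph ≃g G := SimpleGraph.Iso.map e T.1.graph
    have hG : G.IsTree := iso.isTree_iff.1 T.1.isTree_graph
    refine ⟨Quotient.mk _ ⟨G, hG⟩, ?_⟩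
    obtain ⟨φ⟩ := hf (Quotient.mk _ ⟨G, hG⟩)
    have hout : Nonempty ((Quotient.mk (TreeStat.treeSetoid K) ⟨G, hG⟩).out.1 ≃g G) :=
      Quotient.mk_out (s := TreeStat.treeSetoid K) ⟨G, hG⟩
    obtain ⟨ψ⟩ := hout
    apply Subtype.ext
    exact eq_of_isPrimary (f _).2.1 T.2.1 (f _).2.2.1 T.2.2.1 ((φ.trans ψ).trans iso.symm)

end PlaneTree

namespace FreeTrees

open Timed PlaneTree

/-- From a sequence with the invariant the generation lists the free trees that are not larger, if
the bound for the number of rounds is not smaller than their number. -/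
lemma generate_spec (f : ℕ) {n : ℕ} (hn : 2 ≤ n) {T : PlaneTree} (hT : T.IsCanonical)
    (hI : Invariant T) (hs : T.size = n) (hf : {N : PlaneTree | N.IsFree n ∧ N ≤ T}.ncard ≤ f) :
    ∃ l : List PlaneTree, (generate f T.levels).val = l.map levels ∧ l.Nodup ∧
      (∀ N, N ∈ l ↔ N.IsFree n ∧ N ≤ T) ∧
      (generate f T.levels).time ≤ l.length * (38 * n + 33) + 1 := by
  have hfin : ∀ T : PlaneTree, {N : PlaneTree | N.IsFree n ∧ N ≤ T}.Finite := fun T =>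
    (finite_setOf_size n).subset fun N hN => hN.1.2.2
  induction f generalizing T with
  | zero =>
    obtain ⟨P, -, p2, p3, p4, p5, -⟩ := nextFree_spec hT hI (by omega)
    have hempty := (Set.ncard_eq_zero (hfin T)).1 (Nat.le_zero.1 hf)
    have hmem : P ∈ {N : PlaneTree | N.IsFree n ∧ N ≤ T} := ⟨⟨p2, p3, p4.trans hs⟩, p5⟩
    rw [hempty] at hmem
    exact absurd hmem (Set.notMem_empty _)
  | succ f ih =>
    obtain ⟨P, p1, p2, p3, p4, p5, p6⟩ := nextFree_spec hT hI (by omega)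
    have t1 := time_nextFree_le hT (by omega)
    have t2 := time_nextRooted_le P.levels
    rw [length_levels] at t2
    have hiff : ∀ N : PlaneTree, N.IsFree n → (N ≤ T ↔ N = P ∨ N < P) := by
      intro N hN
      rw [← le_iff_eq_or_lt]
      exact ⟨fun h => p6 N hN.1 hN.2.1 (hN.2.2.trans hs.symm) h, fun h => h.trans p5⟩
    have hP : P.IsFree n := ⟨p2, p3, p4.trans hs⟩
    rcases nextRooted_spec p2 p3 (by omega) with ⟨h1, h2⟩ | ⟨S, s1, s2, s3, s4, s5, s6⟩
    · refine ⟨[P], ?_, by simp, fun N => ?_, ?_⟩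
      · simp only [generate, val_bind, p1, h1, val_op, List.map_cons, List.map_nil]
      · rw [List.mem_singleton]
        constructor
        · rintro rfl
          exact ⟨hP, p5⟩
        · rintro ⟨h3, h4⟩
          exact ((hiff N h3).1 h4).resolve_right (h2 N (h3.2.2.trans hP.2.2.symm))
      · simp only [generate, time_bind, p1, h1, time_op, List.length_singleton]
        omega
    · have hS : ∀ N : PlaneTree, N.IsFree n → (N ≤ S ↔ N < P) := fun N hN =>
        ⟨fun h => h.trans_lt s5, fun h => s6 N hN.1 (hN.2.2.trans hP.2.2.symm) h⟩
      have hcard : {N : PlaneTree | N.IsFree n ∧ N ≤ S}.ncard ≤ f := by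
        have hlt : {N : PlaneTree | N.IsFree n ∧ N ≤ S} ⊂ {N : PlaneTree | N.IsFree n ∧ N ≤ T} := by
          refine ⟨fun N hN => ⟨hN.1, (hN.2.trans s5.le).trans p5⟩, fun h => ?_⟩
          exact absurd ((h ⟨hP, p5⟩).2) (not_le.2 s5)
        have := Set.ncard_lt_ncard hlt (hfin T)
        omega
      obtain ⟨l, l1, l2, l3, l4⟩ := ih s2 s3 (s4.trans hP.2.2) hcard
      refine ⟨P :: l, ?_, List.nodup_cons.2 ⟨fun h => ?_, l2⟩, fun N => ?_, ?_⟩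
      · simp only [generate, val_bind, p1, s1, val_op, List.map_cons, l1]
      · exact absurd ((l3 P).1 h).2 (not_le.2 s5)
      · rw [List.mem_cons, l3]
        constructor
        · rintro (rfl | ⟨h3, h4⟩)
          · exact ⟨hP, p5⟩
          · exact ⟨h3, (h4.trans s5.le).trans p5⟩
        · rintro ⟨h3, h4⟩
          rcases (hiff N h3).1 h4 with h5 | h5
          · exact Or.inl h5
          · exact Or.inr ⟨h3, (hS N h3).2 h5⟩
      · simp only [generate, time_bind, p1, s1, time_op, List.length_cons]
        rw [Nat.add_mul]
        omega

/-- The generation lists every free tree once. -/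
theorem freeTrees_spec {K : ℕ} (hK : 1 ≤ K) : ∃ l : List PlaneTree,
    (freeTrees K).val = l.map levels ∧ l.Nodup ∧ (∀ N, N ∈ l ↔ N.IsFree (K + 1)) ∧
      (freeTrees K).time ≤ l.length * (38 * K + 71) + K + 2 := by
  obtain ⟨M, m1, m2, m3⟩ := exists_start hK
  have hcard : {N : PlaneTree | N.IsFree (K + 1) ∧ N ≤ M}.ncard ≤ 4 ^ K :=
    (Set.ncard_le_ncard (fun N hN => hN.1.2.2) (finite_setOf_size (K + 1))).trans
      (ncard_setOf_size_le K)
  have hI : Invariant M := by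
    cases M with
    | leaf => trivial
    | graft A B => exact Or.inl m2.2.1
  obtain ⟨l, l1, l2, l3, l4⟩ := generate_spec (4 ^ K) (by omega) m2.1 hI m2.2.2 hcard
  refine ⟨l, ?_, l2, fun N => (l3 N).trans ⟨fun h => h.1, fun h => ⟨h, m3 N h⟩⟩, ?_⟩
  · simp only [freeTrees, val_bind, val_steps, ← m1, l1]
  · simp only [freeTrees, time_bind, time_steps, val_steps, ← m1]
    have : l.length * (38 * (K + 1) + 33) = l.length * (38 * K + 71) := by ring
    omega

end FreeTrees

/-! ### The number of automorphisms -/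

lemma List.getD_append_add {α : Type*} (l l' : List α) (i : ℕ) (a : α) :
    (l ++ l').getD (l.length + i) a = l'.getD i a := by
  rw [List.getD_append_right _ _ _ _ (by omega), Nat.add_sub_cancel_left]

lemma List.eq_append_drop_of_getD {l Z : List ℕ} (hl : ∀ x ∈ l, x ≠ 0)
    (h : ∀ i < l.length, l.getD i 0 = Z.getD i 0) : Z = l ++ Z.drop l.length := by
  induction l generalizing Z with
  | nil => simp
  | cons a l ih =>
    cases Z with
    | nil => exact absurd (h 0 (by simp)) (by simpa using hl a (by simp))
    | cons b Z =>
      have h0 := h 0 (by simp)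
      simp only [List.getD_cons_zero] at h0
      rw [List.length_cons, List.drop_succ_cons, List.cons_append, h0,
        ← ih (fun x hx => hl x (by simp [hx])) fun i hi => by simpa using h (i + 1) (by simpa using hi)]

lemma List.head?_drop_le {Z : List ℕ} {k b : ℕ} (h : Z.getD k 0 ≤ b) :
    ∀ x ∈ (Z.drop k).head?, x ≤ b := by
  intro x hx
  rw [List.head?_drop] at hx
  rwa [List.getD_eq_getElem?_getD, Option.mem_def.1 hx] at h

namespace FreeTrees

open Timed PlaneTree

lemma findAtMost_spec (L : List ℕ) (l s : ℕ) : (findAtMost L l s).val ≤ s ∧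
    (∀ i, (findAtMost L l s).val < i → i ≤ s → l < L.getD i 0) ∧
    ((findAtMost L l s).val = 0 ∨ L.getD (findAtMost L l s).val 0 ≤ l) := by
  induction s with
  | zero => exact ⟨le_rfl, fun i h1 h2 => by simp [findAtMost] at h1; omega, Or.inl rfl⟩
  | succ s ih =>
    simp only [findAtMost, val_bind, val_rd, val_op, val_ite, decide_eq_true_eq]
    split_ifs with h
    · exact ⟨le_rfl, fun i h1 h2 => by omega, Or.inr h⟩
    · refine ⟨ih.1.trans (by omega), fun i h1 h2 => ?_, ih.2.2⟩
      rcases h2.lt_or_eq with h3 | h3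
      · exact ih.2.1 i h1 (by omega)
      · rw [h3]; omega

lemma time_findAtMost_le (L : List ℕ) (l s : ℕ) : (findAtMost L l s).time ≤ 2 * s + 1 := by
  induction s with
  | zero => simp [findAtMost]
  | succ s ih =>
    simp only [findAtMost, time_bind, time_rd, val_rd, time_op, val_op, time_ite]
    split_ifs <;> omega

lemma sameEntries_spec (L : List ℕ) (u v l k j : ℕ) : (sameEntries L u v l k j).val = true ↔
    (∀ i < k, L.getD (u + (j + i)) 0 = L.getD (v + (j + i)) 0) ∧ L.getD (v + (j + k)) 0 ≤ l := by
  induction k generalizing j with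
  | zero => simp [sameEntries]
  | succ k ih =>
    simp only [sameEntries, val_bind, val_rd, val_op, val_ite, decide_eq_true_eq]
    split_ifs with h
    · rw [ih]
      constructor
      · rintro ⟨h1, h2⟩
        refine ⟨fun i hi => ?_, by rwa [show j + (k + 1) = j + 1 + k by omega]⟩
        rcases Nat.eq_zero_or_pos i with rfl | h0
        · exact h
        · have := h1 (i - 1) (by omega)
          rwa [show j + 1 + (i - 1) = j + i by omega] at this
      · rintro ⟨h1, h2⟩
        refine ⟨fun i hi => ?_, by rwa [show j + 1 + k = j + (k + 1) by omega]⟩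
        rw [show j + 1 + i = j + (i + 1) by omega]
        exact h1 _ (by omega)
    · simp only [false_iff, not_and]
      exact fun h1 => absurd (h1 0 (by omega)) h

lemma time_sameEntries_le (L : List ℕ) (u v l k j : ℕ) :
    (sameEntries L u v l k j).time ≤ 6 * k + 3 := by
  induction k generalizing j with
  | zero => simp [sameEntries]
  | succ k ih =>
    have := ih (j + 1)
    simp only [sameEntries, time_bind, time_rd, val_rd, time_op, val_op, time_ite]
    split_ifs <;> omega

/-- What the loop knows about the entries `pre` before the next child, of depth `d + 1`, of a
vertex: either they end with that vertex, or they end with the subtree `X` of the preceding child,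
whose number is `m`. -/
def Preceded (d : ℕ) (pre ms : List ℕ) : Option (PlaneTree × ℕ) → Prop
  | none => ∃ pre', pre = pre' ++ [d]
  | some (X, m) => ∃ pre', pre = pre' ++ (d + 1) :: tail (d + 1) X ∧ ms.getD pre'.length 0 = m

/-- The number of a child with subtree `B` from the subtree and the number of the child before. -/
noncomputable def nextNumber (B : PlaneTree) : Option (PlaneTree × ℕ) → ℕ
  | none => 1
  | some (X, m) => if X = B then m + 1 else 1

lemma siblingProd_graft (o : Option (PlaneTree × ℕ)) (A B : PlaneTree) :
    siblingProd o (graft A B) =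
      nextNumber B o * siblingProd none B * siblingProd (some (B, nextNumber B o)) A := by
  rcases o with _ | ⟨X, m⟩
  · simp [siblingProd, nextNumber]
  · simp only [siblingProd, nextNumber]
    split_ifs <;> simp

/-- The loop gives a child of depth `d + 1` the number determined by the sibling before, which is the
last earlier vertex of depth at most `d + 1`, unless that is the parent. -/
lemma val_siblingNumber {d : ℕ} {pre ms rest : List ℕ} {o : Option (PlaneTree × ℕ)}
    {B : PlaneTree} (hrest : ∀ x ∈ rest.head?, x ≤ d + 1) (ho : Preceded d pre ms o) :
    (siblingNumber (pre ++ ((d + 1) :: tail (d + 1) B ++ rest)) ms pre.length).val =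
      nextNumber B o := by
  set Z := (d + 1) :: tail (d + 1) B ++ rest with hZ
  have hv : (pre ++ Z).getD pre.length 0 = d + 1 := by
    simp [hZ]
  obtain ⟨h1, h2, h3⟩ := findAtMost_spec (pre ++ Z) (d + 1) (pre.length - 1)
  set u := (findAtMost (pre ++ Z) (d + 1) (pre.length - 1)).val with hu
  simp only [siblingNumber, val_bind, val_rd, val_op, val_ite, decide_eq_true_eq, hv, ← hu]
  rcases o with _ | ⟨X, m⟩
  · obtain ⟨pre', rfl⟩ := ho
    have hpl : (pre' ++ [d] ++ Z).getD pre'.length 0 = d := by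
      have := List.getD_append_add pre' ([d] ++ Z) 0 0
      rw [List.append_assoc]
      simp
    simp only [List.length_append, List.length_singleton, Nat.add_sub_cancel] at h1 h2 hu
    have hue : u = pre'.length := by
      by_contra hne
      have := h2 pre'.length (by omega) le_rfl
      omega
    rw [hue, hpl, if_neg (by omega), nextNumber]
  · obtain ⟨pre', rfl, hm⟩ := ho
    have hget : ∀ i, (pre' ++ (d + 1) :: tail (d + 1) X ++ Z).getD (pre'.length + i) 0 =
        ((d + 1) :: tail (d + 1) X ++ Z).getD i 0 := fun i => by
      rw [List.append_assoc, List.getD_append_add]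
    have hlen := length_tail (d + 1) X
    simp only [List.length_append, List.length_cons] at h1 h2 hu
    have hue : u = pre'.length := by
      rcases lt_trichotomy u pre'.length with h | h | h
      · have := h2 pre'.length h (by omega)
        have h4 := hget 0
        rw [add_zero] at h4
        rw [h4] at this
        simp at this
      · exact h
      · exfalso
        have h4 := h3.resolve_left (by omega)
        have h5 := hget (u - pre'.length)
        rw [show pre'.length + (u - pre'.length) = u by omega] at h5
        rw [h5, List.getD_append _ _ _ _ (by simp; omega),
          show u - pre'.length = u - pre'.length - 1 + 1 by omega, List.getD_cons_succ,
          List.getD_eq_getElem _ _ (by omega)] at h4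
        have := lt_of_mem_tail (List.getElem_mem (l := tail (d + 1) X)
          (n := u - pre'.length - 1) (by omega))
        omega
    have hl' : (pre' ++ (d + 1) :: tail (d + 1) X ++ Z).getD pre'.length 0 = d + 1 := by
      simp
    rw [hue, hl', if_pos rfl, nextNumber, hm]
    have hiff : (sameEntries (pre' ++ (d + 1) :: tail (d + 1) X ++ Z) pre'.length
        (pre' ++ (d + 1) :: tail (d + 1) X).length (d + 1)
        ((pre' ++ (d + 1) :: tail (d + 1) X).length - pre'.length) 0).val = true ↔ X = B := by
      have hk : (pre' ++ (d + 1) :: tail (d + 1) X).length - pre'.length =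
          ((d + 1) :: tail (d + 1) X).length := by simp
      rw [sameEntries_spec, hk]
      simp only [zero_add, List.getD_append_add, hget]
      constructor
      · -- agreement on the length of `X`, followed by an end, gives equality by unique parsing
        rintro ⟨h4, h5⟩
        have h6 := List.eq_append_drop_of_getD (l := (d + 1) :: tail (d + 1) X) (Z := Z)
          (by
            intro x hx
            rcases List.mem_cons.1 hx with rfl | hx
            · omega
            · have := lt_of_mem_tail hx; omega)
          (fun i hi => by rw [← h4 i hi, List.getD_append _ _ _ _ hi])
        rw [hZ, List.cons_append, List.cons_append, List.cons.injEq] at h6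
        exact (tail_append_inj hrest (List.head?_drop_le h5) h6.2).1.symm
      · rintro rfl
        refine ⟨fun i hi => ?_, ?_⟩
        · rw [hZ, List.getD_append _ _ _ _ hi, List.getD_append _ _ _ _ hi]
        · have := List.getD_append_add ((d + 1) :: tail (d + 1) X) rest 0 0
          rw [add_zero] at this
          rw [hZ, this]
          cases rest with
          | nil => simp
          | cons x rest => simpa using hrest x (by simp)
    by_cases hX : X = B
    · rw [if_pos (hiff.2 hX), if_pos hX]
    · rw [if_neg (fun h => hX (hiff.1 h)), if_neg hX]

lemma time_siblingNumber_le (L ms : List ℕ) (v : ℕ) :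
    (siblingNumber L ms v).time ≤ 8 * v + 13 := by
  have h1 := time_findAtMost_le L (L.getD v 0) (v - 1)
  have h2 := time_sameEntries_le L (findAtMost L (L.getD v 0) (v - 1)).val v (L.getD v 0)
    (v - (findAtMost L (L.getD v 0) (v - 1)).val) 0
  simp only [siblingNumber, time_bind, time_rd, val_rd, time_op, val_op, time_ite]
  split_ifs <;> omega

lemma head?_tail_append_le {d : ℕ} {A : PlaneTree} {post : List ℕ}
    (h : ∀ x ∈ post.head?, x ≤ d) : ∀ x ∈ (tail d A ++ post).head?, x ≤ d + 1 := by
  cases A with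
  | leaf => exact fun x hx => (h x hx).trans (by omega)
  | graft A B => intro x hx; simp [tail] at hx; omega

/-- The loop over the vertices below the root of a subtree `T` appends their numbers and multiplies
the product by them, whatever comes before and after. -/
lemma siblingProduct_spec (T : PlaneTree) : ∀ (d k prod : ℕ) (pre post ms : List ℕ)
    (o : Option (PlaneTree × ℕ)), pre.length = ms.length → (∀ x ∈ post.head?, x ≤ d) →
    Preceded d pre ms o → ∃ ms', ms'.length = (tail d T).length ∧
      (siblingProduct (pre ++ (tail d T ++ post)) ((tail d T).length + k) pre.length ms prod).val =
        (siblingProduct (pre ++ (tail d T ++ post)) k (pre ++ tail d T).length (ms ++ ms')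
          (prod * siblingProd o T)).val := by
  induction T with
  | leaf =>
    intro d k prod pre post ms o _ _ _
    refine ⟨[], rfl, ?_⟩
    have h1 : siblingProd o leaf = 1 := by rcases o with _ | ⟨x, m⟩ <;> simp [siblingProd]
    simp [tail, h1]
  | graft A B ihA ihB =>
    intro d k prod pre post ms o hlen hpost ho
    have hA := head?_tail_append_le (A := A) hpost
    have hnum := val_siblingNumber (B := B) (rest := tail d A ++ post) hA ho
    set m := nextNumber B o with hm
    have e1 : pre ++ (tail d (graft A B) ++ post) =
        pre ++ ((d + 1) :: tail (d + 1) B ++ (tail d A ++ post)) := by simp [tail]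
    have e2 : pre ++ (tail d (graft A B) ++ post) =
        (pre ++ [d + 1]) ++ (tail (d + 1) B ++ (tail d A ++ post)) := by simp [tail]
    have e3 : pre ++ (tail d (graft A B) ++ post) =
        (pre ++ [d + 1] ++ tail (d + 1) B) ++ (tail d A ++ post) := by simp [tail]
    obtain ⟨ms₁, l₁, h₁⟩ := ihB (d + 1) ((tail d A).length + k) (prod * m) (pre ++ [d + 1])
      (tail d A ++ post) (ms ++ [m]) none (by simp [hlen]) hA ⟨pre, rfl⟩
    obtain ⟨ms₂, l₂, h₂⟩ := ihA d k (prod * m * siblingProd none B)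
      (pre ++ [d + 1] ++ tail (d + 1) B) post (ms ++ [m] ++ ms₁) (some (B, m))
      (by simp [hlen, l₁]) hpost ⟨pre, by simp, by
        have := List.getD_append_add ms ([m] ++ ms₁) 0 0
        rw [← hlen] at this
        simpa using this⟩
    refine ⟨[m] ++ ms₁ ++ ms₂, by simp [tail, l₁, l₂], ?_⟩
    have hk : (tail d (graft A B)).length + k =
        (tail (d + 1) B).length + ((tail d A).length + k) + 1 := by
      simp [tail]; omega
    rw [hk, siblingProduct]
    simp only [val_bind, val_op]
    rw [e1, hnum, ← e1, e2]
    rw [List.length_append, List.length_singleton] at h₁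
    rw [h₁, ← e2, e3, h₂, siblingProd_graft, ← hm]
    simp only [tail, List.length_append, List.length_cons, List.append_assoc, mul_assoc,
      List.cons_append, List.nil_append]

lemma time_siblingProduct_le (L : List ℕ) (k v : ℕ) (ms : List ℕ) (prod : ℕ) :
    (siblingProduct L k v ms prod).time ≤ k * (8 * (v + k) + 16) + 1 := by
  induction k generalizing v ms prod with
  | zero => simp [siblingProduct]
  | succ k ih =>
    have h1 := time_siblingNumber_le L ms v
    have h2 := ih (v + 1) (ms ++ [(siblingNumber L ms v).val]) (prod * (siblingNumber L ms v).val)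
    have h3 : (k + 1) * (8 * (v + (k + 1)) + 16) + 1 =
        k * (8 * (v + 1 + k) + 16) + 1 + (8 * (v + (k + 1)) + 16) := by ring
    simp only [siblingProduct, time_bind, time_op, val_op]
    omega

/-- The number of automorphisms is computed correctly. -/
theorem val_autCount {T : PlaneTree} (hT : T.IsCanonical) (hp : T.IsPrimary) (hn : 2 ≤ T.size) :
    (autCount T.levels).val = TreeStat.aut T.graph := by
  cases T with
  | leaf => simp [size] at hn
  | graft A B =>
    rw [TreeStat.aut, card_aut hT hp, ← siblingProd_eq_isoCount hT]
    have hprod : (siblingProduct (graft A B).levels ((graft A B).size - 1) 1 [1] 1).val =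
        siblingProd none (graft A B) := by
      obtain ⟨ms', -, h⟩ := siblingProduct_spec (graft A B) 0 0 1 [0] [] [1] none rfl (by simp)
        ⟨[], rfl⟩
      have hl := length_tail 0 (graft A B)
      rw [show (tail 0 (graft A B)).length + 0 = (graft A B).size - 1 by omega] at h
      simp only [List.append_nil, List.length_singleton] at h
      refine Eq.trans h ?_
      simp [siblingProduct]
    simp only [autCount, val_bind, val_op, length_levels, val_split, val_lexGreater, val_ite,
      hprod, Bool.or_eq_true, decide_eq_true_eq, ← lt_iff_levels]
    by_cases h : A = B
    · subst h; simp [mul_comm]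
    · rw [if_pos (lt_or_gt_of_ne h), if_neg h, mul_one]

lemma time_autCount_le {T : PlaneTree} (hn : 2 ≤ T.size) :
    (autCount T.levels).time ≤ 8 * T.size ^ 2 + 30 * T.size := by
  cases T with
  | leaf => simp [size] at hn
  | graft A B =>
    have h1 := time_siblingProduct_le (graft A B).levels ((graft A B).size - 1) 1 [1] 1
    have h2 := time_split_le (graft A B).levels (by simpa using hn)
    have h3 := time_lexGreater_le B.levels A.levels
    have h4 := time_lexGreater_le A.levels B.levels
    have hs : (graft A B).size = A.size + B.size := rfl
    simp only [length_levels] at h1 h2 h3 h4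
    have h5 : ((graft A B).size - 1) * (8 * (1 + ((graft A B).size - 1)) + 16) + 1 + 8 ≤
        8 * (graft A B).size ^ 2 + 16 * (graft A B).size := by
      obtain ⟨k, hk⟩ := Nat.exists_eq_add_of_le hn
      rw [hk, show 2 + k - 1 = k + 1 by omega]
      ring_nf
      omega
    simp only [autCount, time_bind, time_op, val_op, length_levels, val_split, time_ite]
    split_ifs <;> omega

end FreeTrees

/-! ### Sums over colourful maps -/

namespace PlaneTree

section Weight

variable {R V C : Type} [DecidableEq C]

/-- The product of the entries of `M` at the images of the edges, taken from parent to child. -/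
def weight [Field R] (M : V → V → R) : (T : PlaneTree) → (Vert T → V) → R
  | leaf, _ => 1
  | graft A B, φ => weight M A (fun u => φ (.inl u)) * weight M B (fun u => φ (.inr u)) *
      M (φ (.inl A.root)) (φ (.inr B.root))

/-- The map `φ` sends the root to `x` and the vertices to vertices of distinct colours, where `S` is
the set of these colours. -/
def IsColorful (μ : V → C) (T : PlaneTree) (φ : Vert T → V) (x : V) (S : Finset C) : Prop :=
  φ T.root = x ∧ Function.Injective (μ ∘ φ) ∧ Finset.univ.image (μ ∘ φ) = S

lemma isColorful_graft_iff {μ : V → C} {A B : PlaneTree} {φ : Vert A → V} {ψ : Vert B → V}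
    {x y : V} {S P : Finset C} :
    (P ⊆ S ∧ IsColorful μ A φ x P ∧ IsColorful μ B ψ y (S \ P)) ↔
      IsColorful μ (graft A B) (Sum.elim φ ψ) x S ∧ y = ψ B.root ∧
        P = Finset.univ.image (μ ∘ φ) := by
  have hroot : (Sum.elim φ ψ : Vert (graft A B) → V) (graft A B).root = φ A.root := rfl
  have himg : (Finset.univ : Finset (Vert (graft A B))).image
      (μ ∘ (Sum.elim φ ψ : Vert (graft A B) → V)) =
      Finset.univ.image (μ ∘ φ) ∪ Finset.univ.image (μ ∘ ψ) := by
    ext c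
    simp only [Finset.mem_image, Finset.mem_univ, true_and, Finset.mem_union, Function.comp]
    constructor
    · rintro ⟨u | u, h⟩
      · exact Or.inl ⟨u, h⟩
      · exact Or.inr ⟨u, h⟩
    · rintro (⟨u, h⟩ | ⟨u, h⟩)
      · exact ⟨.inl u, h⟩
      · exact ⟨.inr u, h⟩
  have hinj : Function.Injective (μ ∘ (Sum.elim φ ψ : Vert (graft A B) → V)) ↔
      Function.Injective (μ ∘ φ) ∧ Function.Injective (μ ∘ ψ) ∧
        Disjoint (Finset.univ.image (μ ∘ φ)) (Finset.univ.image (μ ∘ ψ)) := by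
    have : μ ∘ (Sum.elim φ ψ : Vert (graft A B) → V) = Sum.elim (μ ∘ φ) (μ ∘ ψ) := by
      funext u; rcases u with u | u <;> rfl
    rw [this, Sum.elim_injective, Finset.disjoint_left]
    refine and_congr Iff.rfl (and_congr Iff.rfl ?_)
    simp only [Finset.mem_image, Finset.mem_univ, true_and, not_exists]
    constructor
    · rintro h c ⟨u, rfl⟩ v hv
      exact h u v hv.symm
    · exact fun h u v huv => h ⟨u, rfl⟩ v huv.symm
  simp only [IsColorful, hroot, himg, hinj]
  constructor
  · rintro ⟨h1, ⟨h2, h3, rfl⟩, h4, h5, h6⟩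
    rw [h6]
    exact ⟨⟨h2, ⟨h3, h5, Finset.disjoint_sdiff⟩, Finset.union_sdiff_of_subset h1⟩, h4.symm, rfl⟩
  · rintro ⟨⟨h1, ⟨h2, h3, h4⟩, rfl⟩, rfl, rfl⟩
    refine ⟨Finset.subset_union_left, ⟨h1, h2, rfl⟩, rfl, h3, ?_⟩
    rw [Finset.union_sdiff_left, Finset.sdiff_eq_self_of_disjoint h4.symm]

variable [Field R]

/-- The recursion of colour coding: the tree is cut at the edge from the root `x` to its first child
`y`, and the colours `S` are distributed to the two parts. -/
def treeSum [Fintype V] (M : V → V → R) (μ : V → C) : PlaneTree → V → Finset C → R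
  | leaf, x, S => if {μ x} = S then 1 else 0
  | graft A B, x, S =>
    ∑ y, ∑ P ∈ S.powerset, treeSum M μ A x P * treeSum M μ B y (S \ P) * M x y

lemma sum_vert_leaf [Fintype V] {_ : Fintype (Vert leaf → V)} (F : (Vert leaf → V) → R) :
    ∑ φ, F φ = ∑ y, F fun _ => y := by
  let e : V ≃ (Vert leaf → V) := (Equiv.funUnique Unit V).symm
  exact (Fintype.sum_equiv e (fun y => F fun _ => y) F fun _ => rfl).symm

lemma sum_vert_graft {A B : PlaneTree} {_ : Fintype (Vert A → V)} {_ : Fintype (Vert B → V)}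
    {_ : Fintype (Vert (graft A B) → V)} (F : (Vert (graft A B) → V) → R) :
    ∑ φ, F φ = ∑ φ : Vert A → V, ∑ ψ : Vert B → V, F (Sum.elim φ ψ) := by
  let e : (Vert A → V) × (Vert B → V) ≃ (Vert (graft A B) → V) :=
    (Equiv.sumArrowEquivProdArrow (Vert A) (Vert B) V).symm
  rw [← Fintype.sum_prod_type' fun (φ : Vert A → V) (ψ : Vert B → V) => F (Sum.elim φ ψ)]
  exact (Fintype.sum_equiv e (fun p => F (Sum.elim p.1 p.2)) F fun _ => rfl).symm

variable [Fintype V]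

open Classical in
/-- The recursion of colour coding computes the sum over the colourful maps. -/
theorem treeSum_eq (M : V → V → R) (μ : V → C) (T : PlaneTree) (x : V) (S : Finset C) :
    treeSum M μ T x S = ∑ φ : Vert T → V, if IsColorful μ T φ x S then weight M T φ else 0 := by
  induction T generalizing x S with
  | leaf =>
    rw [treeSum, sum_vert_leaf, Finset.sum_eq_single x]
    · have : IsColorful μ leaf (fun _ => x) x S ↔ {μ x} = S := by
        have h1 : (Equiv.funUnique Unit V).symm x = fun _ => x := rfl
        have h2 : Function.Injective (μ ∘ fun _ : Unit => x) := Function.injective_of_subsingleton _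
        have h3 : Finset.univ.image (μ ∘ fun _ : Unit => x) = {μ x} := by ext; simp
        rw [IsColorful]
        exact ⟨fun h => by rw [← h.2.2]; exact h3.symm, fun h => ⟨rfl, h2, by rw [← h]; exact h3⟩⟩
      simp only [this, weight]
    · intro y _ hy
      rw [if_neg]
      rintro ⟨h, -⟩
      exact hy h
    · simp
  | graft A B ihA ihB =>
    rw [treeSum, sum_vert_graft]
    -- of the terms for a pair of maps only the one with the right root and colours does not vanish
    have hterm : ∀ y, ∀ P ∈ S.powerset,
        treeSum M μ A x P * treeSum M μ B y (S \ P) * M x y =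
          ∑ φ : Vert A → V, ∑ ψ : Vert B → V,
            if y = ψ B.root then if P = Finset.univ.image (μ ∘ φ) then
              if IsColorful μ (graft A B) (Sum.elim φ ψ) x S then
                weight M (graft A B) (Sum.elim φ ψ) else 0 else 0 else 0 := by
      intro y P hP
      rw [ihA, ihB, Finset.sum_mul_sum, Finset.sum_mul]
      refine Finset.sum_congr rfl fun φ _ => ?_
      rw [Finset.sum_mul]
      refine Finset.sum_congr rfl fun ψ _ => ?_
      have hiff := isColorful_graft_iff (μ := μ) (φ := φ) (ψ := ψ) (x := x) (y := y) (S := S)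
        (P := P)
      rw [Finset.mem_powerset] at hP
      by_cases h : IsColorful μ A φ x P ∧ IsColorful μ B ψ y (S \ P)
      · obtain ⟨h1, h2, h3⟩ := hiff.1 ⟨hP, h⟩
        rw [if_pos h.1, if_pos h.2, if_pos h2, if_pos h3, if_pos h1, h2, ← h.1.1]
        rfl
      · have h0 : (if IsColorful μ A φ x P then weight M A φ else 0) *
            (if IsColorful μ B ψ y (S \ P) then weight M B ψ else 0) = 0 := by
          by_cases h1 : IsColorful μ A φ x P
          · rw [if_neg fun h2 => h ⟨h1, h2⟩, mul_zero]
          · rw [if_neg h1, zero_mul]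
        rw [h0, zero_mul]
        split_ifs with h1 h2 h3
        · exact absurd (hiff.2 ⟨h3, h1, h2⟩).2 h
        · rfl
        · rfl
        · rfl
    rw [Finset.sum_congr rfl fun y _ => Finset.sum_congr rfl (hterm y)]
    simp only [Finset.sum_comm (s := S.powerset)]
    rw [Finset.sum_comm]
    refine Finset.sum_congr rfl fun φ _ => ?_
    rw [Finset.sum_comm]
    refine Finset.sum_congr rfl fun ψ _ => ?_
    rw [Finset.sum_eq_single (ψ B.root), Finset.sum_eq_single (Finset.univ.image (μ ∘ φ))]
    · rw [if_pos rfl, if_pos rfl]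
    · intro P _ hP
      rw [if_pos rfl, if_neg hP]
    · intro h
      rw [if_pos rfl, if_pos rfl, if_neg]
      intro h2
      exact h (Finset.mem_powerset.2 (isColorful_graft_iff.2 ⟨h2, rfl, rfl⟩).1)
    · intro y _ hy
      simp [hy]
    · simp

lemma treeSum_eq_zero_of_notMem (M : V → V → R) (μ : V → C) {T : PlaneTree} {x : V} {S : Finset C}
    (h : μ x ∉ S) : treeSum M μ T x S = 0 := by
  induction T generalizing S with
  | leaf =>
    rw [treeSum, if_neg]
    rintro rfl
    simp at h
  | graft A B ihA ihB =>
    rw [treeSum]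
    refine Finset.sum_eq_zero fun y _ => Finset.sum_eq_zero fun P hP => ?_
    rw [ihA fun h' => h (Finset.mem_powerset.1 hP h'), zero_mul, zero_mul]

lemma treeSum_eq_zero_of_card_ne (M : V → V → R) (μ : V → C) {T : PlaneTree} {x : V} {S : Finset C}
    (h : S.card ≠ T.size) : treeSum M μ T x S = 0 := by
  classical
  rw [treeSum_eq]
  refine Finset.sum_eq_zero fun φ _ => if_neg ?_
  rintro ⟨-, h1, h2⟩
  rw [← h2, Finset.card_image_of_injective _ h1, Finset.card_univ, card_vert] at h
  exact h rfl

end Weight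

open Classical in
/-- For symmetric `M` the weight is the product over the edges of the image, each edge being listed
once as an increasing pair. -/
lemma weight_eq_prod {R : Type} [Field R] {n : ℕ} (M : Fin n → Fin n → R)
    (hM : ∀ i j, M i j = M j i) (T : PlaneTree) (φ : Vert T → Fin n) (hφ : Function.Injective φ) :
    weight M T φ = ∏ e : Fin n × Fin n with e.1 < e.2 ∧ Relation.Map T.graph.Adj φ φ e.1 e.2,
      M e.1 e.2 := by
  induction T with
  | leaf =>
    rw [weight, Finset.filter_false_of_mem, Finset.prod_empty]
    rintro e - ⟨-, u, v, h, -⟩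
    exact h
  | graft A B ihA ihB =>
    have hφA : Function.Injective fun u => φ (.inl u) := fun u v h => Sum.inl_injective (hφ h)
    have hφB : Function.Injective fun u => φ (.inr u) := fun u v h => Sum.inr_injective (hφ h)
    have hne : φ (.inl A.root) ≠ φ (.inr B.root) := fun h => by simpa using hφ h
    -- the pair that lists the edge between the two roots
    obtain ⟨e₀, he₀, hMe, hmem⟩ : ∃ e₀ : Fin n × Fin n, e₀.1 < e₀.2 ∧
        M e₀.1 e₀.2 = M (φ (.inl A.root)) (φ (.inr B.root)) ∧
        ∀ e : Fin n × Fin n, e.1 < e.2 → (e = e₀ ↔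
          e.1 = φ (.inl A.root) ∧ e.2 = φ (.inr B.root) ∨
          e.2 = φ (.inl A.root) ∧ e.1 = φ (.inr B.root)) := by
      rcases hne.lt_or_gt with h | h
      · refine ⟨(φ (.inl A.root), φ (.inr B.root)), h, rfl, fun e he => ?_⟩
        rw [Prod.ext_iff]
        refine ⟨Or.inl, ?_⟩
        rintro (h' | ⟨h1, h2⟩)
        · exact h'
        · rw [h1, h2] at he
          exact absurd he (lt_asymm h)
      · refine ⟨(φ (.inr B.root), φ (.inl A.root)), h, hM _ _, fun e he => ?_⟩
        rw [Prod.ext_iff]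
        refine ⟨fun h' => Or.inr ⟨h'.2, h'.1⟩, ?_⟩
        rintro (⟨h1, h2⟩ | ⟨h1, h2⟩)
        · rw [h1, h2] at he
          exact absurd he (lt_asymm h)
        · exact ⟨h2, h1⟩
    have hset : (Finset.univ.filter fun e : Fin n × Fin n =>
          e.1 < e.2 ∧ Relation.Map (graft A B).graph.Adj φ φ e.1 e.2) =
        insert e₀ ((Finset.univ.filter fun e : Fin n × Fin n => e.1 < e.2 ∧
          Relation.Map A.graph.Adj (fun u => φ (.inl u)) (fun u => φ (.inl u)) e.1 e.2) ∪
        Finset.univ.filter fun e : Fin n × Fin n => e.1 < e.2 ∧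
          Relation.Map B.graph.Adj (fun u => φ (.inr u)) (fun u => φ (.inr u)) e.1 e.2) := by
      ext e
      simp only [Finset.mem_filter, Finset.mem_univ, true_and, Finset.mem_insert, Finset.mem_union]
      constructor
      · rintro ⟨h, u | u, v | v, hadj, h1, h2⟩
        · exact Or.inr (Or.inl ⟨h, u, v, SimpleGraph.joinEdge_inl_inl.1 hadj, h1, h2⟩)
        · obtain ⟨rfl, rfl⟩ := SimpleGraph.joinEdge_inl_inr.1 hadj
          exact Or.inl ((hmem e h).2 (Or.inl ⟨h1.symm, h2.symm⟩))
        · obtain ⟨rfl, rfl⟩ := SimpleGraph.joinEdge_inr_inl.1 hadj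
          exact Or.inl ((hmem e h).2 (Or.inr ⟨h2.symm, h1.symm⟩))
        · exact Or.inr (Or.inr ⟨h, u, v, SimpleGraph.joinEdge_inr_inr.1 hadj, h1, h2⟩)
      · rintro (rfl | ⟨h, u, v, hadj, h1, h2⟩ | ⟨h, u, v, hadj, h1, h2⟩)
        · refine ⟨he₀, ?_⟩
          rcases (hmem e he₀).1 rfl with ⟨h1, h2⟩ | ⟨h1, h2⟩
          · exact ⟨.inl A.root, .inr B.root, SimpleGraph.joinEdge_inl_inr.2 ⟨rfl, rfl⟩, h1.symm,
              h2.symm⟩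
          · exact ⟨.inr B.root, .inl A.root, SimpleGraph.joinEdge_inr_inl.2 ⟨rfl, rfl⟩, h2.symm,
              h1.symm⟩
        · exact ⟨h, .inl u, .inl v, SimpleGraph.joinEdge_inl_inl.2 hadj, h1, h2⟩
        · exact ⟨h, .inr u, .inr v, SimpleGraph.joinEdge_inr_inr.2 hadj, h1, h2⟩
    have hcross : ∀ u v, φ (.inl u) ≠ φ (.inr v) := fun u v h => by simpa using hφ h
    rw [hset, Finset.prod_insert, Finset.prod_union, hMe, weight, ihA _ hφA, ihB _ hφB, mul_comm]
    · rw [Finset.disjoint_left]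
      simp only [Finset.mem_filter, Finset.mem_univ, true_and]
      rintro e ⟨-, u, v, -, h1, -⟩ ⟨-, u', v', -, h1', -⟩
      exact hcross u u' (h1.trans h1'.symm)
    · simp only [Finset.mem_union, Finset.mem_filter, Finset.mem_univ, true_and]
      rintro (⟨-, u, v, -, h1, h2⟩ | ⟨-, u, v, -, h1, h2⟩) <;>
        rcases (hmem e₀ he₀).1 rfl with ⟨h3, h4⟩ | ⟨h3, h4⟩
      · exact hcross v B.root (h2.trans h4)
      · exact hcross u B.root (h1.trans h4)
      · exact hcross A.root u (h3.symm.trans h1.symm)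
      · exact hcross A.root v (h3.symm.trans h2.symm)

end PlaneTree

namespace TreeStat

/-- The image of a graph under an injective map into the vertices of the complete graph. -/
def imageSubgraph {V : Type} {n : ℕ} (G : SimpleGraph V) (φ : V ↪ Fin n) :
    (⊤ : SimpleGraph (Fin n)).Subgraph where
  verts := Set.range φ
  Adj := Relation.Map G.Adj φ φ
  adj_sub := by
    rintro _ _ ⟨u, v, h, rfl, rfl⟩
    exact fun he => h.ne (φ.injective he)
  edge_vert := by
    rintro _ _ ⟨u, v, h, rfl, rfl⟩
    exact ⟨u, rfl⟩
  symm := ⟨by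
    rintro _ _ ⟨u, v, h, rfl, rfl⟩
    exact ⟨v, u, h.symm, rfl, rfl⟩⟩

/-- The injective maps with a given image are the isomorphisms onto that image. -/
lemma card_imageSubgraph_eq {V : Type} {n : ℕ} (G : SimpleGraph V)
    (S : (⊤ : SimpleGraph (Fin n)).Subgraph) :
    Nat.card {φ : V ↪ Fin n // imageSubgraph G φ = S} = Nat.card (G ≃g S.coe) := by
  have himg : ∀ ψ : G ≃g S.coe, imageSubgraph G
      (ψ.toEquiv.toEmbedding.trans (Function.Embedding.subtype _)) = S := by
    intro ψ
    ext x y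
    · constructor
      · rintro ⟨u, rfl⟩
        exact (ψ u).2
      · exact fun hx => ⟨ψ.symm ⟨x, hx⟩, congrArg Subtype.val (ψ.apply_symm_apply ⟨x, hx⟩)⟩
    · constructor
      · rintro ⟨u, v, h, rfl, rfl⟩
        exact (ψ.map_adj_iff.2 h : S.coe.Adj _ _)
      · intro h
        refine ⟨ψ.symm ⟨x, S.edge_vert h⟩, ψ.symm ⟨y, S.edge_vert h.symm⟩, ?_,
          congrArg Subtype.val (ψ.apply_symm_apply ⟨x, _⟩),
          congrArg Subtype.val (ψ.apply_symm_apply ⟨y, _⟩)⟩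
        rw [← ψ.map_adj_iff, ψ.apply_symm_apply, ψ.apply_symm_apply]
        exact h
  refine (Nat.card_congr (Equiv.ofBijective (fun ψ => ⟨_, himg ψ⟩) ⟨fun ψ ψ' h => ?_, ?_⟩)).symm
  · ext u
    have := congrArg (fun φ => (φ.1 u : Fin n)) h
    exact congrArg Fin.val this
  · rintro ⟨φ, rfl⟩
    refine ⟨⟨Equiv.ofInjective φ φ.injective, ?_⟩, ?_⟩
    · intro u v
      constructor
      · rintro ⟨u', v', h, h1, h2⟩
        rwa [φ.injective h1, φ.injective h2] at h
      · exact fun h => ⟨u, v, h, rfl, rfl⟩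
    · exact Subtype.ext (by ext u; rfl)

open Classical in
/-- Every colourful copy of a tree is the image of as many maps as the tree has automorphisms. -/
theorem aut_mul_colorfulCount {n K : ℕ} {H : SimpleGraph (Fin (K + 1))} {T : PlaneTree}
    (ι : T.graph ≃g H) (M : Matrix (Fin n) (Fin n) ℝ) (hM : ∀ i j, M i j = M j i)
    (μ : Coloring n K) :
    (aut T.graph : ℝ) * colorfulCount H M μ =
      ∑ φ : T.Vert → Fin n, if Function.Injective (μ ∘ φ) then T.weight M φ else 0 := by
  have hinj : ∀ φ : T.Vert → Fin n, Function.Injective (μ ∘ φ) → Function.Injective φ :=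
    fun φ h => h.of_comp
  let F : (⊤ : SimpleGraph (Fin n)).Subgraph → ℝ := fun S =>
    colorful μ S.verts * ∏ e : Fin n × Fin n with e.1 < e.2 ∧ S.Adj e.1 e.2, M e.1 e.2
  have h1 : ∑ φ : T.Vert ↪ Fin n, F (imageSubgraph T.graph φ) =
      ∑ φ : T.Vert → Fin n, if Function.Injective (μ ∘ φ) then T.weight M φ else 0 := by
    refine Fintype.sum_of_injective (fun φ : T.Vert ↪ Fin n => (φ : T.Vert → Fin n))
      DFunLike.coe_injective _ _ (fun φ hφ => if_neg fun h => hφ ⟨⟨φ, hinj φ h⟩, rfl⟩) fun φ => ?_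
    have hc : Set.InjOn μ (imageSubgraph T.graph φ).verts ↔ Function.Injective (μ ∘ φ) := by
      change Set.InjOn μ (Set.range φ) ↔ _
      rw [← Set.image_univ, ← Set.InjOn.comp_iff (φ.injective.injOn), Set.injOn_univ]
    simp only [F, colorful, hc]
    split_ifs with h
    · rw [one_mul, PlaneTree.weight_eq_prod M hM T φ φ.injective]
      exact Finset.prod_congr (by ext; rw [Finset.mem_filter, Finset.mem_filter]; rfl) fun _ _ => rfl
    · rw [zero_mul]
  rw [← h1, ← Finset.sum_fiberwise (s := Finset.univ) (g := imageSubgraph T.graph), colorfulCount,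
    Finset.mul_sum, Finset.sum_filter]
  refine Finset.sum_congr rfl fun S _ => ?_
  have h2 : ∑ φ : T.Vert ↪ Fin n with imageSubgraph T.graph φ = S, F (imageSubgraph T.graph φ) =
      (Nat.card (T.graph ≃g S.coe) : ℝ) * F S := by
    rw [Finset.sum_congr rfl (g := fun _ => F S) fun φ hφ => by rw [(Finset.mem_filter.1 hφ).2],
      Finset.sum_const, nsmul_eq_mul, ← card_imageSubgraph_eq, Nat.card_eq_fintype_card,
      Fintype.card_subtype]
  rw [h2]
  by_cases h : Nonempty (S.coe ≃g H)
  · obtain ⟨ψ⟩ := id h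
    rw [if_pos h, aut, Nat.card_congr (β := T.graph ≃g S.coe)
      { toFun := fun f => f.trans (ι.trans ψ.symm)
        invFun := fun f => f.trans (ι.trans ψ.symm).symm
        left_inv := fun f => by ext; simp
        right_inv := fun f => by ext; simp }]
  · rw [if_neg h]
    have : IsEmpty (T.graph ≃g S.coe) := ⟨fun f => h ⟨f.symm.trans ι⟩⟩
    simp

end TreeStat

/-! ### Segments of level sequences -/

namespace PlaneTree

/-- From index `v ≥ 1` on, the level sequence of `T` continues with the levels of `S`, without its
root, which is then a vertex that comes before; all later children of this vertex are in `S`. -/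
def Segment (T : PlaneTree) (v : ℕ) (S : PlaneTree) : Prop :=
  ∃ d pre post, T.levels = pre ++ (tail d S ++ post) ∧ pre.length = v ∧ 0 < v ∧
    ∀ x ∈ post.head?, x ≤ d

lemma segment_self (T : PlaneTree) : Segment T 1 T :=
  ⟨0, [0], [], by simp [levels], rfl, one_pos, by simp⟩

section Segment

variable {T A B : PlaneTree} {v : ℕ}

lemma Segment.first (h : Segment T v (graft A B)) : Segment T (v + 1) B := by
  obtain ⟨d, pre, post, h1, h2, h3, h4⟩ := h
  exact ⟨d + 1, pre ++ [d + 1], tail d A ++ post, by simp [h1, tail], by simp [h2], by omega,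
    FreeTrees.head?_tail_append_le h4⟩

lemma Segment.rest (h : Segment T v (graft A B)) : Segment T (v + B.size) A := by
  obtain ⟨d, pre, post, h1, h2, h3, h4⟩ := h
  have := length_tail (d + 1) B
  exact ⟨d, pre ++ (d + 1) :: tail (d + 1) B, post, by simp [h1, tail], by simp [h2]; omega,
    by omega, h4⟩

lemma Segment.lt_size (h : Segment T v (graft A B)) : v + A.size + B.size ≤ T.size + 1 := by
  obtain ⟨d, pre, post, h1, h2, h3, h4⟩ := h
  have h5 := congrArg List.length h1
  have h6 := length_tail (d + 1) B
  have h7 := length_tail d A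
  simp only [length_levels, tail, List.length_append, List.length_cons] at h5
  omega

lemma getD_head_le {l : List ℕ} {d : ℕ} (h : ∀ x ∈ l.head?, x ≤ d) : l.getD 0 0 ≤ d := by
  cases l with
  | nil => simp
  | cons x l => simpa using h x (by simp)

/-- The levels of a vertex, of its descendants, of the next vertex and of the next sibling. -/
lemma Segment.levels (h : Segment T v (graft A B)) :
    (∀ i, v < i → i < v + B.size → T.lev v < T.lev i) ∧
    (A ≠ leaf → T.lev (v + B.size) = T.lev v) ∧ (A = leaf → T.lev (v + B.size) < T.lev v) ∧
    (B ≠ leaf → T.lev (v + 1) = T.lev v + 1) ∧ (B = leaf → T.lev (v + 1) ≤ T.lev v) := by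
  obtain ⟨d, pre, post, h1, h2, h3, h4⟩ := h
  have hlen := length_tail (d + 1) B
  have e1 : ∀ i, T.lev (v + i) = ((d + 1) :: tail (d + 1) B ++ (tail d A ++ post)).getD i 0 := by
    intro i
    rw [lev, h1, ← h2, List.getD_append_add]
    simp [tail]
  have e2 : T.lev (v + B.size) = (tail d A ++ post).getD 0 0 := by
    have := List.getD_append_add ((d + 1) :: tail (d + 1) B) (tail d A ++ post) 0 0
    rw [add_zero, List.length_cons, hlen] at this
    rw [e1, this]
  have e0 : T.lev v = d + 1 := by simpa using e1 0
  rw [e0]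
  refine ⟨fun i hi1 hi2 => ?_, fun hA => ?_, fun hA => ?_, fun hB => ?_, fun hB => ?_⟩
  · have := e1 (i - v)
    rw [show v + (i - v) = i by omega, List.getD_append _ _ _ _ (by simp; omega),
      show i - v = i - v - 1 + 1 by omega, List.getD_cons_succ,
      List.getD_eq_getElem _ _ (by omega)] at this
    rw [this]
    exact lt_of_mem_tail (List.getElem_mem _)
  · rw [e2]
    cases A with
    | leaf => exact absurd rfl hA
    | graft A' B' => simp [tail]
  · rw [e2, hA]
    have := getD_head_le h4
    simp only [tail, List.nil_append]
    omega
  · cases B with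
    | leaf => exact absurd rfl hB
    | graft A' B' => rw [e1]; simp [tail]
  · subst hB
    have : leaf.size = 1 := rfl
    rw [this] at e2
    rw [e2]
    exact getD_head_le (FreeTrees.head?_tail_append_le h4)

end Segment

/-- The sum of `g` over the sizes of the trees from which the recursion of colour coding builds the
given tree. -/
def sizeSum (g : ℕ → ℕ) : PlaneTree → ℕ
  | leaf => 0
  | graft A B => g (A.size + B.size) + sizeSum g A + sizeSum g B

/-- The segments that begin at the vertices of a segment for `S` are those for the trees from which
`S` is built, so that a sum over the vertices is a sum over these trees. -/
lemma sum_segment {T S : PlaneTree} {v : ℕ} {f g : ℕ → ℕ}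
    (hf : ∀ v A B, Segment T v (graft A B) → f v = g (A.size + B.size)) (h : Segment T v S) :
    ∑ u ∈ Finset.Ico v (v + (S.size - 1)), f u = sizeSum g S := by
  induction S generalizing v with
  | leaf => simp [size, sizeSum]
  | graft A B ihA ihB =>
    have hA := A.size_pos
    have hB := B.size_pos
    have h1 := ihA h.rest
    have h2 := ihB h.first
    rw [sizeSum, ← h1, ← h2, ← hf v A B h]
    have e1 : v + ((graft A B).size - 1) = v + B.size + (A.size - 1) := by
      simp only [size]; omega
    rw [e1, ← Finset.sum_Ico_consecutive _ (show v ≤ v + B.size by omega) (by omega),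
      Finset.sum_eq_sum_Ico_succ_bot (by omega), show v + 1 + (B.size - 1) = v + B.size by omega]
    omega

end PlaneTree

/-! ### The tables of colour coding -/

namespace ColorCoding

open Timed FreeTrees PlaneTree

section Subsets

variable {K : ℕ}

lemma mem_subsetsOfSize (s : ℕ) {cs : List (Fin (K + 1))} (hcs : cs.Nodup)
    (S : Finset (Fin (K + 1))) :
    S ∈ (subsetsOfSize s cs).val ↔ S ⊆ cs.toFinset ∧ S.card = s := by
  induction cs generalizing s S with
  | nil =>
    cases s with
    | zero => simp [subsetsOfSize]
    | succ s =>
      simp only [subsetsOfSize, val_op, List.not_mem_nil, List.toFinset_nil, Finset.subset_empty,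
        false_iff, not_and]
      rintro rfl
      simp
  | cons c cs ih =>
    cases s with
    | zero =>
      simp only [subsetsOfSize, val_op, List.mem_singleton, Finset.card_eq_zero]
      exact ⟨fun h => ⟨by simp [h], h⟩, fun h => h.2⟩
    | succ s =>
      obtain ⟨hc, hcs⟩ := List.nodup_cons.1 hcs
      have hc' : c ∉ cs.toFinset := by simpa using hc
      simp only [subsetsOfSize, insertAll, val_bind, val_mapList, val_op, val_steps,
        List.mem_append, List.mem_map, ih _ hcs, List.toFinset_cons]
      constructor
      · rintro (⟨P, ⟨h1, h2⟩, rfl⟩ | ⟨h1, h2⟩)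
        · exact ⟨Finset.insert_subset_insert _ h1, by
            rw [Finset.card_insert_of_notMem fun h => hc' (h1 h), h2]⟩
        · exact ⟨h1.trans (Finset.subset_insert _ _), h2⟩
      · rintro ⟨h1, h2⟩
        by_cases h : c ∈ S
        · refine Or.inl ⟨S.erase c, ⟨?_, ?_⟩, Finset.insert_erase h⟩
          · rwa [← Finset.subset_insert_iff]
          · rw [Finset.card_erase_of_mem h, h2, Nat.add_sub_cancel]
        · exact Or.inr ⟨(Finset.subset_insert_iff_of_notMem h).1 h1, h2⟩

lemma length_subsetsOfSize (s : ℕ) (cs : List (Fin (K + 1))) :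
    (subsetsOfSize s cs).val.length = cs.length.choose s := by
  induction cs generalizing s with
  | nil => cases s <;> simp [subsetsOfSize]
  | cons c cs ih =>
    cases s with
    | zero => simp [subsetsOfSize]
    | succ s =>
      simp [subsetsOfSize, insertAll, val_mapList, ih, Nat.choose_succ_succ]

lemma time_subsetsOfSize_le (s : ℕ) (cs : List (Fin (K + 1))) :
    (subsetsOfSize s cs).time ≤ (3 * cs.length + 1) * 2 ^ cs.length := by
  induction cs generalizing s with
  | nil => cases s <;> simp [subsetsOfSize]
  | cons c cs ih =>
    cases s with
    | zero =>
      simp only [subsetsOfSize, time_op]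
      exact Nat.mul_pos (by omega) (by positivity)
    | succ s =>
      have h1 := ih s
      have h2 := ih (s + 1)
      have h3 : (insertAll c (subsetsOfSize s cs).val).time ≤ cs.length.choose s * 2 + 1 := by
        have := time_mapList_le (f := fun C : Finset (Fin (K + 1)) => op (insert c C))
          (l := (subsetsOfSize s cs).val) (c := 1) (by simp)
        rwa [length_subsetsOfSize] at this
      have h4 : (insertAll c (subsetsOfSize s cs).val).val.length = cs.length.choose s := by
        rw [insertAll, val_mapList, List.length_map, length_subsetsOfSize]
      have h5 := Nat.choose_le_two_pow cs.length s
      have h6 : 0 < 2 ^ cs.length := by positivity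
      have h7 : (3 * (cs.length + 1) + 1) * 2 ^ (cs.length + 1) =
          2 * ((3 * cs.length + 1) * 2 ^ cs.length) + 6 * 2 ^ cs.length := by ring
      simp only [subsetsOfSize, time_bind, time_steps, h4, List.length_cons]
      omega

lemma sum_distribute {R : Type} [AddCommMonoid R] (c : Fin (K + 1))
    (l : List (Finset (Fin (K + 1)) × Finset (Fin (K + 1))))
    (f : Finset (Fin (K + 1)) × Finset (Fin (K + 1)) → R) :
    ((distribute c l).val.map f).sum =
      (l.map fun p => f (p.1, insert c p.2)).sum + (l.map fun p => f (insert c p.1, p.2)).sum := by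
  induction l with
  | nil => simp [distribute]
  | cons p l ih =>
    obtain ⟨P, Q⟩ := p
    simp only [distribute, val_bind, val_op, List.map_cons, List.sum_cons, ih]
    abel

lemma time_distribute (c : Fin (K + 1))
    (l : List (Finset (Fin (K + 1)) × Finset (Fin (K + 1)))) :
    (distribute c l).time = 4 * l.length + 1 := by
  induction l with
  | nil => rfl
  | cons p l ih =>
    obtain ⟨P, Q⟩ := p
    simp only [distribute, time_bind, time_op, val_op, ih, List.length_cons]
    omega

/-- The listed pairs are all the partitions into two parts. -/
lemma sum_splits {R : Type} [AddCommMonoid R] (C : Finset (Fin (K + 1))) {cs : List (Fin (K + 1))}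
    (hcs : cs.Nodup) (f : Finset (Fin (K + 1)) × Finset (Fin (K + 1)) → R) :
    ((splits C cs).val.map f).sum =
      ∑ P ∈ (cs.toFinset ∩ C).powerset, f (P, (cs.toFinset ∩ C) \ P) := by
  induction cs generalizing f with
  | nil => simp [splits]
  | cons c cs ih =>
    obtain ⟨hc, hcs⟩ := List.nodup_cons.1 hcs
    have hc' : c ∉ cs.toFinset ∩ C := fun h => hc (by simpa using (Finset.mem_inter.1 h).1)
    simp only [splits, val_bind, val_op, val_ite, decide_eq_true_eq, List.toFinset_cons]
    by_cases h : c ∈ C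
    · rw [if_pos h, sum_distribute, ih hcs, ih hcs, Finset.insert_inter_of_mem h,
        Finset.sum_powerset_insert hc']
      congr 1
      · refine Finset.sum_congr rfl fun P hP => ?_
        rw [Finset.insert_sdiff_of_notMem _ fun h' => hc' (Finset.mem_powerset.1 hP h')]
      · refine Finset.sum_congr rfl fun P hP => ?_
        rw [Finset.insert_sdiff_insert, Finset.sdiff_insert_of_notMem hc']
    · rw [if_neg h, val_pure, ih hcs, Finset.insert_inter_of_notMem h]

lemma length_splits (C : Finset (Fin (K + 1))) {cs : List (Fin (K + 1))} (hcs : cs.Nodup) :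
    (splits C cs).val.length = 2 ^ (cs.toFinset ∩ C).card := by
  have := sum_splits C hcs fun _ => 1
  rw [Finset.sum_const, Finset.card_powerset] at this
  simpa using this

lemma time_splits_le (C : Finset (Fin (K + 1))) {cs : List (Fin (K + 1))} (hcs : cs.Nodup) :
    (splits C cs).time ≤ 2 * cs.length + 1 + 4 * 2 ^ (cs.toFinset ∩ C).card := by
  induction cs with
  | nil => simp [splits]
  | cons c cs ih =>
    obtain ⟨hc, hcs⟩ := List.nodup_cons.1 hcs
    have hc' : c ∉ cs.toFinset ∩ C := fun h => hc (by simpa using (Finset.mem_inter.1 h).1)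
    have h1 := ih hcs
    have h2 := length_splits C hcs
    simp only [splits, time_bind, time_op, val_op, time_ite, decide_eq_true_eq,
      List.toFinset_cons, List.length_cons]
    by_cases h : c ∈ C
    · rw [if_pos h, time_distribute, Finset.insert_inter_of_mem h,
        Finset.card_insert_of_notMem hc', pow_succ]
      omega
    · rw [if_neg h, time_pure, Finset.insert_inter_of_notMem h]
      omega

end Subsets

section Tables

variable {R : Type} [Field R] {n K : ℕ}

lemma val_entry (M : Fin n → Fin n → R) (μ : TreeStat.Coloring n K) (A B : PlaneTree)
    (x : Fin n) (S : Finset (Fin (K + 1))) :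
    (entry M (fun key => treeSum M μ A key.1 key.2) (fun key => treeSum M μ B key.1 key.2)
      (x, S)).val = treeSum M μ (graft A B) x S := by
  have hu : (List.finRange (K + 1)).toFinset ∩ S = S := by
    rw [List.toFinset_finRange, Finset.univ_inter]
  simp only [entry, val_bind, val_sumOver, val_op, val_ite, decide_eq_true_eq]
  rw [← Fin.sum_univ_def, treeSum]
  refine Finset.sum_congr rfl fun y _ => ?_
  split_ifs with hy
  · -- a vertex cannot take the place of both roots, as its colour lies in one part only
    symm
    refine Finset.sum_eq_zero fun P _ => ?_
    by_cases h : μ x ∈ P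
    · rw [hy, treeSum_eq_zero_of_notMem M μ (T := B) (S := S \ P) (by simp [h])]
      simp
    · rw [treeSum_eq_zero_of_notMem M μ h]
      simp
  · rw [sum_splits S (List.nodup_finRange _), hu]
    refine Finset.sum_congr rfl fun P _ => ?_
    split_ifs with h1 h2
    · have h1 : P = ∅ := h1
      rw [treeSum_eq_zero_of_notMem M μ (T := A) (S := P) (by rw [h1]; exact Finset.notMem_empty _)]
      simp
    · have h2 : S \ P = ∅ := h2
      rw [treeSum_eq_zero_of_notMem M μ (T := B) (S := S \ P)
        (by rw [h2]; exact Finset.notMem_empty _)]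
      simp
    · rfl

lemma time_entry_le (hn : 1 ≤ n) (M : Fin n → Fin n → R) (Ya Yb : Table R n K)
    (key : Fin n × Finset (Fin (K + 1))) :
    (entry M Ya Yb key).time ≤ n * (2 * (K + 1) + 5 + 12 * 2 ^ key.2.card) := by
  have hu : (List.finRange (K + 1)).toFinset ∩ key.2 = key.2 := by
    rw [List.toFinset_finRange, Finset.univ_inter]
  have h1 := time_splits_le key.2 (List.nodup_finRange (K + 1))
  have h2 := length_splits key.2 (List.nodup_finRange (K + 1))
  rw [hu] at h1 h2
  rw [List.length_finRange] at h1
  have hex : ∀ f : Fin n → Timed R, (∀ y, (f y).time ≤ 2 + 8 * 2 ^ key.2.card) →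
      (splits key.2 (List.finRange (K + 1))).time + (sumOver f (List.finRange n)).time ≤
        n * (2 * (K + 1) + 5 + 12 * 2 ^ key.2.card) := by
    intro f hf
    have h3 := time_sumOver_le (l := List.finRange n) fun y _ => hf y
    rw [List.length_finRange] at h3
    have h4 : 2 * (K + 1) + 2 + 4 * 2 ^ key.2.card ≤
        n * (2 * (K + 1) + 2 + 4 * 2 ^ key.2.card) := Nat.le_mul_of_pos_left _ hn
    have h5 : n * (2 * (K + 1) + 5 + 12 * 2 ^ key.2.card) =
        n * (2 * (K + 1) + 2 + 4 * 2 ^ key.2.card) + n * (2 + 8 * 2 ^ key.2.card + 1) := by ring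
    omega
  refine hex _ fun y => ?_
  simp only [time_bind, time_op, val_op, time_ite]
  split_ifs with hy
  · omega
  · have hin : ∀ f : Finset (Fin (K + 1)) × Finset (Fin (K + 1)) → Timed R,
        (∀ p, (f p).time ≤ 7) → 1 + (sumOver f (splits key.2 (List.finRange (K + 1))).val).time ≤
          2 + 8 * 2 ^ key.2.card := by
      intro f hf
      have := time_sumOver_le (l := (splits key.2 (List.finRange (K + 1))).val) fun p _ => hf p
      rw [h2] at this
      omega
    refine hin _ fun p => ?_
    simp only [time_bind, time_op, val_op, time_ite]
    split_ifs <;> omega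

lemma length_keys (s : ℕ) :
    (List.finRange n ×ˢ (subsetsOfSize s (List.finRange (K + 1))).val).length =
      n * (K + 1).choose s := by
  rw [List.length_product, List.length_finRange, length_subsetsOfSize, List.length_finRange]

lemma mem_keys (s : ℕ) (key : Fin n × Finset (Fin (K + 1))) :
    key ∈ List.finRange n ×ˢ (subsetsOfSize s (List.finRange (K + 1))).val ↔ key.2.card = s := by
  obtain ⟨x, S⟩ := key
  rw [List.mem_product, mem_subsetsOfSize s (List.nodup_finRange _)]
  simp

lemma val_tableZero (M : Fin n → Fin n → R) (μ : TreeStat.Coloring n K) :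
    (tableZero (R := R) μ).val = fun key => treeSum M μ leaf key.1 key.2 := by
  funext key
  simp only [tableZero, val_bind, val_tabulate, mem_keys, val_op, val_ite, decide_eq_true_eq]
  split_ifs with h1 h2
  · rw [treeSum, if_pos h2]
  · rw [treeSum, if_neg h2]
  · rw [treeSum_eq_zero_of_card_ne M μ h1]

lemma time_tableZero_le (μ : TreeStat.Coloring n K) :
    (tableZero (R := R) μ).time ≤ (3 * (K + 1) + 1) * 2 ^ (K + 1) + n * (K + 1) * 5 + 1 := by
  have h1 := time_subsetsOfSize_le 1 (List.finRange (K + 1))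
  rw [List.length_finRange] at h1
  have hex : ∀ f : Fin n × Finset (Fin (K + 1)) → Timed R, (∀ key, (f key).time ≤ 4) →
      (subsetsOfSize 1 (List.finRange (K + 1))).time + (tabulate f
        (List.finRange n ×ˢ (subsetsOfSize 1 (List.finRange (K + 1))).val)).time ≤
      (3 * (K + 1) + 1) * 2 ^ (K + 1) + n * (K + 1) * 5 + 1 := by
    intro f hf
    have h2 := time_tabulate_le (l := List.finRange n ×ˢ
      (subsetsOfSize 1 (List.finRange (K + 1))).val) fun key _ => hf key
    rw [length_keys, Nat.choose_one_right] at h2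
    omega
  refine hex _ fun key => ?_
  simp only [time_bind, time_op, val_op, time_ite]
  split_ifs <;> omega

lemma val_tabulate_entry (M : Fin n → Fin n → R) (μ : TreeStat.Coloring n K)
    (A B : PlaneTree) :
    (tabulate (entry M (fun key => treeSum M μ A key.1 key.2)
      (fun key => treeSum M μ B key.1 key.2))
      (List.finRange n ×ˢ (subsetsOfSize (A.size + B.size) (List.finRange (K + 1))).val)).val =
      fun key => treeSum M μ (graft A B) key.1 key.2 := by
  funext key
  rw [val_tabulate]
  simp only [mem_keys]
  split_ifs with h
  · exact val_entry M μ A B key.1 key.2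
  · exact (treeSum_eq_zero_of_card_ne M μ h).symm

lemma time_tabulate_entry_le (hn : 1 ≤ n) (M : Fin n → Fin n → R) (Ya Yb : Table R n K)
    (s : ℕ) :
    (tabulate (entry M Ya Yb)
      (List.finRange n ×ˢ (subsetsOfSize s (List.finRange (K + 1))).val)).time ≤
      n * (K + 1).choose s * (n * (2 * (K + 1) + 5 + 12 * 2 ^ s) + 1) + 1 := by
  have := time_tabulate_le (f := entry M Ya Yb)
    (l := List.finRange n ×ˢ (subsetsOfSize s (List.finRange (K + 1))).val)
    (c := n * (2 * (K + 1) + 5 + 12 * 2 ^ s)) fun key hkey => by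
      have := time_entry_le hn M Ya Yb key
      rwa [(mem_keys s key).1 hkey] at this
  rwa [length_keys] at this

end Tables

/-! ### The order of the edges -/

lemma parent_eq_iff (T : PlaneTree) {w p : ℕ} (h0 : 0 < w) (hw : w < T.size) :
    (parent T.levels w).val = p ↔
      p < w ∧ T.lev p + 1 = T.lev w ∧ ∀ i, p < i → i < w → T.lev p < T.lev i := by
  obtain ⟨h1, h2, h3⟩ := parent_spec T h0 hw
  constructor
  · rintro rfl
    exact ⟨h1, h2, h3⟩
  · rintro ⟨h4, h5, h6⟩
    rcases lt_trichotomy (parent T.levels w).val p with h | h | h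
    · have := h3 p h h4; omega
    · exact h
    · have := h6 _ h h1; omega

lemma val_edges (K : ℕ) (L : List ℕ) {i : ℕ} (h1 : 1 ≤ i) (h2 : i ≤ K) :
    (edges K L).val i = ((parent L (K + 1 - i)).val, K + 1 - i) := by
  rw [edges, val_tabulate, if_pos (by simp; omega)]
  rfl

lemma time_edges_le (K : ℕ) (L : List ℕ) : (edges K L).time ≤ K * (2 * K + 9) + 1 := by
  have := time_tabulate_le (l := List.range' 1 K) (f := fun i => (do
    let c ← op (K + 1 - i)
    let p ← parent L c
    op (p, c) : Timed (ℕ × ℕ))) (c := 2 * K + 8) fun i hi => by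
      have h1 := time_parent_le L (K + 1 - i)
      have h2 := List.mem_range'_1.1 hi
      simp only [time_bind, time_op, val_op]
      omega
  rwa [List.length_range'] at this

lemma lastIncident_spec (e : ℕ → ℕ × ℕ) (v s : ℕ) : (lastIncident e v s).val ≤ s ∧
    (∀ j, (lastIncident e v s).val < j → j ≤ s → (e j).1 ≠ v ∧ (e j).2 ≠ v) ∧
    ((lastIncident e v s).val = 0 ∨ (e (lastIncident e v s).val).1 = v ∨
      (e (lastIncident e v s).val).2 = v) := by
  induction s with
  | zero => exact ⟨le_rfl, fun i h1 h2 => by simp [lastIncident] at h1; omega, Or.inl rfl⟩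
  | succ s ih =>
    simp only [lastIncident, val_bind, val_op, val_ite, decide_eq_true_eq]
    split_ifs with h h'
    · exact ⟨le_rfl, fun i h1 h2 => by omega, Or.inr (Or.inl h)⟩
    · exact ⟨le_rfl, fun i h1 h2 => by omega, Or.inr (Or.inr h')⟩
    · refine ⟨ih.1.trans (by omega), fun i h1 h2 => ?_, ih.2.2⟩
      rcases h2.lt_or_eq with h3 | h3
      · exact ih.2.1 i h1 (by omega)
      · rw [h3]; exact ⟨h, h'⟩

lemma time_lastIncident_le (e : ℕ → ℕ × ℕ) (v s : ℕ) : (lastIncident e v s).time ≤ 3 * s + 1 := by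
  induction s with
  | zero => simp [lastIncident]
  | succ s ih =>
    simp only [lastIncident, time_bind, time_op, val_op, time_ite]
    split_ifs <;> omega

section Incident

variable {K : ℕ} {T A B : PlaneTree} {v i : ℕ}

/-- The last edge at the parent of `v` before the edge above `v` belongs to the next sibling. -/
lemma val_lastIncident_parent (hT : T.size = K + 1) (h : Segment T v (graft A B)) (hv : 0 < v)
    (hi : i + v = K) :
    (lastIncident (edges K T.levels).val (parent T.levels v).val i).val =
      if A = leaf then 0 else K + 1 - (v + B.size) := by
  have hA := A.size_pos
  have hB := B.size_pos
  have hsz := h.lt_size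
  obtain ⟨l1, l2, l3, -, -⟩ := h.levels
  obtain ⟨p1, p2, p3⟩ := parent_spec T hv (by omega)
  obtain ⟨a1, a2, a3⟩ := lastIncident_spec (edges K T.levels).val (parent T.levels v).val i
  set p := (parent T.levels v).val
  set a := (lastIncident (edges K T.levels).val p i).val
  -- an earlier edge at the parent belongs to a sibling after the descendants of `v`
  have hw : a ≠ 0 → v + B.size ≤ K + 1 - a ∧
      (parent T.levels (K + 1 - a)).val = p := by
    intro ha
    have h1 := a3.resolve_left ha
    rw [val_edges _ _ (by omega) (by omega)] at h1
    have h2 : (parent T.levels (K + 1 - a)).val = p := h1.resolve_right (by simp only; omega)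
    obtain ⟨h3, h4, h5⟩ := (parent_eq_iff T (by omega) (by omega)).1 h2
    refine ⟨?_, h2⟩
    by_contra hlt
    have := l1 (K + 1 - a) (by omega) (by omega)
    omega
  split_ifs with hleaf
  · by_contra ha
    obtain ⟨h1, h2⟩ := hw ha
    obtain ⟨h3, h4, h5⟩ := (parent_eq_iff T (by omega) (by omega)).1 h2
    have h6 := l3 hleaf
    rcases h1.lt_or_eq with h7 | h7
    · have := h5 (v + B.size) (by omega) h7
      omega
    · rw [← h7] at h4
      omega
  · have h2A : 2 ≤ A.size := by
      cases A with
      | leaf => exact absurd rfl hleaf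
      | graft A' B' =>
        have := A'.size_pos
        have := B'.size_pos
        simp only [size]; omega
    have hpar : (parent T.levels (v + B.size)).val = p := by
      rw [parent_eq_iff T (by omega) (by omega), l2 hleaf]
      refine ⟨by omega, p2, fun j h1 h2 => ?_⟩
      rcases lt_trichotomy j v with h3 | h3 | h3
      · exact p3 j h1 h3
      · rw [h3]; omega
      · have := l1 j h3 h2
        omega
    have hinc : ¬ a < K + 1 - (v + B.size) := by
      intro hlt
      have := (a2 _ hlt (by omega)).1
      rw [val_edges _ _ (by omega) (by omega)] at this
      apply this
      simp only
      rw [show K + 1 - (K + 1 - (v + B.size)) = v + B.size by omega, hpar]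
    have := (hw (by omega)).1
    omega

/-- The last edge at `v` before the edge above `v` belongs to the first child. -/
lemma val_lastIncident_child (hT : T.size = K + 1) (h : Segment T v (graft A B)) (hv : 0 < v)
    (hi : i + v = K) :
    (lastIncident (edges K T.levels).val v i).val = if B = leaf then 0 else i := by
  have hA := A.size_pos
  have hB := B.size_pos
  have hsz := h.lt_size
  obtain ⟨-, -, -, l4, l5⟩ := h.levels
  obtain ⟨a1, a2, a3⟩ := lastIncident_spec (edges K T.levels).val v i
  set a := (lastIncident (edges K T.levels).val v i).val
  split_ifs with hleaf
  · by_contra ha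
    have h1 := a3.resolve_left ha
    rw [val_edges _ _ (by omega) (by omega)] at h1
    have h2 : (parent T.levels (K + 1 - a)).val = v := h1.resolve_right (by simp only; omega)
    obtain ⟨h3, h4, h5⟩ := (parent_eq_iff T (by omega) (by omega)).1 h2
    have h6 := l5 hleaf
    rcases Nat.lt_or_ge (v + 1) (K + 1 - a) with h7 | h7
    · have := h5 (v + 1) (by omega) h7
      omega
    · rw [show K + 1 - a = v + 1 by omega] at h4
      omega
  · have h2B : 2 ≤ B.size := by
      cases B with
      | leaf => exact absurd rfl hleaf
      | graft A' B' =>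
        have := A'.size_pos
        have := B'.size_pos
        simp only [size]; omega
    have hpar : (parent T.levels (v + 1)).val = v := by
      rw [parent_eq_iff T (by omega) (by omega), l4 hleaf]
      exact ⟨by omega, rfl, fun j h1 h2 => by omega⟩
    by_contra ha
    have := (a2 i (by omega) le_rfl).1
    rw [val_edges _ _ (by omega) (by omega)] at this
    apply this
    simp only
    rw [show K + 1 - i = v + 1 by omega, hpar]

end Incident

/-! ### The correctness and the time of colour coding -/

section Tables

variable {R : Type} [Field R] {n K : ℕ}

/-- The tables hold the sums over the colourful maps. -/
lemma val_tables {T : PlaneTree} (hT : T.size = K + 1) (M : Fin n → Fin n → R)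
    (μ : TreeStat.Coloring n K) (i : ℕ) (hi : i ≤ K) :
    ((tables M μ (edges K T.levels).val i).val.1 0 = 1 ∧
      (tables M μ (edges K T.levels).val i).val.2 0 = fun key => treeSum M μ leaf key.1 key.2) ∧
    ∀ v A B, Segment T v (graft A B) → K + 1 - v ≤ i →
      (tables M μ (edges K T.levels).val i).val.1 (K + 1 - v) = A.size + B.size ∧
      (tables M μ (edges K T.levels).val i).val.2 (K + 1 - v) =
        fun key => treeSum M μ (graft A B) key.1 key.2 := by
  induction i with
  | zero =>
    refine ⟨⟨?_, ?_⟩, fun v A B h hv => ?_⟩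
    · simp [tables]
    · simp [tables, val_tableZero M μ]
    · have := h.lt_size
      have := A.size_pos
      have := B.size_pos
      omega
  | succ i ih =>
    obtain ⟨⟨z1, z2⟩, hseg⟩ := ih (by omega)
    set X := tables M μ (edges K T.levels).val i with hX
    simp only [tables, val_bind, val_op, val_pure, ← hX]
    refine ⟨⟨?_, ?_⟩, fun v A B h hv => ?_⟩
    · rw [Function.update_of_ne (by omega), z1]
    · rw [Function.update_of_ne (by omega), z2]
    rcases hv.lt_or_eq with hlt | heq
    · rw [Function.update_of_ne (by omega), Function.update_of_ne (by omega)]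
      exact hseg v A B h (by omega)
    · have hsz := h.lt_size
      have hA := A.size_pos
      have hB := B.size_pos
      have hv0 : 0 < v := by obtain ⟨_, _, _, _, _, h3, _⟩ := h; exact h3
      rw [val_edges K T.levels (i := i + 1) (by omega) hi, ← heq,
        show K + 1 - (K + 1 - v) = v by omega, val_lastIncident_parent hT h hv0 (by omega),
        val_lastIncident_child hT h hv0 (by omega)]
      have hAtab : X.val.1 (if A = leaf then 0 else K + 1 - (v + B.size)) = A.size ∧
          X.val.2 (if A = leaf then 0 else K + 1 - (v + B.size)) =
            fun key => treeSum M μ A key.1 key.2 := by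
        cases A with
        | leaf => exact ⟨z1, z2⟩
        | graft A' B' =>
          rw [if_neg (by simp)]
          exact hseg _ A' B' h.rest (by omega)
      have hBtab : X.val.1 (if B = leaf then 0 else i) = B.size ∧
          X.val.2 (if B = leaf then 0 else i) = fun key => treeSum M μ B key.1 key.2 := by
        cases B with
        | leaf => exact ⟨z1, z2⟩
        | graft A' B' =>
          rw [if_neg (by simp)]
          have := hseg _ A' B' h.first (by omega)
          rwa [show K + 1 - (v + 1) = i by omega] at this
      rw [hAtab.1, hAtab.2, hBtab.1, hBtab.2]
      exact ⟨Function.update_self .., by rw [Function.update_self, val_tabulate_entry]⟩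

/-- A bound for the number of steps spent on a table for a tree with `s` vertices. -/
def tableCost (n K s : ℕ) : ℕ :=
  n ^ 2 * (12 * ((K + 1).choose s * 2 ^ s) + (11 * (K + 1) + 20) * 2 ^ (K + 1))

lemma time_tables_succ_le (hn : 1 ≤ n) (M : Fin n → Fin n → R)
    (μ : TreeStat.Coloring n K) (e : ℕ → ℕ × ℕ) {i : ℕ} (hi : i < K) :
    (tables M μ e (i + 1)).time ≤ (tables M μ e i).time +
      tableCost n K ((tables M μ e (i + 1)).val.1 (i + 1)) := by
  simp only [tables, time_bind, time_op, time_pure, val_op, val_bind, val_pure,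
    Function.update_self]
  set X := tables M μ e i
  have h1 := time_lastIncident_le e (e (i + 1)).1 i
  have h2 := time_lastIncident_le e (e (i + 1)).2 i
  set a := (lastIncident e (e (i + 1)).1 i).val
  set b := (lastIncident e (e (i + 1)).2 i).val
  set s := X.val.1 a + X.val.1 b with hs
  have h3 := time_subsetsOfSize_le s (List.finRange (K + 1))
  rw [List.length_finRange] at h3
  have h4 := time_tabulate_entry_le hn M (X.val.2 a) (X.val.2 b) s
  have h5 := Nat.choose_le_two_pow (K + 1) s
  have h6 : 1 ≤ 2 ^ (K + 1) := Nat.one_le_two_pow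
  have h7 : n * (K + 1).choose s * (n * (2 * (K + 1) + 5 + 12 * 2 ^ s) + 1) ≤
      n ^ 2 * (12 * ((K + 1).choose s * 2 ^ s) + (2 * (K + 1) + 6) * 2 ^ (K + 1)) := by
    calc n * (K + 1).choose s * (n * (2 * (K + 1) + 5 + 12 * 2 ^ s) + 1)
        ≤ n * (K + 1).choose s * (n * (2 * (K + 1) + 5 + 12 * 2 ^ s) + n) := by gcongr
      _ = n ^ 2 * (12 * ((K + 1).choose s * 2 ^ s) + (2 * (K + 1) + 6) * (K + 1).choose s) := by
          ring
      _ ≤ _ := by gcongr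
  have h8 : (3 * (K + 1) + 1) * 2 ^ (K + 1) + (6 * K + 13) ≤
      n ^ 2 * ((9 * (K + 1) + 14) * 2 ^ (K + 1)) := by
    calc (3 * (K + 1) + 1) * 2 ^ (K + 1) + (6 * K + 13)
        ≤ (3 * (K + 1) + 1) * 2 ^ (K + 1) + (6 * K + 13) * 2 ^ (K + 1) := by
          gcongr; exact Nat.le_mul_of_pos_right _ h6
      _ ≤ (9 * (K + 1) + 14) * 2 ^ (K + 1) := by
          rw [← Nat.add_mul]; exact Nat.mul_le_mul_right _ (by omega)
      _ ≤ _ := Nat.le_mul_of_pos_left _ (by positivity)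
  have h9 : tableCost n K s =
      n ^ 2 * (12 * ((K + 1).choose s * 2 ^ s) + (2 * (K + 1) + 6) * 2 ^ (K + 1)) +
        n ^ 2 * ((9 * (K + 1) + 14) * 2 ^ (K + 1)) := by
    rw [tableCost]; ring
  omega

/-- Later rounds do not change the sizes of the trees of earlier tables. -/
lemma tables_size_stable (M : Fin n → Fin n → R) (μ : TreeStat.Coloring n K)
    (e : ℕ → ℕ × ℕ) {i j : ℕ} (h : j ≤ i) :
    (tables M μ e i).val.1 j = (tables M μ e j).val.1 j := by
  induction i with
  | zero => obtain rfl : j = 0 := by omega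
            rfl
  | succ i ih =>
    rcases h.lt_or_eq with h1 | rfl
    · rw [← ih (by omega)]
      simp only [tables, val_bind, val_op, val_pure]
      rw [Function.update_of_ne (by omega)]
    · rfl

lemma time_tables_le (hn : 1 ≤ n) (M : Fin n → Fin n → R)
    (μ : TreeStat.Coloring n K) (e : ℕ → ℕ × ℕ) {i : ℕ} (hi : i ≤ K) :
    (tables M μ e i).time ≤ tableCost n K 0 +
      ∑ j ∈ Finset.range i, tableCost n K ((tables M μ e (j + 1)).val.1 (j + 1)) := by
  induction i with
  | zero =>
    have h1 := time_tableZero_le (R := R) (n := n) μ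
    have h2 : 1 ≤ 2 ^ (K + 1) := Nat.one_le_two_pow
    have h3 : (3 * (K + 1) + 1) * 2 ^ (K + 1) + n * (K + 1) * 5 + 1 + 2 ≤
        n ^ 2 * ((11 * (K + 1) + 20) * 2 ^ (K + 1)) := by
      calc (3 * (K + 1) + 1) * 2 ^ (K + 1) + n * (K + 1) * 5 + 1 + 2
          ≤ n ^ 2 * ((3 * (K + 1) + 1) * 2 ^ (K + 1)) + n ^ 2 * ((K + 1) * 5 * 2 ^ (K + 1)) +
              n ^ 2 * (3 * 2 ^ (K + 1)) := by
            have e1 : (3 * (K + 1) + 1) * 2 ^ (K + 1) ≤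
              n ^ 2 * ((3 * (K + 1) + 1) * 2 ^ (K + 1)) := Nat.le_mul_of_pos_left _ (by positivity)
            have e2 : n * (K + 1) * 5 ≤ n ^ 2 * ((K + 1) * 5 * 2 ^ (K + 1)) := by
              calc n * (K + 1) * 5 = n * ((K + 1) * 5 * 1) := by ring
                _ ≤ n ^ 2 * ((K + 1) * 5 * 2 ^ (K + 1)) := by
                  gcongr
                  exact Nat.le_self_pow (by norm_num) n
            have e3 : 3 ≤ n ^ 2 * (3 * 2 ^ (K + 1)) := by
              calc 3 = 1 * (3 * 1) := rfl
                _ ≤ _ := by gcongr; exact Nat.one_le_pow _ _ hn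
            omega
        _ = n ^ 2 * ((8 * (K + 1) + 4) * 2 ^ (K + 1)) := by ring
        _ ≤ _ := by gcongr <;> omega
    have h4 : n ^ 2 * ((11 * (K + 1) + 20) * 2 ^ (K + 1)) ≤ tableCost n K 0 := by
      rw [tableCost]; gcongr; omega
    simp only [tables, time_bind, time_op, time_pure, val_op, Finset.range_zero, Finset.sum_empty]
    omega
  | succ i ih =>
    have h1 := ih (by omega)
    have h2 := time_tables_succ_le hn M μ e (i := i) (by omega)
    rw [Finset.sum_range_succ]
    omega

/-- The number of steps for one tree and one colouring. -/
lemma time_countColorful_le (hn : 1 ≤ n) {T : PlaneTree} (hT : T.size = K + 1)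
    (M : Fin n → Fin n → R) (μ : TreeStat.Coloring n K) (a : ℕ) :
    (countColorful M μ T.levels a).time ≤ K * (2 * K + 9) + 2 * n + 4 + tableCost n K 0 +
      sizeSum (tableCost n K) T := by
  have h1 := time_edges_le K T.levels
  have h2 := time_tables_le hn M μ (edges K T.levels).val le_rfl
  have h3 : ∑ j ∈ Finset.range K,
      tableCost n K ((tables M μ (edges K T.levels).val (j + 1)).val.1 (j + 1)) =
        sizeSum (tableCost n K) T := by
    have hval := (val_tables hT M μ K le_rfl).2
    rw [← sum_segment (f := fun u =>
      tableCost n K ((tables M μ (edges K T.levels).val K).val.1 (K + 1 - u)))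
      (g := tableCost n K) (fun v A B h => ?_) T.segment_self]
    · rw [hT, Finset.sum_Ico_eq_sum_range, ← Finset.sum_range_reflect]
      rw [show 1 + (K + 1 - 1) - 1 = K by omega]
      refine Finset.sum_congr rfl fun j hj => ?_
      rw [Finset.mem_range] at hj
      rw [show K + 1 - (1 + j) = K - 1 - j + 1 by omega, tables_size_stable M μ _ (i := K) (by omega)]
    · have hv0 : 0 < v := by obtain ⟨_, _, _, _, _, h3, _⟩ := h; exact h3
      rw [(hval v A B h (by omega)).1]
  have h4 := time_sumOver_le (l := List.finRange n) (c := 1) (f := fun x => op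
    (((tables M μ (edges K T.levels).val K).val.2 K) (x, Finset.univ))) (by simp)
  rw [List.length_finRange] at h4
  simp only [countColorful, time_bind, time_op, val_op]
  omega

end Tables

/-- Colour coding computes the sum over the colourful copies. -/
theorem val_countColorful {n K : ℕ} (hK : 1 ≤ K) {T : PlaneTree} (hT : T.size = K + 1)
    {H : SimpleGraph (Fin (K + 1))} (ι : T.graph ≃g H)
    (M : Fin n → Fin n → ℝ) (hM : ∀ i j, M i j = M j i) (μ : TreeStat.Coloring n K) :
    (countColorful M μ T.levels (TreeStat.aut T.graph)).val = TreeStat.colorfulCount H M μ := by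
  classical
  have htab : (tables M μ (edges K T.levels).val K).val.2 K =
      fun key => treeSum M μ T key.1 key.2 := by
    cases T with
    | leaf => simp [size] at hT; omega
    | graft A B =>
      exact ((val_tables hT M μ K le_rfl).2 1 A B (segment_self _) (by omega)).2
  have haut : (TreeStat.aut T.graph : ℝ) ≠ 0 := by
    rw [TreeStat.aut]
    have : Finite (T.graph ≃g T.graph) :=
      Finite.of_injective (fun f => (f : T.Vert → T.Vert)) DFunLike.coe_injective
    have : Nonempty (T.graph ≃g T.graph) := ⟨SimpleGraph.Iso.refl⟩
    exact_mod_cast Nat.card_pos.ne'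
  simp only [countColorful, val_bind, val_op, val_sumOver, htab]
  rw [div_eq_iff haut, mul_comm, TreeStat.aut_mul_colorfulCount ι M hM μ, ← Fin.sum_univ_def]
  -- the sum over the images of the root removes the condition on the root, and injectivity on
  -- `K + 1` colours makes all colours occur
  simp only [treeSum_eq]
  rw [Finset.sum_comm]
  refine Finset.sum_congr rfl fun φ _ => ?_
  rw [Finset.sum_eq_single (φ T.root)]
  · refine if_congr ⟨fun h => h.2.1, fun h => ⟨rfl, h, ?_⟩⟩ rfl rfl
    refine Finset.eq_univ_of_card _ ?_
    rw [Finset.card_image_of_injective _ h, Finset.card_univ, card_vert, hT, Fintype.card_fin]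
  · exact fun x _ hx => if_neg fun h => hx h.1.symm
  · simp

end ColorCoding

/-! ### The number of trees and Otter's constant -/

namespace TreeStat

lemma UnlabeledTree.isTree_graph {K : ℕ} (τ : UnlabeledTree K) : τ.graph.IsTree := τ.out.2

lemma UnlabeledTree.eq_of_iso {K : ℕ} {τ τ' : UnlabeledTree K} (φ : τ.graph ≃g τ'.graph) :
    τ = τ' := by
  rw [← Quotient.out_eq τ, ← Quotient.out_eq τ']
  exact Quotient.sound ⟨φ⟩

lemma exists_unlabeledTree {K : ℕ} {V : Type} [Fintype V] {G : SimpleGraph V} (hG : G.IsTree)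
    (hV : Fintype.card V = K + 1) : ∃ τ : UnlabeledTree K, Nonempty (G ≃g τ.graph) := by
  have hc : Fintype.card V = Fintype.card (Fin (K + 1)) := by rw [hV, Fintype.card_fin]
  let iso := SimpleGraph.Iso.map (Fintype.equivOfCardEq hc) G
  refine ⟨Quotient.mk (treeSetoid K) ⟨_, iso.isTree_iff.1 hG⟩, ?_⟩
  have hout := Quotient.mk_out (s := treeSetoid K) ⟨_, iso.isTree_iff.1 hG⟩
  obtain ⟨ψ⟩ := hout
  exact ⟨iso.trans ψ.symm⟩

/-- Two trees with `K` edges can be joined by an edge between their vertices `0`. The result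
determines the two trees up to their order, because only one edge cuts it into equal halves. -/
lemma card_unlabeledTree_sq_le (K : ℕ) :
    Nat.card (UnlabeledTree K) ^ 2 ≤ 2 * Nat.card (UnlabeledTree (2 * K + 1)) := by
  classical
  have hex : ∀ p : UnlabeledTree K × UnlabeledTree K, ∃ τ : UnlabeledTree (2 * K + 1),
      Nonempty (SimpleGraph.joinEdge p.1.graph p.2.graph 0 0 ≃g τ.graph) := fun p =>
    exists_unlabeledTree (p.1.isTree_graph.joinEdge p.2.isTree_graph) (by simp; omega)
  choose J hJ using hex
  have hfib : ∀ p p', J p = J p' → p = p' ∨ p = p'.swap := by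
    intro p p' h
    obtain ⟨φ⟩ := hJ p
    obtain ⟨φ'⟩ := hJ p'
    rw [← h] at φ'
    have hp := fun p : UnlabeledTree K => p.isTree_graph.connected
    rcases SimpleGraph.respects_or_exchanges_sides (hp p.1) (hp p.2) (φ.trans φ'.symm) rfl rfl rfl
      with ⟨h1, h2⟩ | ⟨h1, h2⟩
    · obtain ⟨α, β, -⟩ := SimpleGraph.exists_joinEdgeCongr _ h1 h2
      exact Or.inl (Prod.ext (UnlabeledTree.eq_of_iso α) (UnlabeledTree.eq_of_iso β))
    · have hswap : ∀ x : Fin (K + 1) ⊕ Fin (K + 1), (SimpleGraph.joinEdgeComm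
          (G := p'.1.graph) (H := p'.2.graph) (a := 0) (b := 0) x).isLeft = !x.isLeft := by
        rintro (x | x) <;> rfl
      obtain ⟨α, β, -⟩ := SimpleGraph.exists_joinEdgeCongr
        ((φ.trans φ'.symm).trans SimpleGraph.joinEdgeComm)
        (fun u => by
          have := hswap ((φ.trans φ'.symm) (.inl u))
          rw [h1 u] at this
          exact this)
        (fun u => by
          have := hswap ((φ.trans φ'.symm) (.inr u))
          rw [h2 u] at this
          exact this)
      exact Or.inr (Prod.ext (UnlabeledTree.eq_of_iso α) (UnlabeledTree.eq_of_iso β))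
  have hcard := Finset.card_le_mul_card_image (f := J) Finset.univ 2 (by
    intro τ hτ
    obtain ⟨p', -, rfl⟩ := Finset.mem_image.1 hτ
    refine (Finset.card_le_card (t := {p', p'.swap}) fun p hp => ?_).trans Finset.card_le_two
    rw [Finset.mem_insert, Finset.mem_singleton]
    exact hfib p p' (Finset.mem_filter.1 hp).2)
  rw [Finset.card_univ, Fintype.card_prod] at hcard
  rw [Nat.card_eq_fintype_card, Nat.card_eq_fintype_card, sq]
  exact hcard.trans (Nat.mul_le_mul_left _ (Finset.card_le_univ _))

lemma card_unlabeledTree_le (K : ℕ) : Nat.card (UnlabeledTree K) ≤ 4 ^ K := by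
  obtain ⟨e, -⟩ := PlaneTree.exists_unlabeledTree_equiv K
  rw [Nat.card_congr e]
  exact (Set.ncard_le_ncard (fun N hN => hN.2.2) (PlaneTree.finite_setOf_size (K + 1))).trans
    (PlaneTree.ncard_setOf_size_le K)

lemma card_unlabeledTree_pos (K : ℕ) : 0 < Nat.card (UnlabeledTree K) := by
  obtain ⟨τ, -⟩ := exists_unlabeledTree (PlaneTree.isTree_graph (PlaneTree.path K))
    ((PlaneTree.card_vert _).trans (PlaneTree.size_path K))
  rw [Nat.card_eq_fintype_card]
  exact Fintype.card_pos_iff.2 ⟨τ⟩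

/-- Repeated doubling: the number of trees with `2 ^ j * (K + 1)` vertices is at
least doubly exponential in `j`. -/
lemma pow_le_card_unlabeledTree (K j : ℕ) :
    2 * ((Nat.card (UnlabeledTree K) : ℝ) / 2) ^ 2 ^ j ≤
      Nat.card (UnlabeledTree (2 ^ j * (K + 1) - 1)) := by
  induction j with
  | zero => simp; linarith
  | succ j ih =>
    have h1 := card_unlabeledTree_sq_le (2 ^ j * (K + 1) - 1)
    have h2 : 0 < 2 ^ j * (K + 1) := by positivity
    have h4 : 2 ^ (j + 1) * (K + 1) = 2 * (2 ^ j * (K + 1)) := by ring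
    rw [show 2 * (2 ^ j * (K + 1) - 1) + 1 = 2 ^ (j + 1) * (K + 1) - 1 by omega] at h1
    have h1 : (Nat.card (UnlabeledTree (2 ^ j * (K + 1) - 1)) : ℝ) ^ 2 ≤
        2 * Nat.card (UnlabeledTree (2 ^ (j + 1) * (K + 1) - 1)) := by exact_mod_cast h1
    have h3 := pow_le_pow_left₀ (by positivity) ih 2
    have h5 : ((Nat.card (UnlabeledTree K) : ℝ) / 2) ^ 2 ^ (j + 1) =
        (((Nat.card (UnlabeledTree K) : ℝ) / 2) ^ 2 ^ j) ^ 2 := by rw [pow_succ 2 j, pow_mul]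
    rw [h5]
    nlinarith

/-- The growth rate of the number of trees, the inverse of Otter's constant. -/
noncomputable def growthRate : ℝ :=
  limsup (fun K : ℕ => (Nat.card (UnlabeledTree K) : ℝ) ^ (1 / (K : ℝ))) atTop

lemma inv_otterConstant : otterConstant⁻¹ = growthRate := inv_inv _

lemma card_rpow_le (K : ℕ) : (Nat.card (UnlabeledTree K) : ℝ) ^ (1 / (K : ℝ)) ≤ 4 := by
  rcases Nat.eq_zero_or_pos K with rfl | hK
  · simp
  · have h1 : (Nat.card (UnlabeledTree K) : ℝ) ≤ 4 ^ K := by exact_mod_cast card_unlabeledTree_le K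
    calc (Nat.card (UnlabeledTree K) : ℝ) ^ (1 / (K : ℝ)) ≤ ((4 : ℝ) ^ K) ^ (1 / (K : ℝ)) :=
          Real.rpow_le_rpow (by positivity) h1 (by positivity)
      _ = 4 := by
          rw [one_div, Real.pow_rpow_inv_natCast (by norm_num) hK.ne']

lemma one_le_card_rpow (K : ℕ) : 1 ≤ (Nat.card (UnlabeledTree K) : ℝ) ^ (1 / (K : ℝ)) :=
  Real.one_le_rpow (by exact_mod_cast card_unlabeledTree_pos K) (by positivity)

lemma le_growthRate {x : ℝ}
    (h : ∃ᶠ K : ℕ in atTop, x ≤ (Nat.card (UnlabeledTree K) : ℝ) ^ (1 / (K : ℝ))) :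
    x ≤ growthRate :=
  le_limsup_of_frequently_le h (isBoundedUnder_of ⟨4, card_rpow_le⟩)

lemma one_le_growthRate : 1 ≤ growthRate :=
  le_growthRate (Frequently.of_forall one_le_card_rpow)

lemma growthRate_le : growthRate ≤ 4 :=
  limsup_le_of_le (isCoboundedUnder_le_of_le atTop one_le_card_rpow)
    (Eventually.of_forall card_rpow_le)

/-- The number of trees is bounded by its growth rate: by doubling, a larger number would persist
along a sequence of numbers of edges. -/
theorem card_unlabeledTree_le_growthRate (K : ℕ) :
    (Nat.card (UnlabeledTree K) : ℝ) ≤ 2 * growthRate ^ (K + 1) := by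
  set x := (Nat.card (UnlabeledTree K) : ℝ) / 2 with hx
  suffices h : x ≤ growthRate ^ (K + 1) by linarith
  -- for `x ≤ 1` the growth rate `≥ 1` suffices, and for `x ≥ 1` the roots are monotone
  rcases le_total x 1 with hx1 | hx1
  · exact hx1.trans (one_le_pow₀ one_le_growthRate)
  have hx0 : 0 ≤ x := by linarith
  have hroot : x ^ (1 / ((K + 1 : ℕ) : ℝ)) ≤ growthRate := by
    refine le_growthRate (frequently_atTop.2 fun N => ?_)
    have hm : N + 1 ≤ 2 ^ (N + 1) * (K + 1) - 1 := by
      have h1 : N + 1 < 2 ^ (N + 1) := Nat.lt_two_pow_self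
      have h2 : 2 ^ (N + 1) * 1 ≤ 2 ^ (N + 1) * (K + 1) := Nat.mul_le_mul_left _ (by omega)
      omega
    refine ⟨2 ^ (N + 1) * (K + 1) - 1, by omega, ?_⟩
    have h1 := pow_le_card_unlabeledTree K (N + 1)
    rw [← hx] at h1
    set k := 2 ^ (N + 1) * (K + 1) - 1 with hk
    have hk0 : (0 : ℝ) < k := by exact_mod_cast (by omega : 0 < k)
    have hkm : (k : ℝ) ≤ 2 ^ (N + 1) * ((K + 1 : ℕ) : ℝ) := by
      exact_mod_cast (by omega : k ≤ 2 ^ (N + 1) * (K + 1))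
    have h2 : x ^ 2 ^ (N + 1) ≤ Nat.card (UnlabeledTree k) := by
      have : 0 ≤ x ^ 2 ^ (N + 1) := by positivity
      linarith
    calc x ^ (1 / ((K + 1 : ℕ) : ℝ)) ≤ x ^ (((2 ^ (N + 1) : ℕ) : ℝ) * (1 / (k : ℝ))) := by
          refine Real.rpow_le_rpow_of_exponent_le hx1 ?_
          rw [mul_one_div, div_le_div_iff₀ (by positivity) hk0]
          push_cast at hkm ⊢
          linarith
      _ = (x ^ 2 ^ (N + 1)) ^ (1 / (k : ℝ)) := by
          rw [Real.rpow_mul hx0, Real.rpow_natCast]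
      _ ≤ _ := Real.rpow_le_rpow (by positivity) h2 (by positivity)
  calc x = (x ^ (1 / ((K + 1 : ℕ) : ℝ))) ^ (K + 1) := by
        rw [one_div, Real.rpow_inv_natCast_pow hx0 (by omega)]
    _ ≤ _ := pow_le_pow_left₀ (by positivity) hroot _

end TreeStat

/-! ### The number of steps of colour coding -/

/-- Polynomial factors are absorbed by a larger base. -/
lemma exists_pow_mul_pow_le (k : ℕ) {a b : ℝ} (ha : 0 ≤ a) (hab : a < b) :
    ∃ C : ℝ, 0 < C ∧ ∀ n : ℕ, (n : ℝ) ^ k * a ^ n ≤ C * b ^ n := by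
  have hb : 0 < b := ha.trans_lt hab
  have hlim := tendsto_pow_const_mul_const_pow_of_abs_lt_one k (r := a / b)
    (by rw [abs_of_nonneg (by positivity), div_lt_one hb]; exact hab)
  obtain ⟨C, hC⟩ := hlim.bddAbove_range
  refine ⟨max C 1, by positivity, fun n => ?_⟩
  have h1 : (n : ℝ) ^ k * (a / b) ^ n ≤ max C 1 := (hC ⟨n, rfl⟩).trans (le_max_left _ _)
  rw [div_pow, mul_div_assoc', div_le_iff₀ (by positivity)] at h1
  exact h1

namespace PlaneTree

lemma sizeSum_linear (f : ℕ → ℕ) (a b c : ℕ) (T : PlaneTree) :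
    sizeSum (fun s => a * (b * f s + c)) T = a * (b * sizeSum f T + (T.size - 1) * c) := by
  induction T with
  | leaf => simp [sizeSum, size]
  | graft A B ihA ihB =>
    have hA := A.size_pos
    have hB := B.size_pos
    simp only [sizeSum, ihA, ihB, size]
    obtain ⟨x, hx⟩ := Nat.exists_eq_add_of_le hA
    obtain ⟨y, hy⟩ := Nat.exists_eq_add_of_le hB
    rw [show A.size + B.size - 1 = 1 + (A.size - 1) + (B.size - 1) by omega]
    ring

/-- The smaller of the two parts into which a tree is cut has at most half of its vertices, so that
the terms for this part are at most `W`. Up to a quadratic number of such terms, the sum has at most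
one term for each size. -/
lemma sizeSum_le (w : ℕ → ℕ) {N W : ℕ} (hW : ∀ j, 2 * j ≤ N → w j ≤ W) {T : PlaneTree}
    (hT : T.size ≤ N) :
    sizeSum w T ≤ ∑ j ∈ Finset.range (T.size + 1), w j + T.size ^ 2 * W := by
  induction T with
  | leaf => simp [sizeSum]
  | graft A B ihA ihB =>
    have hA := A.size_pos
    have hB := B.size_pos
    have hs : (graft A B).size = A.size + B.size := rfl
    have h1 := ihA (by omega)
    have h2 := ihB (by omega)
    have key : ∀ a b S S', 0 < a → 0 < b → b ≤ a → a + b ≤ N →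
        S ≤ ∑ j ∈ Finset.range (a + 1), w j + a ^ 2 * W →
        S' ≤ ∑ j ∈ Finset.range (b + 1), w j + b ^ 2 * W →
        w (a + b) + S + S' ≤ ∑ j ∈ Finset.range (a + b + 1), w j + (a + b) ^ 2 * W := by
      intro a b S S' ha hb hba hN hS hS'
      have h3 : ∑ j ∈ Finset.range (a + 1), w j ≤ ∑ j ∈ Finset.range (a + b), w j :=
        Finset.sum_le_sum_of_subset (Finset.range_mono (by omega))
      have h4 : ∑ j ∈ Finset.range (b + 1), w j ≤ (b + 1) * W := by
        have := Finset.sum_le_card_nsmul (Finset.range (b + 1)) w W fun j hj => hW j (by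
          rw [Finset.mem_range] at hj; omega)
        simpa using this
      have h5 : (b + 1) * W ≤ 2 * a * b * W := Nat.mul_le_mul_right _ (by nlinarith)
      have h6 : (a + b) ^ 2 * W = a ^ 2 * W + b ^ 2 * W + 2 * a * b * W := by ring
      rw [Finset.sum_range_succ _ (a + b)]
      omega
    rw [sizeSum, hs]
    rcases le_total B.size A.size with h | h
    · exact key _ _ _ _ hA hB h (by omega) h1 h2
    · have := key _ _ _ _ hB hA h (by omega) h2 h1
      rw [add_comm B.size A.size] at this
      omega

/-- The terms `N.choose s * 2 ^ s` for all sizes `s` add up to `3 ^ N`. -/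
lemma sizeSum_choose_le {T : PlaneTree} {N : ℕ} (hT : T.size = N) :
    sizeSum (fun s => N.choose s * 2 ^ s) T ≤ 3 ^ N + N ^ 2 * (2 ^ N * 2 ^ (N / 2)) := by
  have h := sizeSum_le (fun s => N.choose s * 2 ^ s) (N := N) (W := 2 ^ N * 2 ^ (N / 2))
    (fun j hj => Nat.mul_le_mul (Nat.choose_le_two_pow _ _)
      (Nat.pow_le_pow_right (by norm_num) (by omega))) hT.le
  rw [hT] at h
  refine h.trans (Nat.add_le_add_right (le_of_eq ?_) _)
  rw [show 3 = 2 + 1 from rfl, add_pow]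
  exact Finset.sum_congr rfl fun j _ => by simp [mul_comm]

end PlaneTree

namespace ColorCoding

open Timed FreeTrees PlaneTree

/-- One tree and one colouring take `O(n² 3 ^ K)` steps. -/
theorem exists_time_countColorful_le : ∃ C : ℝ, 0 < C ∧ ∀ (n K : ℕ), 1 ≤ n →
    ∀ T : PlaneTree, T.size = K + 1 → ∀ (M : Fin n → Fin n → ℝ) (μ : TreeStat.Coloring n K)
      (a : ℕ), ((countColorful M μ T.levels a).time : ℝ) ≤ C * (n ^ 2 * 3 ^ K) := by
  have h8 : √8 < 3 := by
    rw [Real.sqrt_lt' (by norm_num)]; norm_num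
  obtain ⟨C₁, c1, hC₁⟩ := exists_pow_mul_pow_le 2 (Real.sqrt_nonneg 8) h8
  obtain ⟨C₂, c2, hC₂⟩ := exists_pow_mul_pow_le 2 (a := 2) (b := 3) (by norm_num) (by norm_num)
  refine ⟨3 * (100 * C₂ + 12 * C₁ + 12), by positivity, fun n K hn T hT M μ a => ?_⟩
  have h1 := time_countColorful_le hn hT M μ a
  have h2 : sizeSum (tableCost n K) T = n ^ 2 * (12 * sizeSum (fun s => (K + 1).choose s * 2 ^ s) T +
      (T.size - 1) * ((11 * (K + 1) + 20) * 2 ^ (K + 1))) := sizeSum_linear _ _ _ _ _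
  have h3 := sizeSum_choose_le hT
  have h4 : tableCost n K 0 ≤ n ^ 2 * (12 * 1 + (11 * (K + 1) + 20) * 2 ^ (K + 1)) := by
    simp [tableCost]
  rw [h2, hT, Nat.add_sub_cancel] at h1
  set N := K + 1 with hN
  have hn2 : 1 ≤ n ^ 2 := Nat.one_le_pow _ _ hn
  have h2N : 1 ≤ 2 ^ N := Nat.one_le_two_pow
  have hN1 : 1 ≤ N := by omega
  have hnat : (countColorful M μ T.levels a).time ≤
      n ^ 2 * (100 * (N ^ 2 * 2 ^ N) + 12 * (3 ^ N + N ^ 2 * (2 ^ N * 2 ^ (N / 2)))) := by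
    have e1 : K * (2 * K + 9) + 2 * n + 4 ≤ n ^ 2 * (17 * (N ^ 2 * 2 ^ N)) := by
      have e2 : K * (2 * K + 9) + 6 ≤ 17 * N ^ 2 := by rw [hN]; nlinarith
      calc K * (2 * K + 9) + 2 * n + 4 ≤ n ^ 2 * (K * (2 * K + 9) + 6) := by
            have := Nat.le_mul_of_pos_left (K * (2 * K + 9)) hn2
            nlinarith
        _ ≤ n ^ 2 * (17 * N ^ 2 * 1) := by rw [mul_one]; gcongr
        _ ≤ n ^ 2 * (17 * N ^ 2 * 2 ^ N) := by gcongr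
        _ = _ := by ring
    have e3 : (11 * N + 20) * 2 ^ N + 12 * 1 + K * ((11 * N + 20) * 2 ^ N) ≤
        83 * (N ^ 2 * 2 ^ N) := by
      calc (11 * N + 20) * 2 ^ N + 12 * 1 + K * ((11 * N + 20) * 2 ^ N)
          = N * (11 * N + 20) * 2 ^ N + 12 * 1 := by rw [hN]; ring
        _ ≤ N * (11 * N + 20) * 2 ^ N + 12 * 2 ^ N := by gcongr
        _ = (11 * (N * N) + 20 * N + 12) * 2 ^ N := by ring
        _ ≤ (83 * N ^ 2) * 2 ^ N := by gcongr; nlinarith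
        _ = _ := by ring
    calc (countColorful M μ T.levels a).time
        ≤ n ^ 2 * (17 * (N ^ 2 * 2 ^ N)) + n ^ 2 * (12 * 1 + (11 * N + 20) * 2 ^ N) +
          n ^ 2 * (12 * (3 ^ N + N ^ 2 * (2 ^ N * 2 ^ (N / 2))) +
            K * ((11 * N + 20) * 2 ^ N)) := by
          refine h1.trans (add_le_add (add_le_add e1 h4) ?_)
          gcongr
      _ = n ^ 2 * (17 * (N ^ 2 * 2 ^ N) + ((11 * N + 20) * 2 ^ N + 12 * 1 +
            K * ((11 * N + 20) * 2 ^ N)) + 12 * (3 ^ N + N ^ 2 * (2 ^ N * 2 ^ (N / 2)))) := by ring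
      _ ≤ n ^ 2 * (17 * (N ^ 2 * 2 ^ N) + 83 * (N ^ 2 * 2 ^ N) +
            12 * (3 ^ N + N ^ 2 * (2 ^ N * 2 ^ (N / 2)))) := by gcongr
      _ = _ := by ring
  -- the small trees contribute `O(N² 8 ^ (N / 2))`, where `√8 < 3`
  have hsqrt : (2 : ℝ) ^ N * 2 ^ (N / 2) ≤ √8 ^ N := by
    refine (pow_le_pow_iff_left₀ (by positivity) (by positivity) two_ne_zero).1 ?_
    rw [← pow_mul, mul_comm N 2, pow_mul, Real.sq_sqrt (by norm_num), mul_pow, ← pow_mul, ← pow_mul,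
      ← pow_add, show (8 : ℝ) = 2 ^ 3 by norm_num, ← pow_mul]
    exact pow_le_pow_right₀ (by norm_num) (by omega)
  have hcast : ((countColorful M μ T.levels a).time : ℝ) ≤
      n ^ 2 * (100 * (N ^ 2 * 2 ^ N) + 12 * (3 ^ N + N ^ 2 * (2 ^ N * 2 ^ (N / 2)))) := by
    exact_mod_cast hnat
  calc ((countColorful M μ T.levels a).time : ℝ)
      ≤ n ^ 2 * (100 * (N ^ 2 * 2 ^ N) + 12 * (3 ^ N + N ^ 2 * √8 ^ N)) := by
        refine hcast.trans ?_
        gcongr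
    _ ≤ n ^ 2 * (100 * (C₂ * 3 ^ N) + 12 * (3 ^ N + C₁ * 3 ^ N)) := by
        have e1 := hC₂ N
        have e2 := hC₁ N
        refine mul_le_mul_of_nonneg_left ?_ (by positivity)
        linarith
    _ = _ := by rw [hN]; ring

end ColorCoding

/-! ### Random computations -/

namespace PMF

/-- A map whose fibres all have the same size maps the uniform distribution to the uniform
distribution. -/
lemma map_uniformOfFintype_of_card {α β : Type} [Fintype α] [Nonempty α] [Fintype β] [Nonempty β]
    {f : α → β} {k : ℕ} (hf : ∀ b, Nat.card {a // f a = b} = k) :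
    (uniformOfFintype α).map f = uniformOfFintype β := by
  classical
  have hcard : Fintype.card α = Fintype.card β * k := by
    rw [Fintype.card_congr (Equiv.sigmaFiberEquiv f).symm, Fintype.card_sigma,
      Finset.sum_congr rfl (g := fun _ => k) fun b _ => by rw [← hf b, Nat.card_eq_fintype_card],
      Finset.sum_const, Finset.card_univ, smul_eq_mul]
  have hk : k ≠ 0 := by
    rintro rfl
    rw [mul_zero] at hcard
    exact Fintype.card_ne_zero hcard
  ext b
  rw [map_apply, tsum_fintype, uniformOfFintype_apply]
  simp only [uniformOfFintype_apply]
  rw [← Finset.sum_filter, Finset.sum_const, nsmul_eq_mul]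
  have : (Finset.univ.filter fun a => b = f a).card = k := by
    rw [← hf b, Nat.card_eq_fintype_card, Fintype.card_subtype]
    simp only [eq_comm]
  rw [this, hcard, Nat.cast_mul, ENNReal.mul_inv (Or.inr (by simp)) (Or.inr (by simpa using hk)),
    mul_comm, mul_assoc, ENNReal.inv_mul_cancel (by simpa using hk) (by simp), mul_one]

lemma map_uniformOfFintype_equiv {α β : Type} [Fintype α] [Nonempty α] [Fintype β] [Nonempty β]
    (e : α ≃ β) : (uniformOfFintype α).map e = uniformOfFintype β :=
  map_uniformOfFintype_of_card (k := 1) fun b => by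
    rw [Nat.card_eq_one_iff_unique]
    exact ⟨⟨fun a a' => Subtype.ext (e.injective (a.2.trans a'.2.symm))⟩, ⟨e.symm b, by simp⟩⟩

lemma map_fst_uniformOfFintype {α β : Type} [Fintype α] [Nonempty α] [Fintype β] [Nonempty β] :
    (uniformOfFintype (α × β)).map Prod.fst = uniformOfFintype α :=
  map_uniformOfFintype_of_card (k := Nat.card β) fun a => Nat.card_congr
    { toFun := fun p => p.1.2
      invFun := fun b => ⟨(a, b), rfl⟩
      left_inv := by rintro ⟨⟨_, b⟩, rfl⟩; rfl
      right_inv := fun b => rfl }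

/-- Two independent uniform elements form a uniform pair. -/
lemma uniformOfFintype_bind {α β γ : Type} [Fintype α] [Nonempty α] [Fintype β] [Nonempty β]
    (F : α → β → γ) :
    ((uniformOfFintype α).bind fun a => (uniformOfFintype β).map (F a)) =
      (uniformOfFintype (α × β)).map fun p => F p.1 p.2 := by
  have h : ((uniformOfFintype α).bind fun a => (uniformOfFintype β).map (Prod.mk a)) =
      uniformOfFintype (α × β) := by
    classical
    ext ⟨a, b⟩
    rw [bind_apply, tsum_fintype, uniformOfFintype_apply, Finset.sum_eq_single a]
    · rw [map_apply, tsum_fintype, Finset.sum_eq_single b]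
      · rw [if_pos rfl, uniformOfFintype_apply, uniformOfFintype_apply, Fintype.card_prod,
          Nat.cast_mul, ENNReal.mul_inv (Or.inr (by simp)) (Or.inr (by simp))]
      · intro b' _ hb'
        rw [if_neg]
        intro h
        exact hb' (Prod.ext_iff.1 h).2.symm
      · simp
    · intro a' _ ha'
      rw [map_apply, tsum_fintype, Finset.sum_eq_zero, mul_zero]
      intro b' _
      rw [if_neg]
      intro h
      exact ha' (Prod.ext_iff.1 h).1.symm
    · simp
  rw [← h, map_bind]
  congr 1
  funext a
  rw [map_comp]
  rfl

end PMF

namespace RandTimed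

lemma law_bind {α β : Type} (x : RandTimed α) (f : α → RandTimed β) :
    (x >>= f).law = x.law.bind fun a => (f a).law := by
  have key : ∀ (x : PMF (Timed α)) (f : α → PMF (Timed β)), PMF.map Timed.val (PMF.bind x fun a =>
      PMF.map (fun b => (⟨b.val, a.time + b.time⟩ : Timed _)) (f a.val)) =
      (PMF.map Timed.val x).bind fun a => PMF.map Timed.val (f a) := by
    intro x f
    rw [PMF.map_bind, PMF.bind_map]
    congr 1
    funext a
    rw [PMF.map_comp]
    rfl
  exact key x f

lemma law_lift {α : Type} (x : Timed α) : (lift x).law = PMF.pure x.val := PMF.pure_map _ _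

lemma law_pure {α : Type} (a : α) : (pure a : RandTimed α).law = PMF.pure a := PMF.pure_map _ _

lemma law_draw (α : Type) [Fintype α] [Nonempty α] : (draw α).law = PMF.uniformOfFintype α := by
  change PMF.map Timed.val (PMF.map Timed.op (PMF.uniformOfFintype α)) = _
  rw [PMF.map_comp]
  exact PMF.map_id _

/-- The possible runs of a computation. -/
def runs {α : Type} (x : RandTimed α) : Set (Timed α) := PMF.support x

lemma mem_runs_bind {α β : Type} {x : RandTimed α} {f : α → RandTimed β} {y : Timed β}
    (hy : y ∈ (x >>= f).runs) : ∃ a ∈ x.runs, ∃ b ∈ (f a.val).runs,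
      y = ⟨b.val, a.time + b.time⟩ := by
  obtain ⟨a, ha, hy⟩ := (PMF.mem_support_bind_iff _ _ _).1 hy
  obtain ⟨b, hb, rfl⟩ := (PMF.mem_support_map_iff _ _ _).1 hy
  exact ⟨a, ha, b, hb, rfl⟩

lemma eq_of_mem_runs_lift {α : Type} {x y : Timed α} (hy : y ∈ (lift x).runs) : y = x := by
  change y ∈ PMF.support (PMF.pure x) at hy
  simpa using hy

lemma eq_of_mem_runs_pure {α : Type} {a : α} {y : Timed α} (hy : y ∈ (pure a : RandTimed α).runs) :
    y = ⟨a, 0⟩ := by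
  change y ∈ PMF.support (PMF.pure (⟨a, 0⟩ : Timed α)) at hy
  simpa using hy

lemma time_of_mem_runs_draw {α : Type} [Fintype α] [Nonempty α] {y : Timed α}
    (hy : y ∈ (draw α).runs) : y.time = 1 := by
  change y ∈ PMF.support (PMF.map Timed.op (PMF.uniformOfFintype α)) at hy
  rw [PMF.mem_support_map_iff] at hy
  obtain ⟨b, -, rfl⟩ := hy
  rfl

end RandTimed

namespace ColorCoding

open Timed RandTimed

/-- The colours drawn so far are uniform and independent; the other vertices have the colour `0`. -/
lemma law_drawColors_aux (n K : ℕ) {l : List (Fin n)} (hl : l.Nodup) :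
    (drawColors n K l).law = (PMF.uniformOfFintype (TreeStat.Coloring n K)).map
      fun μ x => if x ∈ l then μ x else 0 := by
  induction l with
  | nil =>
    rw [drawColors, law_lift]
    simp only [List.not_mem_nil, if_false, Timed.val_op]
    exact (PMF.map_const _ _).symm
  | cons x l ih =>
    obtain ⟨hx, hl⟩ := List.nodup_cons.1 hl
    -- a uniform colouring stays uniform if the colour of `x` is drawn anew
    let e : Fin (K + 1) × TreeStat.Coloring n K ≃ TreeStat.Coloring n K × Fin (K + 1) :=
      { toFun := fun p => (Function.update p.2 x p.1, p.2 x)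
        invFun := fun p => (p.1 x, Function.update p.1 x p.2)
        left_inv := fun p => by simp
        right_inv := fun p => by simp }
    have hfst : (PMF.uniformOfFintype (Fin (K + 1) × TreeStat.Coloring n K)).map
        (fun p => Function.update p.2 x p.1) =
        PMF.uniformOfFintype (TreeStat.Coloring n K) := by
      refine Eq.trans ?_ (PMF.map_fst_uniformOfFintype (α := TreeStat.Coloring n K)
        (β := Fin (K + 1)))
      rw [← PMF.map_uniformOfFintype_equiv e, PMF.map_comp]
      rfl
    have hsplit : (PMF.uniformOfFintype (TreeStat.Coloring n K)).map
        (fun μ y => if y ∈ x :: l then μ y else 0) =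
        (PMF.uniformOfFintype (Fin (K + 1))).bind fun c =>
          (PMF.uniformOfFintype (TreeStat.Coloring n K)).map fun μ y =>
            if y ∈ x :: l then Function.update μ x c y else 0 := by
      rw [PMF.uniformOfFintype_bind fun (c : Fin (K + 1)) (μ : TreeStat.Coloring n K) y =>
        if y ∈ x :: l then Function.update μ x c y else 0, ← hfst, PMF.map_comp]
      rfl
    rw [drawColors, law_bind, law_draw, hsplit]
    simp only [law_bind, law_lift, ih hl, Timed.val_op]
    congr 1
    funext c
    rw [PMF.bind_map, ← PMF.bind_pure_comp]
    congr 1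
    funext μ
    simp only [Function.comp]
    congr 1
    funext y
    by_cases hy : y = x
    · subst hy; simp
    · simp [hy]

lemma law_drawColors (n K : ℕ) :
    (drawColors n K (List.finRange n)).law = PMF.uniformOfFintype (TreeStat.Coloring n K) := by
  rw [law_drawColors_aux n K (List.nodup_finRange n)]
  simp only [List.mem_finRange, if_true]
  exact PMF.map_id _

/-- The colourings are independent and uniform. -/
lemma law_drawColorings (n K t : ℕ) : (drawColorings n K t).law =
    (PMF.uniformOfFintype (Fin t → TreeStat.Coloring n K)).map List.ofFn := by
  induction t with
  | zero =>
    rw [drawColorings, law_lift]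
    have : (List.ofFn : (Fin 0 → TreeStat.Coloring n K) → List (TreeStat.Coloring n K)) =
        Function.const _ [] := by funext f; simp
    rw [this, PMF.map_const]
    rfl
  | succ t ih =>
    rw [drawColorings, law_bind, law_drawColors]
    simp only [law_bind, law_lift, ih, Timed.val_op]
    have hsplit := PMF.uniformOfFintype_bind
      fun (μ : TreeStat.Coloring n K) (f : Fin t → TreeStat.Coloring n K) =>
        List.ofFn (Fin.consEquiv (fun _ : Fin (t + 1) => TreeStat.Coloring n K) (μ, f))
    rw [← PMF.map_uniformOfFintype_equiv (Fin.consEquiv fun _ : Fin (t + 1) =>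
      TreeStat.Coloring n K), PMF.map_comp]
    refine Eq.trans ?_ hsplit
    congr 1
    funext μ
    rw [PMF.bind_map, ← PMF.bind_pure_comp]
    congr 1
    funext f
    simp [Fin.consEquiv, List.ofFn_succ]

lemma time_of_mem_runs_drawColors {n K : ℕ} {l : List (Fin n)} {y : Timed (TreeStat.Coloring n K)}
    (hy : y ∈ (drawColors n K l).runs) : y.time = 2 * l.length + 1 := by
  induction l generalizing y with
  | nil => rw [eq_of_mem_runs_lift hy]; rfl
  | cons x l ih =>
    obtain ⟨a, ha, b, hb, rfl⟩ := mem_runs_bind hy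
    obtain ⟨c, hc, d, hd, rfl⟩ := mem_runs_bind hb
    rw [eq_of_mem_runs_lift hd]
    have h1 := time_of_mem_runs_draw ha
    have h2 := ih hc
    simp only [h1, h2, Timed.time_op, List.length_cons]
    omega

lemma time_of_mem_runs_drawColorings {n K t : ℕ} {y : Timed (List (TreeStat.Coloring n K))}
    (hy : y ∈ (drawColorings n K t).runs) :
    y.val.length = t ∧ y.time = t * (2 * n + 2) + 1 := by
  induction t generalizing y with
  | zero => rw [eq_of_mem_runs_lift hy]; simp
  | succ t ih =>
    obtain ⟨a, ha, b, hb, rfl⟩ := mem_runs_bind hy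
    obtain ⟨c, hc, d, hd, rfl⟩ := mem_runs_bind hb
    rw [eq_of_mem_runs_lift hd]
    have h1 := time_of_mem_runs_drawColors ha
    obtain ⟨h2, h3⟩ := ih hc
    rw [List.length_finRange] at h1
    simp only [h1, h2, h3, Timed.time_op, Timed.val_op, List.length_cons]
    refine ⟨trivial, ?_⟩
    ring

end ColorCoding

/-! ### The whole algorithm -/

namespace ColorCoding

open Timed RandTimed FreeTrees PlaneTree

lemma val_power (b k : ℕ) : (power b k).val = b ^ k := by
  induction k with
  | zero => rfl
  | succ k ih => simp [power, ih, pow_succ]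

lemma time_power (b k : ℕ) : (power b k).time = k + 1 := by
  induction k with
  | zero => rfl
  | succ k ih => simp [power, ih]

lemma val_fact (k : ℕ) : (fact k).val = k.factorial := by
  induction k with
  | zero => rfl
  | succ k ih => simp [fact, ih, Nat.factorial_succ, mul_comm]

lemma time_fact (k : ℕ) : (fact k).time = 2 * k + 1 := by
  induction k with
  | zero => rfl
  | succ k ih => simp [fact, ih]; omega

lemma val_rounds (K : ℕ) : (rounds K).val = TreeStat.numRounds K := by
  simp only [rounds, val_bind, val_op, val_power, val_fact]
  have hf : 0 < (K + 1).factorial := Nat.factorial_pos _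
  have hp : 0 < (K + 1) ^ (K + 1) := by positivity
  refine eq_of_forall_ge_iff fun m => ?_
  have hf' : (0 : ℝ) < (K + 1).factorial := by exact_mod_cast hf
  rw [TreeStat.numRounds, TreeStat.colorfulProb, one_div_div, Nat.ceil_le, div_le_iff₀ hf',
    ← Nat.lt_succ_iff, Nat.div_lt_iff_lt_mul hf]
  have : ((K : ℝ) + 1) ^ (K + 1) ≤ (m : ℝ) * (K + 1).factorial ↔
      (K + 1) ^ (K + 1) ≤ m * (K + 1).factorial := by
    exact_mod_cast Iff.rfl
  rw [this, Nat.succ_mul]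
  omega

lemma time_rounds (K : ℕ) : (rounds K).time = 3 * K + 9 := by
  simp only [rounds, time_bind, time_op, val_op, time_power, time_fact]
  omega

/-- By the exponential series there are at most `2 e ^ (K + 1)` rounds. -/
lemma numRounds_le (K : ℕ) : (TreeStat.numRounds K : ℝ) ≤ 2 * Real.exp 1 ^ (K + 1) := by
  have hf : (0 : ℝ) < (K + 1).factorial := by exact_mod_cast Nat.factorial_pos _
  have h1 := Real.pow_div_factorial_le_exp ((K : ℝ) + 1) (by positivity) (K + 1)
  have h2 : Real.exp ((K : ℝ) + 1) = Real.exp 1 ^ (K + 1) := by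
    rw [← Real.exp_nat_mul]
    push_cast
    rw [mul_one]
  have h3 : (1 : ℝ) ≤ Real.exp 1 ^ (K + 1) := one_le_pow₀ (Real.one_le_exp zero_le_one)
  have h4 : (TreeStat.numRounds K : ℝ) < 1 / TreeStat.colorfulProb K + 1 := by
    refine Nat.ceil_lt_add_one ?_
    rw [TreeStat.colorfulProb]
    positivity
  rw [TreeStat.colorfulProb, one_div_div] at h4
  rw [h2] at h1
  linarith

section Rounds

variable {R : Type} [Field R] {n K : ℕ}

/-- The sums after all rounds. -/
lemma allRounds_spec (Abar Bbar : Matrix (Fin n) (Fin n) R) (T : List (List ℕ × ℕ)) {c : ℕ}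
    (hA : ∀ h ∈ T, ∀ μ : TreeStat.Coloring n K, (countColorful Abar μ h.1 h.2).time ≤ c)
    (hB : ∀ h ∈ T, ∀ μ : TreeStat.Coloring n K, (countColorful Bbar μ h.1 h.2).time ≤ c)
    (μs νs : List (TreeStat.Coloring n K)) (hlen : μs.length = νs.length)
    (fx fy : List ℕ × ℕ → R) :
    (allRounds Abar Bbar μs νs (T.map fun h => (h, (fx h, fy h)))).val =
      T.map (fun h => (h, (fx h + (μs.map fun μ => (countColorful Abar μ h.1 h.2).val).sum,
        fy h + (νs.map fun ν => (countColorful Bbar ν h.1 h.2).val).sum))) ∧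
    (allRounds Abar Bbar μs νs (T.map fun h => (h, (fx h, fy h)))).time ≤
      μs.length * (T.length * (2 * c + 4) + 1) + 1 := by
  induction μs generalizing νs fx fy with
  | nil =>
    obtain rfl : νs = [] := List.eq_nil_of_length_eq_zero hlen.symm
    simp [allRounds]
  | cons μ μs ih =>
    cases νs with
    | nil => simp at hlen
    | cons ν νs =>
      have hval : (addRound Abar Bbar μ ν (T.map fun h => (h, (fx h, fy h)))).val =
          T.map fun h => (h, (fx h + (countColorful Abar μ h.1 h.2).val,
            fy h + (countColorful Bbar ν h.1 h.2).val)) := by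
        rw [addRound, val_mapList, List.map_map]
        rfl
      have htime : (addRound Abar Bbar μ ν (T.map fun h => (h, (fx h, fy h)))).time ≤
          T.length * (2 * c + 4) + 1 := by
        have := time_mapList_le (l := T.map fun h => (h, (fx h, fy h))) (c := 2 * c + 3)
          (f := fun h : (List ℕ × ℕ) × (R × R) => do
            let x ← countColorful Abar μ h.1.1 h.1.2
            let y ← countColorful Bbar ν h.1.1 h.1.2
            let sx ← op (h.2.1 + x)
            let sy ← op (h.2.2 + y)
            op (h.1, (sx, sy))) (by
            intro h hh
            obtain ⟨h, hT, rfl⟩ := List.mem_map.1 hh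
            have h1 := hA h hT μ
            have h2 := hB h hT ν
            simp only [time_bind, time_op]
            omega)
        rwa [List.length_map] at this
      obtain ⟨h1, h2⟩ := ih νs (by simpa using hlen)
        (fun h => fx h + (countColorful Abar μ h.1 h.2).val)
        (fun h => fy h + (countColorful Bbar ν h.1 h.2).val)
      simp only [allRounds, val_bind, time_bind, hval]
      refine ⟨?_, ?_⟩
      · rw [h1]
        simp only [List.map_cons, List.sum_cons, add_assoc]
      · rw [List.length_cons, Nat.add_mul]
        omega

/-- The averages over the rounds are multiplied and added up over the trees. -/
lemma evaluate_spec (Abar Bbar : Matrix (Fin n) (Fin n) R) (t : ℕ) (T : List (List ℕ × ℕ)) {c : ℕ}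
    (hA : ∀ h ∈ T, ∀ μ : TreeStat.Coloring n K, (countColorful Abar μ h.1 h.2).time ≤ c)
    (hB : ∀ h ∈ T, ∀ μ : TreeStat.Coloring n K, (countColorful Bbar μ h.1 h.2).time ≤ c)
    (μs νs : List (TreeStat.Coloring n K)) (hlen : μs.length = νs.length) :
    (evaluate Abar Bbar t T μs νs).val =
      (T.map fun h => (h.2 : R) *
        ((μs.map fun μ => (countColorful Abar μ h.1 h.2).val).sum / t) *
        ((νs.map fun ν => (countColorful Bbar ν h.1 h.2).val).sum / t)).sum ∧
    (evaluate Abar Bbar t T μs νs).time ≤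
      μs.length * (T.length * (2 * c + 4) + 1) + 7 * T.length + 3 := by
  have hstart : (mapList (fun h : List ℕ × ℕ => op (h, ((0 : R), (0 : R)))) T).val =
      T.map fun h => (h, (0, 0)) := by
    rw [val_mapList]
    rfl
  have htime := time_mapList_le (f := fun h : List ℕ × ℕ => op (h, ((0 : R), (0 : R)))) (l := T)
    (c := 1) (by simp)
  obtain ⟨h1, h2⟩ := allRounds_spec Abar Bbar T hA hB μs νs hlen (fun _ => 0) (fun _ => 0)
  simp only [evaluate, val_bind, time_bind, hstart]
  rw [h1]
  refine ⟨?_, ?_⟩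
  · rw [val_sumOver, List.map_map]
    simp only [val_bind, val_op, zero_add]
    rfl
  · have hex : ∀ (L : List ((List ℕ × ℕ) × (R × R))) (f : (List ℕ × ℕ) × (R × R) → Timed R),
        L.length = T.length → (∀ h, (f h).time ≤ 4) → (sumOver f L).time ≤ 5 * T.length + 1 := by
      intro L f hL hf
      have := time_sumOver_le (l := L) fun h _ => hf h
      omega
    have h3 := hex _ (fun h : (List ℕ × ℕ) × (R × R) => do
      let x ← op (h.2.1 / (t : R))
      let y ← op (h.2.2 / (t : R))
      let ax ← op ((h.1.2 : R) * x)
      op (ax * y)) (List.length_map (as := T) fun h => (h, ((0 : R) +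
        (μs.map fun μ => (countColorful Abar μ h.1 h.2).val).sum,
        (0 : R) + (νs.map fun ν => (countColorful Bbar ν h.1 h.2).val).sum))) (fun h => by
          simp only [time_bind, time_op]
          omega)
    omega

end Rounds

/-- The list of trees with their numbers of automorphisms. -/
lemma treesWithAut_spec {K : ℕ} (hK : 1 ≤ K) : ∃ l : List PlaneTree,
    (treesWithAut K).val = l.map (fun T => (T.levels, TreeStat.aut T.graph)) ∧
    l.Nodup ∧ (∀ T, T ∈ l ↔ T.IsFree (K + 1)) ∧
    (treesWithAut K).time ≤ l.length * (210 * K ^ 2) + 2 * K + 4 := by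
  obtain ⟨l, l1, l2, l3, l4⟩ := freeTrees_spec hK
  refine ⟨l, ?_, l2, l3, ?_⟩
  · simp only [treesWithAut, val_bind, l1, val_mapList, List.map_map]
    refine List.map_congr_left fun T hT => ?_
    obtain ⟨h1, h2, h3⟩ := (l3 T).1 hT
    simp only [Function.comp, val_op, val_autCount h1 h2 (by omega)]
  · have h5 := time_mapList_le (l := l.map levels) (c := 8 * (K + 1) ^ 2 + 30 * (K + 1) + 1)
      (f := fun L => do
        let a ← autCount L
        op (L, a)) (by
        intro L hL
        obtain ⟨T, hT, rfl⟩ := List.mem_map.1 hL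
        obtain ⟨h1, h2, h3⟩ := (l3 T).1 hT
        have := time_autCount_le (T := T) (by omega)
        rw [h3] at this
        simp only [time_bind, time_op]
        omega)
    rw [List.length_map] at h5
    have h6 : l.length * (38 * K + 71) + l.length * (8 * (K + 1) ^ 2 + 30 * (K + 1) + 1 + 1) ≤
        l.length * (210 * K ^ 2) := by
      rw [← Nat.mul_add]
      exact Nat.mul_le_mul_left _ (by nlinarith)
    simp only [treesWithAut, time_bind, l1]
    omega

/-- Sums over the listed trees are sums over the isomorphism classes. -/
lemma sum_freeTrees {K : ℕ} {l : List PlaneTree} (hl : l.Nodup)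
    (hmem : ∀ T, T ∈ l ↔ T.IsFree (K + 1)) (f : PlaneTree → ℝ) (g : TreeStat.UnlabeledTree K → ℝ)
    (hfg : ∀ T τ, T.IsFree (K + 1) → (T.graph ≃g τ.graph) → f T = g τ) :
    (l.map f).sum = ∑ τ, g τ := by
  classical
  obtain ⟨e, he⟩ := exists_unlabeledTree_equiv K
  let _ : Fintype {T : PlaneTree // T.IsFree (K + 1)} := Fintype.ofEquiv _ e
  rw [← List.sum_toFinset f hl, Finset.sum_subtype l.toFinset (p := fun T => T.IsFree (K + 1))
    (fun T => by rw [List.mem_toFinset, hmem]), ← Equiv.sum_comp e]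
  refine Finset.sum_congr rfl fun τ _ => ?_
  obtain ⟨φ⟩ := he τ
  exact hfg _ _ (e τ).2 φ

lemma length_freeTrees {K : ℕ} {l : List PlaneTree} (hl : l.Nodup)
    (hmem : ∀ T, T ∈ l ↔ T.IsFree (K + 1)) :
    (l.length : ℝ) = Nat.card (TreeStat.UnlabeledTree K) := by
  have := sum_freeTrees hl hmem (fun _ => 1) (fun _ => 1) fun _ _ _ _ => rfl
  rw [Nat.card_eq_fintype_card]
  simpa using this

/-- For every outcome of the colourings the statistic is computed. -/
lemma val_evaluate {n K : ℕ} (hK : 1 ≤ K) {l : List PlaneTree} (hl : l.Nodup)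
    (hmem : ∀ T, T ∈ l ↔ T.IsFree (K + 1)) {Abar Bbar : Matrix (Fin n) (Fin n) ℝ}
    (hA : ∀ i j, Abar i j = Abar j i) (hB : ∀ i j, Bbar i j = Bbar j i)
    (μ ν : Fin (TreeStat.numRounds K) → TreeStat.Coloring n K) :
    (evaluate Abar Bbar (TreeStat.numRounds K)
      (l.map fun T => (T.levels, TreeStat.aut T.graph)) (List.ofFn μ) (List.ofFn ν)).val =
      TreeStat.statisticY Abar Bbar μ ν := by
  -- some bound for the times is needed to apply the lemma on values and times
  have hbound : ∃ c, (∀ h ∈ l.map fun T => (T.levels, TreeStat.aut T.graph),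
      ∀ μ : TreeStat.Coloring n K, (countColorful Abar μ h.1 h.2).time ≤ c) ∧
      ∀ h ∈ l.map fun T => (T.levels, TreeStat.aut T.graph),
      ∀ μ : TreeStat.Coloring n K, (countColorful Bbar μ h.1 h.2).time ≤ c := by
    have hfin : ∀ M : Matrix (Fin n) (Fin n) ℝ, ∃ c,
        ∀ h ∈ l.map fun T => (T.levels, TreeStat.aut T.graph),
          ∀ μ : TreeStat.Coloring n K, (countColorful M μ h.1 h.2).time ≤ c := by
      intro M
      refine ⟨((l.map fun T => (T.levels, TreeStat.aut T.graph)).toFinset ×ˢ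
        (Finset.univ : Finset (TreeStat.Coloring n K))).sup
          fun p => (countColorful M p.2 p.1.1 p.1.2).time, fun h hh μ => ?_⟩
      exact Finset.le_sup (f := fun p : (List ℕ × ℕ) × TreeStat.Coloring n K =>
        (countColorful M p.2 p.1.1 p.1.2).time) (b := (h, μ)) (by simpa using hh)
    obtain ⟨c, hc⟩ := hfin Abar
    obtain ⟨c', hc'⟩ := hfin Bbar
    exact ⟨max c c', fun h hh μ => (hc h hh μ).trans (le_max_left _ _),
      fun h hh μ => (hc' h hh μ).trans (le_max_right _ _)⟩
  obtain ⟨c, hcA, hcB⟩ := hbound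
  rw [(evaluate_spec Abar Bbar _ _ hcA hcB _ _ (by simp)).1, List.map_map]
  refine sum_freeTrees hl hmem _ _ fun T τ hT φ => ?_
  have haut : TreeStat.aut T.graph = TreeStat.aut τ.graph := Nat.card_congr
    { toFun := fun f => (φ.symm.trans f).trans φ
      invFun := fun f => (φ.trans f).trans φ.symm
      left_inv := fun f => by ext; simp
      right_inv := fun f => by ext; simp }
  have hcA' := fun i => val_countColorful hK hT.2.2 φ Abar hA (μ i)
  have hcB' := fun i => val_countColorful hK hT.2.2 φ Bbar hB (ν i)
  simp only [haut] at hcA' hcB'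
  simp only [Function.comp, List.map_ofFn, List.sum_ofFn, hcA', hcB', haut, one_div,
    inv_mul_eq_div]

lemma law_algorithm {n K : ℕ} (hK : 1 ≤ K) {Abar Bbar : Matrix (Fin n) (Fin n) ℝ}
    (hA : ∀ i j, Abar i j = Abar j i) (hB : ∀ i j, Bbar i j = Bbar j i) :
    (algorithm K Abar Bbar).law =
      (PMF.uniformOfFintype ((Fin (TreeStat.numRounds K) → TreeStat.Coloring n K) ×
        (Fin (TreeStat.numRounds K) → TreeStat.Coloring n K))).map
        fun c => (List.ofFn c.1, List.ofFn c.2, TreeStat.statisticY Abar Bbar c.1 c.2) := by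
  obtain ⟨l, l1, l2, l3, -⟩ := treesWithAut_spec hK
  rw [← PMF.uniformOfFintype_bind fun μ ν =>
    (List.ofFn μ, List.ofFn ν, TreeStat.statisticY Abar Bbar μ ν)]
  simp only [algorithm, law_bind, law_lift, law_pure, PMF.pure_bind, l1, val_rounds,
    law_drawColorings]
  rw [PMF.bind_map]
  congr 1
  funext μ
  simp only [Function.comp]
  rw [PMF.bind_map, ← PMF.bind_pure_comp]
  congr 1
  funext ν
  simp only [Function.comp, val_evaluate hK l2 l3 hA hB]

lemma time_algorithm_le {n K : ℕ} (hK : 1 ≤ K) {Abar Bbar : Matrix (Fin n) (Fin n) ℝ} {c : ℕ}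
    (hc : ∀ T : PlaneTree, T.size = K + 1 → ∀ (M : Fin n → Fin n → ℝ) (μ : TreeStat.Coloring n K)
      (a : ℕ), (countColorful M μ T.levels a).time ≤ c) {y}
    (hy : y ∈ (algorithm K Abar Bbar).runs) :
    y.time ≤ Nat.card (TreeStat.UnlabeledTree K) *
        (210 * K ^ 2 + TreeStat.numRounds K * (2 * c + 4) + 7) +
      TreeStat.numRounds K * (4 * n + 5) + 5 * K + 18 := by
  obtain ⟨l, l1, l2, l3, l4⟩ := treesWithAut_spec hK
  have hlen : l.length = Nat.card (TreeStat.UnlabeledTree K) := by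
    exact_mod_cast length_freeTrees l2 l3
  obtain ⟨a₁, h₁, b₁, hy1, rfl⟩ := mem_runs_bind hy
  obtain ⟨a₂, h₂, b₂, hy2, rfl⟩ := mem_runs_bind hy1
  obtain ⟨a₃, h₃, b₃, hy3, rfl⟩ := mem_runs_bind hy2
  obtain ⟨a₄, h₄, b₄, hy4, rfl⟩ := mem_runs_bind hy3
  obtain ⟨a₅, h₅, b₅, hy5, rfl⟩ := mem_runs_bind hy4
  have e₁ := eq_of_mem_runs_lift h₁
  have e₂ := eq_of_mem_runs_lift h₂
  have e₅ := eq_of_mem_runs_lift h₅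
  subst e₁ e₂ e₅
  rw [eq_of_mem_runs_pure hy5]
  rw [val_rounds] at h₃ h₄
  obtain ⟨g₁, g₂⟩ := time_of_mem_runs_drawColorings h₃
  obtain ⟨g₃, g₄⟩ := time_of_mem_runs_drawColorings h₄
  have hT : ∀ M : Matrix (Fin n) (Fin n) ℝ, ∀ h ∈ (treesWithAut K).val,
      ∀ μ : TreeStat.Coloring n K, (countColorful M μ h.1 h.2).time ≤ c := by
    intro M h hh μ
    rw [l1] at hh
    obtain ⟨T, hT, rfl⟩ := List.mem_map.1 hh
    exact hc T ((l3 T).1 hT).2.2 M μ _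
  have h6 := (evaluate_spec Abar Bbar (rounds K).val (treesWithAut K).val (hT Abar) (hT Bbar)
    a₃.val a₄.val (by rw [g₁, g₃])).2
  have hl : (treesWithAut K).val.length = Nat.card (TreeStat.UnlabeledTree K) := by
    rw [l1, List.length_map, hlen]
  rw [g₁, hl] at h6
  rw [hlen] at l4
  simp only [time_rounds, g₂, g₄]
  have h7 : Nat.card (TreeStat.UnlabeledTree K) *
        (210 * K ^ 2 + TreeStat.numRounds K * (2 * c + 4) + 7) +
      TreeStat.numRounds K * (4 * n + 5) =
      Nat.card (TreeStat.UnlabeledTree K) * (210 * K ^ 2) +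
      TreeStat.numRounds K * (Nat.card (TreeStat.UnlabeledTree K) * (2 * c + 4) + 1) +
      7 * Nat.card (TreeStat.UnlabeledTree K) + 2 * (TreeStat.numRounds K * (2 * n + 2)) := by ring
  omega

end ColorCoding

/-! ### The running time -/

namespace TreeStat

lemma centeredAdj_symm {n : ℕ} (q : ℝ) (G : SimpleGraph (Fin n)) (i j : Fin n) :
    centeredAdj q G i j = centeredAdj q G j i := by
  by_cases h : G.Adj i j
  · simp [centeredAdj, eq_comm (a := i), h, h.symm]
  · have h' : ¬G.Adj j i := fun h' => h h'.symm
    simp [centeredAdj, eq_comm (a := i), h, h']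

end TreeStat

namespace ColorCoding

open Timed RandTimed TreeStat

/-- Every run takes `O(n² (3 e / α) ^ K)` steps: there are `O(α⁻¹ ^ K)` trees and `O(e ^ K)` rounds,
and `O(n² 3 ^ K)` steps for one tree in one round. -/
theorem exists_runsWithin_algorithm : ∃ C : ℝ, 0 < C ∧ ∀ (n K : ℕ), 1 ≤ n → 1 ≤ K →
    ∀ Abar Bbar : Matrix (Fin n) (Fin n) ℝ, (algorithm K Abar Bbar).RunsWithin
      (C * ((n : ℝ) ^ 2 * (3 * Real.exp 1 / otterConstant) ^ K)) := by
  obtain ⟨C₁, c1, hC₁⟩ := exists_time_countColorful_le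
  obtain ⟨C₂, c2, hC₂⟩ := exists_pow_mul_pow_le 2 (a := 1) (b := 3) (by norm_num) (by norm_num)
  refine ⟨96 * C₁ + 1680 * C₂ + 400, by positivity, fun n K hn hK Abar Bbar y hy => ?_⟩
  rw [div_eq_mul_inv, inv_otterConstant, mul_pow, mul_pow]
  have hcount := card_unlabeledTree_le_growthRate K
  have hround := numRounds_le K
  have hg1 := one_le_growthRate
  have hg4 := growthRate_le
  have hE1 : 1 ≤ Real.exp 1 := Real.one_le_exp zero_le_one
  have hE3 : Real.exp 1 ≤ 3 := Real.exp_one_lt_d9.le.trans (by norm_num)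
  have hn1 : (1 : ℝ) ≤ n := by exact_mod_cast hn
  have hK1 : (1 : ℝ) ≤ K := by exact_mod_cast hK
  have ht := time_algorithm_le hK (c := ⌊C₁ * ((n : ℝ) ^ 2 * 3 ^ K)⌋₊)
    (fun T hT M μ a => Nat.le_floor (hC₁ n K hn T hT M μ a)) hy
  have ht' : (y.time : ℝ) ≤ Nat.card (UnlabeledTree K) * (210 * (K : ℝ) ^ 2 + numRounds K *
      (2 * (⌊C₁ * ((n : ℝ) ^ 2 * 3 ^ K)⌋₊ : ℝ) + 4) + 7) + numRounds K * (4 * (n : ℝ) + 5) +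
        5 * K + 18 := by exact_mod_cast ht
  have hc : (⌊C₁ * ((n : ℝ) ^ 2 * 3 ^ K)⌋₊ : ℝ) ≤ C₁ * ((n : ℝ) ^ 2 * 3 ^ K) :=
    Nat.floor_le (by positivity)
  have hK2 := hC₂ K
  rw [one_pow, mul_one] at hK2
  have hN : (Nat.card (UnlabeledTree K) : ℝ) ≤ 8 * growthRate ^ K := by
    rw [pow_succ] at hcount
    have : 0 < growthRate ^ K := by positivity
    nlinarith
  have hR : (numRounds K : ℝ) ≤ 6 * Real.exp 1 ^ K := by
    rw [pow_succ] at hround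
    have : 0 < Real.exp 1 ^ K := by positivity
    nlinarith
  have hKpow : (K : ℝ) ≤ 3 ^ K := by exact_mod_cast (Nat.lt_pow_self (by norm_num)).le
  have h3 : (1 : ℝ) ≤ 3 ^ K := one_le_pow₀ (by norm_num)
  have hg : 1 ≤ growthRate ^ K := one_le_pow₀ hg1
  have hE : 1 ≤ Real.exp 1 ^ K := one_le_pow₀ hE1
  have hn2 : (1 : ℝ) ≤ (n : ℝ) ^ 2 := one_le_pow₀ hn1
  have hnn : 4 * (n : ℝ) + 5 ≤ 9 * (n : ℝ) ^ 2 := by nlinarith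
  generalize growthRate ^ K = g at *
  generalize Real.exp 1 ^ K = e at *
  generalize (3 : ℝ) ^ K = w at *
  generalize (n : ℝ) ^ 2 = m at *
  have hmw : 1 ≤ m * w := one_le_mul_of_one_le_of_one_le hn2 h3
  have hmwe : 1 ≤ m * w * e := one_le_mul_of_one_le_of_one_le hmw hE
  have hge : 1 ≤ g * e := one_le_mul_of_one_le_of_one_le hg hE
  calc (y.time : ℝ) ≤ 8 * g * (210 * (C₂ * w) + 6 * e * (2 * (C₁ * (m * w)) + 4) + 7) +
        6 * e * (9 * m) + 5 * w + 18 := by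
        refine ht'.trans ?_
        gcongr
    _ = 96 * C₁ * (m * (w * e * g)) + 1680 * C₂ * (w * g) + 192 * (g * e) + 56 * g + 54 * (e * m) +
        5 * w + 18 := by ring
    _ ≤ 96 * C₁ * (m * (w * e * g)) + 1680 * C₂ * (m * (w * e * g)) + 192 * (m * (w * e * g)) +
        56 * (m * (w * e * g)) + 54 * (m * (w * e * g)) + 5 * (m * (w * e * g)) +
        18 * (m * (w * e * g)) := by
      have f1 : w * g ≤ m * (w * e * g) :=
        (le_mul_of_one_le_right (by positivity) (one_le_mul_of_one_le_of_one_le hn2 hE)).trans_eq (by ring)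
      have f2 : g * e ≤ m * (w * e * g) :=
        (le_mul_of_one_le_right (by positivity) (hmw)).trans_eq (by ring)
      have f3 : g ≤ m * (w * e * g) :=
        (le_mul_of_one_le_right (by positivity) (hmwe)).trans_eq (by ring)
      have f4 : e * m ≤ m * (w * e * g) :=
        (le_mul_of_one_le_right (by positivity) (one_le_mul_of_one_le_of_one_le h3 hg)).trans_eq (by ring)
      have f5 : w ≤ m * (w * e * g) :=
        (le_mul_of_one_le_right (by positivity) (one_le_mul_of_one_le_of_one_le hn2 hge)).trans_eq (by ring)
      have f6 : 1 ≤ m * (w * e * g) :=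
        (one_le_mul_of_one_le_of_one_le hmwe hg).trans_eq (by ring)
      gcongr
      linarith
    _ ≤ _ := by
      have : 0 ≤ m * (w * e * g) := by positivity
      linarith

end ColorCoding

/-- In the regime of interest `K = O(log n / log log n) = o(log n)`, so that exponential factors in
`K` are `n ^ o(1)`. -/
lemma TreeStat.Regime.exists_rpow {q ρ : ℕ → ℝ} {K : ℕ → ℕ} (h : Regime q ρ K) {C B : ℝ}
    (hC : 0 < C) (hB : 1 ≤ B) : ∃ δ : ℕ → ℝ, Tendsto δ atTop (𝓝 0) ∧
      ∀ᶠ n : ℕ in atTop, C * ((n : ℝ) ^ 2 * B ^ K n) = (n : ℝ) ^ (2 + δ n) := by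
  have hlog : Tendsto (fun n : ℕ => Real.log n) atTop atTop :=
    Real.tendsto_log_atTop.comp tendsto_natCast_atTop_atTop
  have hloglog : Tendsto (fun n : ℕ => Real.log (Real.log n)) atTop atTop :=
    Real.tendsto_log_atTop.comp hlog
  have hK : Tendsto (fun n => (K n : ℝ) / Real.log n) atTop (𝓝 0) := by
    have hlim : Tendsto (fun n : ℕ => (16 * Real.log (Real.log n))⁻¹) atTop (𝓝 0) :=
      (hloglog.const_mul_atTop (by norm_num : (0 : ℝ) < 16)).inv_tendsto_atTop
    refine squeeze_zero' ?_ ?_ hlim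
    · filter_upwards [hlog.eventually_gt_atTop 0] with n hn
      positivity
    · filter_upwards [hlog.eventually_gt_atTop 0, hloglog.eventually_gt_atTop 0, h.K_le]
        with n h1 h2 h3
      rw [div_le_iff₀ h1, mul_comm, ← div_eq_mul_inv]
      exact h3.trans (div_le_div_of_nonneg_left h1.le (by positivity) (le_max_left _ _))
  refine ⟨fun n => Real.log C / Real.log n + (K n : ℝ) / Real.log n * Real.log B, ?_, ?_⟩
  · simpa using (tendsto_const_nhds.div_atTop hlog).add (hK.mul_const (Real.log B))
  · filter_upwards [hlog.eventually_gt_atTop 0, eventually_gt_atTop 0] with n h1 h2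
    have hn : (0 : ℝ) < n := by exact_mod_cast h2
    rw [Real.rpow_add hn, Real.rpow_two, Real.rpow_def_of_pos hn,
      show Real.log n * (Real.log C / Real.log n + (K n : ℝ) / Real.log n * Real.log B) =
        Real.log C + K n * Real.log B by field_simp, Real.exp_add, Real.exp_log hC,
      Real.exp_nat_mul, Real.exp_log (by linarith)]
    ring

theorem mainTheorem6 :
    -- the algorithm computes the statistic, in time `O(n² (3e/α)^K)`
    (∃ C : ℝ, 0 < C ∧ ∀ (n K : ℕ), 1 ≤ n → 1 ≤ K → ∀ q : ℝ, 0 < q → q < 1 →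
      ∀ G₁ G₂ : SimpleGraph (Fin n),
        (ColorCoding.algorithm K
            (TreeStat.centeredAdj q G₁) (TreeStat.centeredAdj q G₂)).law =
          (PMF.uniformOfFintype ((Fin (TreeStat.numRounds K) → TreeStat.Coloring n K) ×
              (Fin (TreeStat.numRounds K) → TreeStat.Coloring n K))).map
            (fun c => (List.ofFn c.1, List.ofFn c.2,
              TreeStat.statisticY (TreeStat.centeredAdj q G₁) (TreeStat.centeredAdj q G₂)
                c.1 c.2)) ∧
        (ColorCoding.algorithm K
            (TreeStat.centeredAdj q G₁) (TreeStat.centeredAdj q G₂)).RunsWithin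
          (C * ((n : ℝ) ^ 2 * (3 * Real.exp 1 / TreeStat.otterConstant) ^ K))) ∧
    -- in the regime of interest the time is `n^(2 + o(1))`
    (∀ (q ρ : ℕ → ℝ) (K : ℕ → ℕ), TreeStat.Regime q ρ K →
      ∃ δ : ℕ → ℝ, Tendsto δ atTop (𝓝 0) ∧ ∀ᶠ n : ℕ in atTop,
        ∀ G₁ G₂ : SimpleGraph (Fin n),
          (ColorCoding.algorithm (K n)
              (TreeStat.centeredAdj (q n) G₁) (TreeStat.centeredAdj (q n) G₂)).RunsWithin
            ((n : ℝ) ^ (2 + δ n))) := by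
  obtain ⟨C, hC, hrun⟩ := ColorCoding.exists_runsWithin_algorithm
  refine ⟨⟨C, hC, fun n K hn hK q _ _ G₁ G₂ =>
    ⟨ColorCoding.law_algorithm hK (TreeStat.centeredAdj_symm q G₁) (TreeStat.centeredAdj_symm q G₂),
      hrun n K hn hK _ _⟩⟩, fun q ρ K h => ?_⟩
  have hB : 1 ≤ 3 * Real.exp 1 / TreeStat.otterConstant := by
    rw [div_eq_mul_inv, TreeStat.inv_otterConstant]
    have := TreeStat.one_le_growthRate
    have := Real.one_le_exp (zero_le_one (α := ℝ))
    nlinarith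
  obtain ⟨δ, hδ, hpow⟩ := h.exists_rpow hC hB
  refine ⟨δ, hδ, ?_⟩
  filter_upwards [hpow, eventually_ge_atTop 1, h.K_tendsto.eventually_ge_atTop 1]
    with n h1 hn hK G₁ G₂
  rw [← h1]
  exact hrun n (K n) hn hK _ _
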